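/- Let $V=\{v_1,\dots,v_n\}$, $n\ge 1$, be customers in the Euclidean plane with positive weights $w(v_i)$, no three collinear and no two sharing an $x$- or a $y$-coordinate, and let $R\ge 0$. For points $x,y$ let $W(y\,|\,x)$ be the total weight of the customers $v$ with $d(v,y)<d(v,x)$, and let the weight loss of $x$ be $$W^*(x)=\max\{W(y\,|\,x) : y\in\mathbb{R}^2,\ d(x,y)\ge R\}.$$ There are a preprocessing algorithm and a query algorithm for the real RAM (unit-cost $+,-,\times,/,\sqrt{\ }$ and comparison of real numbers, and unit-cost addition, truncated subtraction, halving and comparison of natural numbers, which serve as counters and array addresses), fixed independently of the instance, and an absolute constant $C>0$ such that the following holds for every instance $(V,w,R)$ as above. (i) The preprocessing algorithm, given $n$, $V$, $w$ and $R$, halts after at most $C\,n^2\log (n+1)$, that is $O(n^2\log n)$, steps. (ii) After the preprocessing, and after any number of earlier queries, the query algorithm, given any real number $a$, i.e. the vertical line $L=\{(x_1,x_2): x_1=a\}$, halts after at most $C\,n\log^2 (n+1)$, that is $O(n\log^2 n)$, steps. It outputs one of the two open half-planes bounded by $L$ (left or right) and a point $p\in L$ such that $W^*(x')\ge W^*(p)$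 for every point $x'$ of that half-plane, so that this half-plane can be discarded in the search for a point of minimum weight loss. -/

import Mathlib

open scoped BigOperators

/-! ## The competitive location problem -/

/-- The Euclidean plane. -/
abbrev Plane : Type := EuclideanSpace ℝ (Fin 2)

/-- The data of an instance with `n` customers: their positions, their weights (buying powers),
and the minimal distance `R` between the two facilities. -/
structure Market (n : ℕ) where
  pos : Fin n → Plane
  weight : Fin n → ℝ
  R : ℝ

/-- The standing assumptions: positive weights, `R ≥ 0`, and customers in general position, that
is, no three are collinear and no two share an `x`- or a `y`-coordinate. -/
structure Market.Admissible {n : ℕ} (M : Market n) : Prop where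
  weight_pos : ∀ i, 0 < M.weight i
  R_nonneg : 0 ≤ M.R
  x_injective : Function.Injective fun i => M.pos i 0
  y_injective : Function.Injective fun i => M.pos i 1
  not_collinear : ∀ i j k, i ≠ j → i ≠ k → j ≠ k →
    ¬ Collinear ℝ {M.pos i, M.pos j, M.pos k}

open Classical in
/-- The total weight of the customers that prefer the follower at `y` to the leader at `x`
(ties are broken in favour of the leader). -/
noncomputable def Market.capture {n : ℕ} (M : Market n) (x y : Plane) : ℝ :=
  ∑ i with dist (M.pos i) y < dist (M.pos i) x, M.weight i

/-- The weight loss `W*(x)`: the largest capture of a follower at distance at least `R` from `x`.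
It is a maximum, see `Market.isGreatest_weightLoss`. -/
noncomputable def Market.weightLoss {n : ℕ} (M : Market n) (x : Plane) : ℝ :=
  sSup {c | ∃ y : Plane, M.R ≤ dist y x ∧ M.capture x y = c}

theorem Market.isGreatest_weightLoss {n : ℕ} (M : Market n) (x : Plane) :
    IsGreatest {c | ∃ y : Plane, M.R ≤ dist y x ∧ M.capture x y = c} (M.weightLoss x) := by
  classical
  have hfin : {c | ∃ y : Plane, M.R ≤ dist y x ∧ M.capture x y = c}.Finite := by
    apply (Set.finite_range fun s : Finset (Fin n) => ∑ i ∈ s, M.weight i).subset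
    rintro c ⟨y, -, rfl⟩
    exact ⟨Finset.univ.filter fun i => dist (M.pos i) y < dist (M.pos i) x, by
      unfold Market.capture; congr⟩
  have hne : {c | ∃ y : Plane, M.R ≤ dist y x ∧ M.capture x y = c}.Nonempty := by
    obtain ⟨u, hu⟩ := NormedSpace.exists_lt_norm ℝ Plane M.R
    exact ⟨_, x + u, by simpa [dist_eq_norm] using hu.le, rfl⟩
  exact ⟨hne.csSup_mem hfin, fun c hc => le_csSup hfin.bddAbove hc⟩

/-- The two sides of a vertical line. -/
inductive Side where
  | left
  | right

/-- The open half-plane strictly to the given side of the vertical line with abscissa `a`. -/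
def Side.halfPlane : Side → ℝ → Set Plane
  | .left, a => {x | x 0 < a}
  | .right, a => {x | a < x 0}

/-! ## The real RAM

A machine whose memory consists of arrays of natural numbers (for counters and addresses) and of
arrays of real numbers. A program text names finitely many arrays. Real cells admit exact
`+`, `-`, `*`, `/`, square root and comparison; natural-number cells admit addition, truncated
subtraction, halving and comparison. There is no conversion between reals and naturals.
Every operation, memory access and comparison costs one step.
-/

/-- Memory: `nat k i` and `real k i` are the `i`-th cells of the `k`-th arrays. -/
structure State where
  nat : ℕ → ℕ → ℕ
  real : ℕ → ℕ → ℝ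

/-- Natural-number expressions. -/
inductive NExpr where
  | lit (k : ℕ)
  | get (k : ℕ) (i : NExpr)
  | add (e f : NExpr)
  | sub (e f : NExpr)
  | half (e : NExpr)

def NExpr.eval (s : State) : NExpr → ℕ
  | .lit k => k
  | .get k i => s.nat k (i.eval s)
  | .add e f => e.eval s + f.eval s
  | .sub e f => e.eval s - f.eval s
  | .half e => e.eval s / 2

def NExpr.cost : NExpr → ℕ
  | .lit _ => 1
  | .get _ i => i.cost + 1
  | .add e f => e.cost + f.cost + 1
  | .sub e f => e.cost + f.cost + 1
  | .half e => e.cost + 1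

/-- Real expressions. -/
inductive RExpr where
  | lit (z : ℤ)
  | get (k : ℕ) (i : NExpr)
  | add (e f : RExpr)
  | sub (e f : RExpr)
  | mul (e f : RExpr)
  | div (e f : RExpr)
  | sqrt (e : RExpr)

/-- Division by zero and the square root of a negative number return `0`. -/
noncomputable def RExpr.eval (s : State) : RExpr → ℝ
  | .lit z => z
  | .get k i => s.real k (i.eval s)
  | .add e f => e.eval s + f.eval s
  | .sub e f => e.eval s - f.eval s
  | .mul e f => e.eval s * f.eval s
  | .div e f => e.eval s / f.eval s
  | .sqrt e => Real.sqrt (e.eval s)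

def RExpr.cost : RExpr → ℕ
  | .lit _ => 1
  | .get _ i => i.cost + 1
  | .add e f => e.cost + f.cost + 1
  | .sub e f => e.cost + f.cost + 1
  | .mul e f => e.cost + f.cost + 1
  | .div e f => e.cost + f.cost + 1
  | .sqrt e => e.cost + 1

/-- Tests. -/
inductive Test where
  | nlt (e f : NExpr)
  | rlt (e f : RExpr)
  | not (b : Test)
  | and (b c : Test)

def Test.Holds (s : State) : Test → Prop
  | .nlt e f => e.eval s < f.eval s
  | .rlt e f => e.eval s < f.eval s
  | .not b => ¬ b.Holds s
  | .and b c => b.Holds s ∧ c.Holds s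

def Test.cost : Test → ℕ
  | .nlt e f => e.cost + f.cost + 1
  | .rlt e f => e.cost + f.cost + 1
  | .not b => b.cost + 1
  | .and b c => b.cost + c.cost + 1

/-- Programs. `nset k i e` and `rset k i e` store the value of `e` in the `i`-th cell of the
`k`-th array of naturals, respectively reals. -/
inductive Prog where
  | skip
  | nset (k : ℕ) (i e : NExpr)
  | rset (k : ℕ) (i : NExpr) (e : RExpr)
  | seq (p q : Prog)
  | ite (b : Test) (p q : Prog)
  | loop (b : Test) (p : Prog)

def State.setNat (s : State) (k i v : ℕ) : State where
  nat := Function.update s.nat k (Function.update (s.nat k) i v)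
  real := s.real

noncomputable def State.setReal (s : State) (k i : ℕ) (v : ℝ) : State where
  nat := s.nat
  real := Function.update s.real k (Function.update (s.real k) i v)

/-- `Exec p s t s'`: started in `s`, the program `p` halts in `s'` after exactly `t` steps. -/
inductive Exec : Prog → State → ℕ → State → Prop
  | skip (s : State) : Exec .skip s 1 s
  | nset (s : State) (k : ℕ) (i e : NExpr) :
      Exec (.nset k i e) s (i.cost + e.cost + 1) (s.setNat k (i.eval s) (e.eval s))
  | rset (s : State) (k : ℕ) (i : NExpr) (e : RExpr) :
      Exec (.rset k i e) s (i.cost + e.cost + 1) (s.setReal k (i.eval s) (e.eval s))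
  | seq {p q : Prog} {s s₁ s₂ : State} {t₁ t₂ : ℕ} :
      Exec p s t₁ s₁ → Exec q s₁ t₂ s₂ → Exec (.seq p q) s (t₁ + t₂) s₂
  | ite_true {b : Test} {p q : Prog} {s s' : State} {t : ℕ} :
      b.Holds s → Exec p s t s' → Exec (.ite b p q) s (b.cost + t) s'
  | ite_false {b : Test} {p q : Prog} {s s' : State} {t : ℕ} :
      ¬ b.Holds s → Exec q s t s' → Exec (.ite b p q) s (b.cost + t) s'
  | loop_done {b : Test} {p : Prog} {s : State} :
      ¬ b.Holds s → Exec (.loop b p) s b.cost s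
  | loop_step {b : Test} {p : Prog} {s s₁ s₂ : State} {t₁ t₂ : ℕ} :
      b.Holds s → Exec p s t₁ s₁ → Exec (.loop b p) s₁ t₂ s₂ →
      Exec (.loop b p) s (b.cost + t₁ + t₂) s₂

/-- The machine is deterministic. -/
theorem Exec.deterministic {p : Prog} {s s₁ s₂ : State} {t₁ t₂ : ℕ}
    (h₁ : Exec p s t₁ s₁) (h₂ : Exec p s t₂ s₂) : t₁ = t₂ ∧ s₁ = s₂ := by
  induction h₁ generalizing t₂ s₂ with
  | skip s => cases h₂; exact ⟨rfl, rfl⟩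
  | nset s k i e => cases h₂; exact ⟨rfl, rfl⟩
  | rset s k i e => cases h₂; exact ⟨rfl, rfl⟩
  | seq _ _ ih₁ ih₂ =>
    cases h₂ with
    | seq a b =>
      obtain ⟨rfl, rfl⟩ := ih₁ a
      obtain ⟨rfl, rfl⟩ := ih₂ b
      exact ⟨rfl, rfl⟩
  | ite_true hb _ ih =>
    cases h₂ with
    | ite_true _ a =>
      obtain ⟨rfl, rfl⟩ := ih a
      exact ⟨rfl, rfl⟩
    | ite_false hb' _ => exact absurd hb hb'
  | ite_false hb _ ih =>
    cases h₂ with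
    | ite_true hb' _ => exact absurd hb' hb
    | ite_false _ a =>
      obtain ⟨rfl, rfl⟩ := ih a
      exact ⟨rfl, rfl⟩
  | loop_done hb =>
    cases h₂ with
    | loop_done _ => exact ⟨rfl, rfl⟩
    | loop_step hb' _ _ => exact absurd hb' hb
  | loop_step hb _ _ ih₁ ih₂ =>
    cases h₂ with
    | loop_done hb' => exact absurd hb hb'
    | loop_step _ a b =>
      obtain ⟨rfl, rfl⟩ := ih₁ a
      obtain ⟨rfl, rfl⟩ := ih₂ b
      exact ⟨rfl, rfl⟩

/-! ## Input and output -/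

/-- The initial memory: `n` in cell 0 of the array 0 of naturals; the `x`-coordinates,
the `y`-coordinates and the weights of the customers in the arrays 0, 1, 2 of reals; `R` in cell 0
of the array 3 of reals; `0` everywhere else. -/
noncomputable def Market.initial {n : ℕ} (M : Market n) : State where
  nat k i := if k = 0 ∧ i = 0 then n else 0
  real k i :=
    if h : i < n then
      if k = 0 then M.pos ⟨i, h⟩ 0
      else if k = 1 then M.pos ⟨i, h⟩ 1
      else if k = 2 then M.weight ⟨i, h⟩
      else if k = 3 ∧ i = 0 then M.R
      else 0
    else if k = 3 ∧ i = 0 then M.R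
    else 0

/-- A query: the abscissa `a` of a vertical line is written to cell 0 of the array 4 of reals. -/
noncomputable def State.query (s : State) (a : ℝ) : State := s.setReal 4 0 a

/-- The side to be pruned, read off from cell 0 of the array 1 of naturals
(`0` for left, any other number for right). -/
def State.prunedSide (s : State) : Side := if s.nat 1 0 = 0 then .left else .right

/-- The point that justifies the pruning, read off from cells 0 and 1 of the array 5 of reals. -/
noncomputable def State.foundPoint (s : State) : Plane := !₂[s.real 5 0, s.real 5 1]

/-- The memory contents that can occur when a query arrives: those left behind by the
preprocessing `pre`, possibly followed by runs of `qry` for earlier lines. -/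
inductive Ready (pre qry : Prog) {n : ℕ} (M : Market n) : State → Prop
  | start {t : ℕ} {s : State} : Exec pre M.initial t s → Ready pre qry M s
  | next {t : ℕ} {s s' : State} {a : ℝ} :
      Ready pre qry M s → Exec qry (s.query a) t s' → Ready pre qry M s'

/-!
A follower who keeps the distance `R` from the leader `x` and wants to attract customers in the
direction `u` does best at distance (just above) `R`, and then captures the customers beyond the
tangent with normal `u` to the circle of radius `R / 2` about `x`. So `W*(x)` is the largest weight
beyond such a tangent. Let `x` move on the vertical line `x₁ = a`, and split the directions into an
upper and a lower open half-circle (horizontal directions are limits, `Admissible.weightLoss_le`).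
In the parameter `τ` of the half-circle a customer is captured in an interval `Aτ + C/τ < 2E`
(`sees_iff`), and this interval shrinks as `x` moves away. Hence the largest capture upwards is
nonincreasing and the largest capture downwards is nondecreasing in the height of `x`; at one height
both, and their one-sided limits together with optimal directions, are found in `O(n log n)` steps
by sorting the endpoints of the intervals and sweeping over them (`runs_evalProg`).

At a height `y` where the two functions cross (`Conf.Done`), a point `x'` with smaller weight loss
than `p = (a, y)` has to lie beyond two lines through `p`, one for the optimal direction of the
prevailing half-circle and one for a limiting optimal direction of the other one. These lines bound
a wedge with apex `p` which, the two directions being in opposite half-circles, lies on one side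
of the vertical line. Comparing the slopes tells which side; the other half-plane can be
discarded (`Admissible.prune`).

A crossing exists at the start of the search or at a critical height, where the interval of one
customer becomes nonempty or the intervals of two customers begin to overlap
(`Conf.exists_done`, by Helly's theorem on the line). In the second case the tangent passes through
both customers, so its direction does not depend on the vertical line. The preprocessing sorts these
`n` directions for each customer, in `O(n² log n)` steps altogether (`runs_preProg`). As the height
of a tangent is monotone along either branch of the curve of a customer, every query obtains
implicitly a matrix of `4n` sorted rows with `n` columns which contains all critical heights
(`critHeight_mono`, `critHeight_cover`). A round of the search evaluates a weighted median of the
middle cells of the rows and thus discards a quarter of the cells (`runs_roundProg`), which gives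
`O(log n)` rounds of `O(n log n)` steps (`runs_searchProg`).

In the machine programs, arrays of which only the cell `0` is used are called scalars. Of the arrays
of naturals, `2`-`11` belong to sorting, `13` and `22` are loop counters, `15` and `21` hold the
offsets and the number of the rows, and `16` and `17` bound the columns that are still searched. Of
the arrays of reals, `6` holds keys, `7`-`9` intervals and their weights, `10` the sorted
directions, `14`-`17` the parameters of the rows, `22` the current height, and `30`-`33` and
`40`-`43` the largest captures and optimal directions at this height.
-/

/-! ### Running time and frame rules for the real RAM -/

/-- `p`, started in `s`, halts after at most `T` steps in a state satisfying `Q`. -/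
def Runs (p : Prog) (s : State) (T : ℕ) (Q : State → Prop) : Prop :=
  ∃ t s', Exec p s t s' ∧ t ≤ T ∧ Q s'

/-- The program never writes to the `k`-th array of naturals. -/
def Prog.keepsNat (k : ℕ) : Prog → Bool
  | .skip => true
  | .nset k' _ _ => !(Nat.beq k' k)
  | .rset _ _ _ => true
  | .seq p q => p.keepsNat k && q.keepsNat k
  | .ite _ p q => p.keepsNat k && q.keepsNat k
  | .loop _ p => p.keepsNat k

/-- The program never writes to the `k`-th array of reals. -/
def Prog.keepsReal (k : ℕ) : Prog → Bool
  | .skip => true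
  | .nset _ _ _ => true
  | .rset k' _ _ => !(Nat.beq k' k)
  | .seq p q => p.keepsReal k && q.keepsReal k
  | .ite _ p q => p.keepsReal k && q.keepsReal k
  | .loop _ p => p.keepsReal k

/-- The two memories agree on all arrays that `p` does not write to. -/
structure Agree (p : Prog) (s s' : State) : Prop where
  nat : ∀ k, p.keepsNat k = true → s'.nat k = s.nat k
  real : ∀ k, p.keepsReal k = true → s'.real k = s.real k

theorem Agree.refl (p : Prog) (s : State) : Agree p s s := ⟨fun _ _ => rfl, fun _ _ => rfl⟩

theorem Agree.trans {p : Prog} {s s₁ s₂ : State} (h : Agree p s s₁) (h' : Agree p s₁ s₂) :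
    Agree p s s₂ :=
  ⟨fun k hk => (h'.nat k hk).trans (h.nat k hk), fun k hk => (h'.real k hk).trans (h.real k hk)⟩

theorem Exec.agree {p : Prog} {s s' : State} {t : ℕ} (h : Exec p s t s') : Agree p s s' := by
  induction h with
  | skip s => exact Agree.refl _ _
  | nset s k i e =>
    refine ⟨fun k' hk => ?_, fun k' _ => rfl⟩
    have hne : k' ≠ k := by
      rintro rfl
      simp [Prog.keepsNat] at hk
    simp [State.setNat, Function.update_of_ne hne]
  | rset s k i e =>
    refine ⟨fun k' _ => rfl, fun k' hk => ?_⟩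
    have hne : k' ≠ k := by
      rintro rfl
      simp [Prog.keepsReal] at hk
    simp [State.setReal, Function.update_of_ne hne]
  | seq _ _ ih₁ ih₂ =>
    constructor <;> intro k hk <;>
      simp only [Prog.keepsNat, Prog.keepsReal, Bool.and_eq_true] at hk
    · exact (ih₂.nat k hk.2).trans (ih₁.nat k hk.1)
    · exact (ih₂.real k hk.2).trans (ih₁.real k hk.1)
  | ite_true _ _ ih =>
    constructor <;> intro k hk <;>
      simp only [Prog.keepsNat, Prog.keepsReal, Bool.and_eq_true] at hk
    · exact ih.nat k hk.1
    · exact ih.real k hk.1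
  | ite_false _ _ ih =>
    constructor <;> intro k hk <;>
      simp only [Prog.keepsNat, Prog.keepsReal, Bool.and_eq_true] at hk
    · exact ih.nat k hk.2
    · exact ih.real k hk.2
  | loop_done _ => exact Agree.refl _ _
  | loop_step _ _ _ ih₁ ih₂ =>
    exact Agree.trans ⟨fun k hk => ih₁.nat k hk, fun k hk => ih₁.real k hk⟩ ih₂

theorem Runs.mono {p : Prog} {s : State} {T T' : ℕ} {Q Q' : State → Prop}
    (h : Runs p s T Q) (hT : T ≤ T') (hQ : ∀ s', Agree p s s' → Q s' → Q' s') :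
    Runs p s T' Q' := by
  obtain ⟨t, s', he, ht, hq⟩ := h
  exact ⟨t, s', he, ht.trans hT, hQ s' he.agree hq⟩

theorem Runs.seq {p q : Prog} {s : State} {T₁ T₂ : ℕ} {Q R : State → Prop}
    (hp : Runs p s T₁ R) (hq : ∀ s', Agree p s s' → R s' → Runs q s' T₂ Q) :
    Runs (.seq p q) s (T₁ + T₂) Q := by
  obtain ⟨t₁, s₁, e₁, ht₁, hr⟩ := hp
  obtain ⟨t₂, s₂, e₂, ht₂, hQ⟩ := hq s₁ e₁.agree hr
  exact ⟨_, s₂, e₁.seq e₂, add_le_add ht₁ ht₂, hQ⟩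

theorem Runs.ite {b : Test} {p q : Prog} {s : State} {T : ℕ} {Q : State → Prop}
    (hp : b.Holds s → Runs p s T Q) (hq : ¬ b.Holds s → Runs q s T Q) :
    Runs (.ite b p q) s (b.cost + T) Q := by
  by_cases hb : b.Holds s
  · obtain ⟨t, s', e, ht, h⟩ := hp hb
    exact ⟨_, s', .ite_true hb e, by omega, h⟩
  · obtain ⟨t, s', e, ht, h⟩ := hq hb
    exact ⟨_, s', .ite_false hb e, by omega, h⟩

/-- The loop rule: `I m` is an invariant which implies that at most `m` iterations remain. -/
theorem Runs.loop {b : Test} {p : Prog} {T : ℕ} (I : ℕ → State → Prop) {s₀ : State}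
    (step : ∀ m s, Agree (.loop b p) s₀ s → I m s → b.Holds s →
      ∃ m', m = m' + 1 ∧ Runs p s T (I m'))
    {m : ℕ} (h : I m s₀) :
    Runs (.loop b p) s₀ (m * (b.cost + T) + b.cost) (fun s' => ¬ b.Holds s' ∧ ∃ m', I m' s') := by
  suffices H : ∀ m s, Agree (.loop b p) s₀ s → I m s →
      Runs (.loop b p) s (m * (b.cost + T) + b.cost) (fun s' => ¬ b.Holds s' ∧ ∃ m', I m' s') from
    H m s₀ (Agree.refl _ _) h
  intro m
  induction m with
  | zero =>
    intro s ha hi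
    have hb : ¬ b.Holds s := fun hb => by
      obtain ⟨m', hm, -⟩ := step 0 s ha hi hb
      omega
    exact ⟨_, s, .loop_done hb, by omega, hb, 0, hi⟩
  | succ m ih =>
    intro s ha hi
    by_cases hb : b.Holds s
    · obtain ⟨m', hm, t₁, s₁, e₁, ht₁, h₁⟩ := step _ s ha hi hb
      obtain rfl : m = m' := by omega
      have hag : Agree (.loop b p) s s₁ := ⟨fun k hk => e₁.agree.nat k hk,
        fun k hk => e₁.agree.real k hk⟩
      obtain ⟨t₂, s₂, e₂, ht₂, h₂⟩ := ih s₁ (ha.trans hag) h₁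
      refine ⟨_, s₂, .loop_step hb e₁ e₂, ?_, h₂⟩
      rw [Nat.succ_mul]
      omega
    · exact ⟨_, s, .loop_done hb, by omega, hb, _, hi⟩

/-! ### Loop-free programs -/

/-- Weakest precondition of a loop-free program. -/
def Prog.wp : Prog → (State → Prop) → State → Prop
  | .skip, Q, s => Q s
  | .nset k i e, Q, s => Q (s.setNat k (i.eval s) (e.eval s))
  | .rset k i e, Q, s => Q (s.setReal k (i.eval s) (e.eval s))
  | .seq p q, Q, s => p.wp (q.wp Q) s
  | .ite b p q, Q, s => (b.Holds s → p.wp Q s) ∧ (¬ b.Holds s → q.wp Q s)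
  | .loop _ _, _, _ => False

/-- The running time of a loop-free program, counting all branches. -/
def Prog.maxCost : Prog → ℕ
  | .skip => 1
  | .nset _ i e => i.cost + e.cost + 1
  | .rset _ i e => i.cost + e.cost + 1
  | .seq p q => p.maxCost + q.maxCost
  | .ite b p q => b.cost + (p.maxCost + q.maxCost)
  | .loop _ _ => 0

theorem Runs.of_wp {p : Prog} {s : State} {Q : State → Prop} (h : p.wp Q s) :
    Runs p s p.maxCost Q := by
  induction p generalizing s Q with
  | skip => exact ⟨_, _, .skip s, le_rfl, h⟩
  | nset k i e => exact ⟨_, _, .nset s k i e, le_rfl, h⟩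
  | rset k i e => exact ⟨_, _, .rset s k i e, le_rfl, h⟩
  | seq p q ihp ihq => exact (ihp h).seq fun s' _ hs' => ihq hs'
  | ite b p q ihp ihq =>
    exact Runs.ite (fun hb => (ihp (h.1 hb)).mono (Nat.le_add_right _ _) fun _ _ h => h)
      (fun hb => (ihq (h.2 hb)).mono (Nat.le_add_left _ _) fun _ _ h => h)
  | loop b p => exact h.elim

@[simp] theorem State.setNat_nat (s : State) (k i v k' : ℕ) :
    (s.setNat k i v).nat k' = if k' = k then Function.update (s.nat k) i v else s.nat k' := by
  by_cases h : k' = k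
  · subst h; simp [State.setNat]
  · simp [State.setNat, h]

@[simp] theorem State.setNat_real (s : State) (k i v : ℕ) : (s.setNat k i v).real = s.real := rfl

@[simp] theorem State.setReal_nat (s : State) (k i : ℕ) (v : ℝ) :
    (s.setReal k i v).nat = s.nat := rfl

@[simp] theorem State.setReal_real (s : State) (k i : ℕ) (v : ℝ) (k' : ℕ) :
    (s.setReal k i v).real k' = if k' = k then Function.update (s.real k) i v else s.real k' := by
  by_cases h : k' = k
  · subst h; simp [State.setReal]
  · simp [State.setReal, h]

attribute [simp] NExpr.eval RExpr.eval Test.Holds Prog.wp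

/-! ### Counting loops -/

/-- The scalar variable kept in cell `0` of the `k`-th array of naturals. -/
abbrev nv (k : ℕ) : NExpr := .get k (.lit 0)

/-- The scalar variable kept in cell `0` of the `k`-th array of reals. -/
abbrev rv (k : ℕ) : RExpr := .get k (.lit 0)

/-- `for c = 0, …, N - 1 do body`. -/
def forLoop (c : ℕ) (N : NExpr) (body : Prog) : Prog :=
  .seq (.nset c (.lit 0) (.lit 0))
    (.loop (.nlt (nv c) N) (.seq body (.nset c (.lit 0) (.add (nv c) (.lit 1)))))

theorem Runs.forLoop {c : ℕ} {N : NExpr} {body : Prog} {s₀ : State} {B T : ℕ}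
    (I : ℕ → State → Prop)
    (hN : ∀ s, Agree (forLoop c N body) s₀ s → N.eval s = B)
    (h0 : I 0 (s₀.setNat c 0 0))
    (step : ∀ k s, k < B → s.nat c 0 = k → Agree (_root_.forLoop c N body) s₀ s → I k s →
      Runs body s T fun s' => s'.nat c 0 = k ∧ I (k + 1) (s'.setNat c 0 (k + 1))) :
    Runs (_root_.forLoop c N body) s₀ ((B + 1) * (T + N.cost + 15)) fun s' => I B s' := by
  have hinit : Agree (_root_.forLoop c N body) s₀ (s₀.setNat c 0 0) := by
    refine ⟨fun k hk => ?_, fun k _ => rfl⟩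
    have := (Exec.nset s₀ c (.lit 0) (.lit 0)).agree.nat k (by
      simp only [_root_.forLoop, Prog.keepsNat, Bool.and_eq_true] at hk ⊢
      exact hk.1)
    simpa using this
  have key : Runs (.loop (.nlt (nv c) N) (.seq body (.nset c (.lit 0) (.add (nv c) (.lit 1)))))
      (s₀.setNat c 0 0) _ _ :=
    Runs.loop (T := T + 7) (m := B)
      (fun m s => ∃ k, k + m = B ∧ s.nat c 0 = k ∧ I k s) (by
      rintro m s ha ⟨k, hkm, hk, hI⟩ hb
      have ha' : Agree (_root_.forLoop c N body) s₀ s := hinit.trans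
        ⟨fun k hk => ha.nat k (by
            simp only [_root_.forLoop, Prog.keepsNat, Bool.and_eq_true] at hk ⊢
            exact hk.2),
          fun k hk => ha.real k (by
            simp only [_root_.forLoop, Prog.keepsReal, Bool.and_eq_true] at hk ⊢
            exact hk.2)⟩
      have hlt : k < B := by
        simpa [hN s ha', hk] using hb
      refine ⟨m - 1, by omega, (step k s hlt hk ha' hI).seq fun s' _ hs' => ?_⟩
      refine (Runs.of_wp ?_).mono (by simp [Prog.maxCost, NExpr.cost]) fun _ _ h => h
      simp only [Prog.wp, NExpr.eval, hs'.1]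
      exact ⟨k + 1, by omega, by simp, hs'.2⟩) ⟨0, by omega, by simp, h0⟩
  refine ((Runs.of_wp (p := .nset c (.lit 0) (.lit 0)) (s := s₀)
    (Q := fun s => s = s₀.setNat c 0 0) rfl).seq fun s' _ hs' => hs' ▸ key).mono ?_ ?_
  · simp only [Prog.maxCost, NExpr.cost, Test.cost]
    nlinarith
  · rintro s' ha ⟨hb, m, k, hkm, hk, hI⟩
    have : ¬ k < B := by simpa [hN s' ha, hk] using hb
    obtain rfl : k = B := by omega
    exact hI

/-! ### Merge sort -/

/-- The progress of one pass of bottom-up merge sort, at the moment when `k` entries of the output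
`Q` have been written. The block `[lo, hi)` consists of the two sorted runs `[lo, mid)` and
`[mid, hi)` of `P`; the entries before `i` and `j` have been consumed. -/
structure MergeInv (key : ℕ → ℝ) (P Q : ℕ → ℕ) (w n k lo mid hi i j : ℕ) : Prop where
  block : ∃ c, lo = c * (2 * w)
  mid_eq : mid = min (lo + w) n
  hi_eq : hi = min (mid + w) n
  lo_le : lo ≤ i
  i_le : i ≤ mid
  mid_le : mid ≤ j
  j_le : j ≤ hi
  count : k + mid = i + j
  cover : ∀ x, x < i ∨ (mid ≤ x ∧ x < j) → ∃ y, y < k ∧ Q y = P x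
  below_left : ∀ y x, lo ≤ y → y < k → i ≤ x → x < mid → key (Q y) ≤ key (P x)
  below_right : ∀ y x, lo ≤ y → y < k → j ≤ x → x < hi → key (Q y) ≤ key (P x)
  sorted : ∀ c x y, c * (2 * w) ≤ x → x ≤ y → y < (c + 1) * (2 * w) → y < k →
    key (Q x) ≤ key (Q y)

/-- The index array `P` is sorted within every aligned block of length `w`. -/
def BlockSorted (key : ℕ → ℝ) (P : ℕ → ℕ) (w n : ℕ) : Prop :=
  ∀ c x y, c * w ≤ x → x ≤ y → y < (c + 1) * w → y < n → key (P x) ≤ key (P y)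

/-- The next entry of the left run may be written if it does not exceed that of the right run. -/
theorem MergeInv.emit_left {key : ℕ → ℝ} {P Q Q' : ℕ → ℕ} {w n k lo mid hi i j : ℕ}
    (h : MergeInv key P Q w n k lo mid hi i j) (hP : BlockSorted key P w n)
    (hi' : i < mid) (hc : j < hi → key (P i) ≤ key (P j))
    (hQ : ∀ y, y < k → Q' y = Q y) (hk : Q' k = P i) :
    MergeInv key P Q' w n (k + 1) lo mid hi (i + 1) j := by
  obtain ⟨⟨c, hc0⟩, h2, h3, h4, h5, h6, h7, h8, h9, h10, h11, h12⟩ := h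
  have hrun : ∀ x y, lo ≤ x → x ≤ y → y < mid → key (P x) ≤ key (P y) := fun x y hx hxy hy =>
    hP (2 * c) x y (by rw [hc0] at hx; linarith) hxy
      (by have : y < lo + w := by omega
          rw [hc0] at this; linarith) (by omega)
  have hrun' : ∀ x y, mid ≤ x → x ≤ y → y < hi → key (P x) ≤ key (P y) := fun x y hx hxy hy =>
    hP (2 * c + 1) x y (by have : lo + w ≤ x := by omega
                           rw [hc0] at this; linarith) hxy
      (by have : y < lo + w + w := by omega
          rw [hc0] at this; linarith) (by omega)
  refine ⟨⟨c, hc0⟩, h2, h3, by omega, by omega, h6, h7, by omega, ?_, ?_, ?_, ?_⟩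
  · intro x hx
    by_cases hxi : x = i
    · exact ⟨k, by omega, by rw [hk, hxi]⟩
    · obtain ⟨y, hy, hyx⟩ := h9 x (by omega)
      exact ⟨y, by omega, by rw [hQ y hy, hyx]⟩
  · intro y x hy hyk hx hxm
    by_cases hyk' : y = k
    · rw [hyk', hk]; exact hrun _ _ h4 (by omega) hxm
    · rw [hQ y (by omega)]; exact h10 y x hy (by omega) (by omega) hxm
  · intro y x hy hyk hx hxm
    by_cases hyk' : y = k
    · rw [hyk', hk]; exact (hc (by omega)).trans (hrun' _ _ h6 (by omega) hxm)
    · rw [hQ y (by omega)]; exact h11 y x hy (by omega) (by omega) hxm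
  · intro b x y hx hxy hy hyk
    by_cases hyk' : y = k
    · subst hyk'
      by_cases hxk : x = y
      · rw [hxk]
      · have hb : b = c := by
          have h1 : c * (2 * w) ≤ y := by omega
          have h2' : y < (c + 1) * (2 * w) := by
            have : y < lo + 2 * w := by omega
            rw [hc0] at this; linarith
          have hw : 0 < 2 * w := by
            by_contra h0
            have : w = 0 := by omega
            simp [this] at h2'
          have h3' : b * (2 * w) < (c + 1) * (2 * w) := by omega
          have h4' : c * (2 * w) < (b + 1) * (2 * w) := by omega
          have := Nat.lt_of_mul_lt_mul_right h3'
          have := Nat.lt_of_mul_lt_mul_right h4'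
          omega
        rw [hk, hQ x (by omega)]
        exact h10 x i (by rw [hc0, ← hb]; exact hx) (by omega) le_rfl hi'
    · rw [hQ y (by omega), hQ x (by omega)]; exact h12 b x y hx hxy hy (by omega)

theorem MergeInv.emit_right {key : ℕ → ℝ} {P Q Q' : ℕ → ℕ} {w n k lo mid hi i j : ℕ}
    (h : MergeInv key P Q w n k lo mid hi i j) (hP : BlockSorted key P w n)
    (hj' : j < hi) (hc : i < mid → key (P j) ≤ key (P i))
    (hQ : ∀ y, y < k → Q' y = Q y) (hk : Q' k = P j) :
    MergeInv key P Q' w n (k + 1) lo mid hi i (j + 1) := by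
  obtain ⟨⟨c, hc0⟩, h2, h3, h4, h5, h6, h7, h8, h9, h10, h11, h12⟩ := h
  have hrun : ∀ x y, lo ≤ x → x ≤ y → y < mid → key (P x) ≤ key (P y) := fun x y hx hxy hy =>
    hP (2 * c) x y (by rw [hc0] at hx; linarith) hxy
      (by have : y < lo + w := by omega
          rw [hc0] at this; linarith) (by omega)
  have hrun' : ∀ x y, mid ≤ x → x ≤ y → y < hi → key (P x) ≤ key (P y) := fun x y hx hxy hy =>
    hP (2 * c + 1) x y (by have : lo + w ≤ x := by omega
                           rw [hc0] at this; linarith) hxy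
      (by have : y < lo + w + w := by omega
          rw [hc0] at this; linarith) (by omega)
  refine ⟨⟨c, hc0⟩, h2, h3, h4, h5, by omega, by omega, by omega, ?_, ?_, ?_, ?_⟩
  · intro x hx
    by_cases hxi : x = j
    · exact ⟨k, by omega, by rw [hk, hxi]⟩
    · obtain ⟨y, hy, hyx⟩ := h9 x (by omega)
      exact ⟨y, by omega, by rw [hQ y hy, hyx]⟩
  · intro y x hy hyk hx hxm
    by_cases hyk' : y = k
    · rw [hyk', hk]; exact (hc (by omega)).trans (hrun _ _ h4 (by omega) hxm)
    · rw [hQ y (by omega)]; exact h10 y x hy (by omega) (by omega) hxm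
  · intro y x hy hyk hx hxm
    by_cases hyk' : y = k
    · rw [hyk', hk]; exact hrun' _ _ h6 (by omega) hxm
    · rw [hQ y (by omega)]; exact h11 y x hy (by omega) (by omega) hxm
  · intro b x y hx hxy hy hyk
    by_cases hyk' : y = k
    · subst hyk'
      by_cases hxk : x = y
      · rw [hxk]
      · have hb : b = c := by
          have h1 : c * (2 * w) ≤ y := by omega
          have h2' : y < (c + 1) * (2 * w) := by
            have : y < lo + 2 * w := by omega
            rw [hc0] at this; linarith
          have h3' : b * (2 * w) < (c + 1) * (2 * w) := by omega
          have h4' : c * (2 * w) < (b + 1) * (2 * w) := by omega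
          have := Nat.lt_of_mul_lt_mul_right h3'
          have := Nat.lt_of_mul_lt_mul_right h4'
          omega
        rw [hk, hQ x (by omega)]
        exact h11 x j (by rw [hc0, ← hb]; exact hx) (by omega) le_rfl hj'
    · rw [hQ y (by omega), hQ x (by omega)]; exact h12 b x y hx hxy hy (by omega)

/-- What one pass of merge sort has achieved between two steps: either a block is being merged, or
a new one is about to be opened at `k = hi`. -/
def PassInv (key : ℕ → ℝ) (P Q : ℕ → ℕ) (w n k lo mid hi i j : ℕ) : Prop :=
  (k = hi ∧ (∃ c, hi = c * (2 * w)) ∧ (∀ x, x < k → ∃ y, y < k ∧ Q y = P x) ∧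
    ∀ c x y, c * (2 * w) ≤ x → x ≤ y → y < (c + 1) * (2 * w) → y < k → key (Q x) ≤ key (Q y)) ∨
  MergeInv key P Q w n k lo mid hi i j

theorem PassInv.open_block {key : ℕ → ℝ} {P Q : ℕ → ℕ} {w n k lo mid hi i j : ℕ}
    (h : PassInv key P Q w n k lo mid hi i j) (hk : k < n) (hkh : ¬ k < hi) :
    MergeInv key P Q w n k hi (min (hi + w) n) (min (min (hi + w) n + w) n) hi
      (min (hi + w) n) := by
  have main : k = hi ∧ (∃ c, hi = c * (2 * w)) ∧ (∀ x, x < k → ∃ y, y < k ∧ Q y = P x) ∧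
      ∀ c x y, c * (2 * w) ≤ x → x ≤ y → y < (c + 1) * (2 * w) → y < k →
        key (Q x) ≤ key (Q y) := by
    rcases h with h | ⟨⟨c, hc⟩, h2, h3, h4, h5, h6, h7, h8, h9, h10, h11, h12⟩
    · exact h
    · have hkhi : k = hi := by omega
      refine ⟨hkhi, ⟨c + 1, ?_⟩, fun x hx => h9 x (by omega), h12⟩
      have : hi = lo + 2 * w := by omega
      rw [this, hc]; ring
  obtain ⟨h1, h2, h3, h4⟩ := main
  exact ⟨h2, rfl, rfl, le_rfl, by omega, le_rfl, by omega, by omega,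
    fun x hx => h3 x (by omega), fun y x _ _ _ _ => by omega, fun y x _ _ _ _ => by omega, h4⟩

theorem PassInv.finish {key : ℕ → ℝ} {P Q : ℕ → ℕ} {w n lo mid hi i j : ℕ}
    (h : PassInv key P Q w n n lo mid hi i j) :
    (∀ x, x < n → ∃ y, y < n ∧ Q y = P x) ∧ BlockSorted key Q (2 * w) n := by
  rcases h with h | ⟨-, h2, h3, h4, h5, h6, h7, h8, h9, h10, h11, h12⟩
  · exact ⟨h.2.2.1, h.2.2.2⟩
  · exact ⟨fun x hx => h9 x (by omega), h12⟩

/-- The smaller of two natural numbers. -/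
def NExpr.min (e f : NExpr) : NExpr := .sub e (.sub e f)

@[simp] theorem NExpr.eval_min (s : State) (e f : NExpr) :
    (e.min f).eval s = Min.min (e.eval s) (f.eval s) := by
  simp only [NExpr.min, NExpr.eval]; omega

/-- One step of a merging pass: the next entry of the array `11` is taken from the array `10`.
The scalars `5`, …, `9` are `lo`, `mid`, `hi`, `i`, `j`; `3` is the length of the runs, `2` the
length of the array, and the keys are in the array `K` of reals. -/
def mergeStep (K : ℕ) : Prog :=
  .seq
    (.ite (.nlt (nv 4) (nv 7)) .skip
      (.seq (.nset 5 (.lit 0) (nv 7))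
      (.seq (.nset 6 (.lit 0) (.min (.add (nv 7) (nv 3)) (nv 2)))
      (.seq (.nset 7 (.lit 0) (.min (.add (nv 6) (nv 3)) (nv 2)))
      (.seq (.nset 8 (.lit 0) (nv 5)) (.nset 9 (.lit 0) (nv 6)))))))
    (.ite (.and (.nlt (nv 8) (nv 6)) (.not (.and (.nlt (nv 9) (nv 7))
        (.rlt (.get K (.get 10 (nv 9))) (.get K (.get 10 (nv 8)))))))
      (.seq (.nset 11 (nv 4) (.get 10 (nv 8))) (.nset 8 (.lit 0) (.add (nv 8) (.lit 1))))
      (.seq (.nset 11 (nv 4) (.get 10 (nv 9))) (.nset 9 (.lit 0) (.add (nv 9) (.lit 1)))))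

theorem runs_mergeStep {K n w k : ℕ} {s : State} {P : ℕ → ℕ} (hwpos : 0 < w)
    (hP : BlockSorted (s.real K) P w n) (hsP : s.nat 10 = P) (hn : s.nat 2 0 = n)
    (hw : s.nat 3 0 = w) (hk : s.nat 4 0 = k) (hkn : k < n)
    (h : PassInv (s.real K) P (s.nat 11) w n k (s.nat 5 0) (s.nat 6 0) (s.nat 7 0) (s.nat 8 0)
      (s.nat 9 0)) :
    Runs (mergeStep K) s (mergeStep K).maxCost fun s' => PassInv (s.real K) P (s'.nat 11) w n
      (k + 1) (s'.nat 5 0) (s'.nat 6 0) (s'.nat 7 0) (s'.nat 8 0) (s'.nat 9 0) := by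
  refine Runs.seq (R := fun s' => s'.real = s.real ∧ s'.nat 11 = s.nat 11 ∧ k < s'.nat 7 0 ∧
      MergeInv (s.real K) P (s'.nat 11) w n k (s'.nat 5 0) (s'.nat 6 0) (s'.nat 7 0)
        (s'.nat 8 0) (s'.nat 9 0))
    (T₁ := Prog.maxCost _) (T₂ := Prog.maxCost _) (Runs.of_wp ?_) fun s₁ ha hs₁ => Runs.of_wp ?_
  · simp only [Prog.wp, Test.Holds, NExpr.eval]
    refine ⟨fun hlt => ?_, fun hlt => ?_⟩
    · rw [hk] at hlt
      refine ⟨trivial, trivial, hlt, h.resolve_left fun h => by omega⟩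
    · rw [hk] at hlt
      have := h.open_block hkn hlt
      have hkhi : k = s.nat 7 0 := by
        rcases h with h | h
        · exact h.1
        · have := h.count; have := h.i_le; have := h.j_le; omega
      refine ⟨by simp, by simp, ?_, ?_⟩
      · simp [hn, hw]; omega
      · simpa [hn, hw] using this
  · obtain ⟨hr, hQ, hklt, hI⟩ := hs₁
    have e10 : s₁.nat 10 = P := (ha.nat 10 rfl).trans hsP
    have e4 : s₁.nat 4 0 = k := by rw [ha.nat 4 rfl, hk]
    have hc := hI.count
    have h1 := hI.i_le
    have h2 := hI.j_le
    simp only [Prog.wp, Test.Holds, NExpr.eval, RExpr.eval, hr, e10, e4]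
    refine ⟨fun hb => Or.inr ?_, fun hb => Or.inr ?_⟩
    · simpa using hI.emit_left hP hb.1 (fun hj => not_lt.1 fun hl => hb.2 ⟨hj, hl⟩)
        (Q' := Function.update (s₁.nat 11) k (P (s₁.nat 8 0)))
        (fun y hy => Function.update_of_ne (by omega) _ _) (by simp)
    · have hj : s₁.nat 9 0 < s₁.nat 7 0 := by
        by_contra hj
        exact hb ⟨by omega, fun h => hj h.1⟩
      simpa using hI.emit_right hP hj (fun hi => by
          by_contra hl
          exact hb ⟨hi, fun h => hl h.2.le⟩)
        (Q' := Function.update (s₁.nat 11) k (P (s₁.nat 9 0)))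
        (fun y hy => Function.update_of_ne (by omega) _ _) (by simp)

/-- Sorts the indices below the length kept in the scalar `2` by their keys in the array `K` of
reals, by bottom-up merge sort. The sorted indices are returned in the array `10`. -/
def sortProg (K : ℕ) : Prog :=
  .seq (forLoop 4 (nv 2) (.nset 10 (nv 4) (nv 4)))
  (.seq (.nset 3 (.lit 0) (.lit 1))
  (.loop (.nlt (nv 3) (nv 2))
    (.seq (.nset 7 (.lit 0) (.lit 0))
    (.seq (forLoop 4 (nv 2) (mergeStep K))
    (.seq (forLoop 4 (nv 2) (.nset 10 (nv 4) (.get 11 (nv 4))))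
      (.nset 3 (.lit 0) (.add (nv 3) (nv 3))))))))

/-- `P` lists the indices below `n` in the order of their keys. -/
structure SortedIdx (key : ℕ → ℝ) (P : ℕ → ℕ) (n : ℕ) : Prop where
  cover : ∀ v, v < n → ∃ x, x < n ∧ P x = v
  mono : ∀ x y, x ≤ y → y < n → key (P x) ≤ key (P y)

theorem SortedIdx.image {key : ℕ → ℝ} {P : ℕ → ℕ} {n : ℕ} (h : SortedIdx key P n) :
    (Finset.range n).image P = Finset.range n := by
  refine (Finset.eq_of_subset_of_card_le (fun v hv => ?_) ?_).symm
  · obtain ⟨x, hx, rfl⟩ := h.cover v (Finset.mem_range.1 hv)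
    exact Finset.mem_image_of_mem _ (Finset.mem_range.2 hx)
  · exact Finset.card_image_le

theorem SortedIdx.lt {key : ℕ → ℝ} {P : ℕ → ℕ} {n : ℕ} (h : SortedIdx key P n) {x : ℕ}
    (hx : x < n) : P x < n := by
  have := Finset.mem_image_of_mem P (Finset.mem_range.2 hx)
  rw [h.image] at this
  exact Finset.mem_range.1 this

theorem SortedIdx.injOn {key : ℕ → ℝ} {P : ℕ → ℕ} {n : ℕ} (h : SortedIdx key P n) :
    Set.InjOn P (Finset.range n : Finset ℕ) := by
  rw [← Finset.card_image_iff, h.image]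

/-- The state of a pass of merge sort after `k` steps. -/
def PassState (K w n : ℕ) (P : ℕ → ℕ) (k : ℕ) (s : State) : Prop :=
  PassInv (s.real K) P (s.nat 11) w n k (s.nat 5 0) (s.nat 6 0) (s.nat 7 0) (s.nat 8 0) (s.nat 9 0)

theorem runs_mergePass {K n w : ℕ} {s : State} (hwpos : 0 < w) (hn : s.nat 2 0 = n)
    (hw : s.nat 3 0 = w) (h7 : s.nat 7 0 = 0)
    (hP : BlockSorted (s.real K) (s.nat 10) w n) :
    Runs (forLoop 4 (nv 2) (mergeStep K)) s ((n + 1) * ((mergeStep K).maxCost + 17)) fun s' =>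
      (∀ x, x < n → ∃ y, y < n ∧ s'.nat 11 y = s.nat 10 x) ∧
      BlockSorted (s.real K) (s'.nat 11) (2 * w) n := by
  refine (Runs.forLoop (B := n) (T := (mergeStep K).maxCost) (PassState K w n (s.nat 10))
    (fun s' ha => ?_) ?_
    (fun k s₁ hk h4 ha hI => ?_)).mono (le_of_eq ?_) ?_
  · simp [ha.nat 2 rfl, hn]
  · left
    simp [h7]
  · have e : s₁.real = s.real := funext fun K' => ha.real K' rfl
    refine (runs_mergeStep (P := s.nat 10) hwpos (by rwa [e]) (ha.nat 10 rfl)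
      (by rw [ha.nat 2 rfl, hn]) (by rw [ha.nat 3 rfl, hw]) h4 hk hI).mono le_rfl
      fun s₂ ha₂ h => ⟨by rw [ha₂.nat 4 rfl, h4], ?_⟩
    simpa [PassState, ha₂.real K rfl] using h
  · simp [NExpr.cost]
  · intro s' ha h
    have := PassInv.finish h
    rwa [ha.real K rfl] at this

/-- Since the length of the sorted blocks doubles in each pass, `Nat.log 2 n + 1` passes suffice. -/
theorem runs_sortProg (K : ℕ) : ∃ c : ℕ, ∀ (n : ℕ) (s : State), 1 ≤ n → s.nat 2 0 = n →
    Runs (sortProg K) s (c * (n * (Nat.log 2 n + 1))) fun s' =>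
      SortedIdx (s.real K) (s'.nat 10) n := by
  obtain ⟨c₀, hc₀⟩ : ∃ c₀, c₀ = (mergeStep K).maxCost := ⟨_, rfl⟩
  refine ⟨10 * c₀ + 500, fun n s hn1 hn => ?_⟩
  have init : Runs (forLoop 4 (nv 2) (.nset 10 (nv 4) (nv 4))) s ((n + 1) * 22) fun s' =>
      ∀ x, x < n → s'.nat 10 x = x := by
    refine (Runs.forLoop (B := n) (T := Prog.maxCost _) (fun k s' =>
      ∀ x, x < k → s'.nat 10 x = x) (fun s' ha => ?_) ?_
      (fun k s₁ hk h4 ha hI => Runs.of_wp ?_)).mono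
      (le_of_eq (by simp [NExpr.cost, Prog.maxCost])) fun _ _ h => h
    · simp [ha.nat 2 rfl, hn]
    · simp
    · simp [h4, Function.update_apply]
      intro x hx
      split_ifs with hxk
      · exact hxk.symm
      · exact hI x (by omega)
  have copy : ∀ s : State, s.nat 2 0 = n →
      Runs (forLoop 4 (nv 2) (.nset 10 (nv 4) (.get 11 (nv 4)))) s ((n + 1) * 23) fun s' =>
      ∀ x, x < n → s'.nat 10 x = s.nat 11 x := by
    intro s hn
    refine (Runs.forLoop (B := n) (T := Prog.maxCost _) (fun k s' =>
      ∀ x, x < k → s'.nat 10 x = s.nat 11 x) (fun s' ha => ?_) ?_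
      (fun k s₁ hk h4 ha hI => Runs.of_wp ?_)).mono
      (le_of_eq (by simp [NExpr.cost, Prog.maxCost])) fun _ _ h => h
    · simp [ha.nat 2 rfl, hn]
    · simp
    · simp [h4, Function.update_apply]
      intro x hx
      split_ifs with hxk
      · rw [ha.nat 11 rfl, hxk]
      · exact hI x (by omega)
  refine (init.seq fun s₁ ha₁ h₁ => ((Runs.of_wp (p := .nset 3 (.lit 0) (.lit 1))
    (Q := fun s => s = s₁.setNat 3 0 1) rfl).seq fun s₂ ha₂ h₂ =>
    Runs.loop (T := (n + 1) * (c₀ + 60)) (m := Nat.log 2 n + 1)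
      (fun m s' => ∃ e, e + m = Nat.log 2 n + 1 ∧ s'.nat 3 0 = 2 ^ e ∧
        (∀ v, v < n → ∃ x, x < n ∧ s'.nat 10 x = v) ∧
        BlockSorted (s.real K) (s'.nat 10) (2 ^ e) n) ?_ ?_)).mono ?_ ?_
  · rintro m s' ha ⟨e, hem, h3, hcov, hbs⟩ hb
    have h2 : s'.nat 2 0 = n := by rw [ha.nat 2 rfl, ha₂.nat 2 rfl, ha₁.nat 2 rfl, hn]
    have hr : s'.real K = s.real K := by rw [ha.real K rfl, ha₂.real K rfl, ha₁.real K rfl]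
    have hlt : 2 ^ e < n := by simpa [h2, h3] using hb
    have hel : e < Nat.log 2 n + 1 := by
      have := Nat.pow_lt_pow_iff_right (a := 2) (by norm_num) |>.1
        (hlt.trans (Nat.lt_pow_succ_log_self (by norm_num) n))
      exact this
    refine ⟨m - 1, by omega, ?_⟩
    refine ((Runs.of_wp (p := .nset 7 (.lit 0) (.lit 0))
      (Q := fun s => s = s'.setNat 7 0 0) rfl).seq fun s₃ ha₃ h₃ =>
      (runs_mergePass (K := K) (n := n) (w := 2 ^ e) (by positivity) ?_ ?_ ?_ ?_).seq
        fun s₄ ha₄ h₄ => (copy s₄ ?_).seq fun s₅ ha₅ h₅ => Runs.of_wp ?_).mono ?_ fun _ _ h => h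
    · simp [h₃, h2]
    · simp [h₃, h3]
    · simp [h₃]
    · simpa [h₃, hr] using hbs
    · simp [ha₄.nat 2 rfl, h₃, h2]
    · simp only [Prog.wp, NExpr.eval]
      have e3 : s₅.nat 3 0 = 2 ^ e := by simp [ha₅.nat 3 rfl, ha₄.nat 3 rfl, h₃, h3]
      refine ⟨e + 1, by omega, ?_, ?_, ?_⟩
      · simp [e3]; ring
      · intro v hv
        obtain ⟨x, hx, hxv⟩ := hcov v hv
        obtain ⟨y, hy, hyx⟩ := h₄.1 x hx
        refine ⟨y, hy, ?_⟩
        simp only [State.setNat_nat]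
        rw [if_neg (by norm_num), h₅ y hy, hyx, ← hxv]
        simp [h₃]
      · intro c x y hx hxy hy hyn
        have := h₄.2 c x y (by rwa [← pow_succ']) hxy (by rwa [← pow_succ']) hyn
        simp only [State.setNat_nat]
        rw [if_neg (by norm_num), h₅ y hyn, h₅ x (by omega)]
        simpa [h₃, hr] using this
    · rw [← hc₀]
      simp [Prog.maxCost, NExpr.cost]
      nlinarith
  · refine ⟨0, by omega, by simp [h₂], fun v hv => ⟨v, hv, ?_⟩, fun c x y hx hxy hy hyn => ?_⟩
    · simp [h₂, h₁ v hv]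
    · have : x = y := by omega
      rw [this]
  · simp [Prog.maxCost, NExpr.cost, Test.cost]
    generalize Nat.log 2 n = l
    have : 1 ≤ n * (l + 1) := Nat.one_le_iff_ne_zero.2 (by positivity)
    nlinarith [Nat.zero_le (n * l), Nat.zero_le (n * l * c₀), Nat.zero_le (n * c₀),
      Nat.zero_le (l * c₀), Nat.mul_le_mul_right (l * c₀) hn1, Nat.mul_le_mul_right l hn1,
      Nat.mul_le_mul_right c₀ hn1]
  · rintro s' ha ⟨hb, m, e, hem, h3, hcov, hbs⟩
    have h2 : s'.nat 2 0 = n := by rw [ha.nat 2 rfl, hn]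
    have hle : n ≤ 2 ^ e := by simpa [h2, h3] using hb
    exact ⟨hcov, fun x y hxy hy => hbs 0 x y (by omega) hxy (by omega) hy⟩

/-! ### The sweep over sorted intervals -/

/-- An interval with right endpoint `r` has ended at `l`. Right endpoints of closed intervals
(`cl = true`) still count. -/
def Gone (cl : Bool) (r l : ℝ) : Prop := if cl = true then r < l else r ≤ l

theorem Gone.mono {cl : Bool} {r r' l l' : ℝ} (h : Gone cl r l) (hr : r' ≤ r) (hl : l ≤ l') :
    Gone cl r' l' := by
  cases cl <;> simp only [Gone] at h ⊢ <;> norm_num at h ⊢ <;> linarith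

open Classical in
/-- The total weight of the intervals that have begun but not ended at `l`. -/
noncomputable def sampleWeight (cl : Bool) (L R W : ℕ → ℝ) (n : ℕ) (l : ℝ) : ℝ :=
  ∑ i ∈ Finset.range n, if L i ≤ l ∧ ¬ Gone cl (R i) l then W i else 0

theorem SortedIdx.sum {key : ℕ → ℝ} {P : ℕ → ℕ} {n : ℕ} (h : SortedIdx key P n) (f : ℕ → ℝ) :
    ∑ m ∈ Finset.range n, f (P m) = ∑ i ∈ Finset.range n, f i := by
  conv_rhs => rw [← h.image, Finset.sum_image h.injOn]

open Classical in
theorem SortedIdx.sum_prefix {key : ℕ → ℝ} {P : ℕ → ℕ} {n q : ℕ} (h : SortedIdx key P n)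
    (W : ℕ → ℝ) (p : ℕ → Prop) (hq : q ≤ n) (hp : ∀ m, m < q → p (P m))
    (hp' : ∀ m, q ≤ m → m < n → ¬ p (P m)) :
    ∑ m ∈ Finset.range q, W (P m) = ∑ i ∈ Finset.range n, if p i then W i else 0 := by
  rw [← h.sum fun i => if p i then W i else 0]
  rw [← Finset.sum_subset (Finset.range_subset_range.2 hq)]
  · exact Finset.sum_congr rfl fun m hm => by rw [if_pos (hp m (Finset.mem_range.1 hm))]
  · intro m hm hm'
    rw [Finset.mem_range] at hm hm'
    rw [if_neg (hp' m (by omega) hm)]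

open Classical in
theorem SortedIdx.sum_prefix_le {key : ℕ → ℝ} {P : ℕ → ℕ} {n q : ℕ} (h : SortedIdx key P n)
    (W : ℕ → ℝ) (p : ℕ → Prop) (hW : ∀ i, i < n → 0 ≤ W i) (hq : q ≤ n)
    (hp : ∀ m, m < q → p (P m)) :
    ∑ m ∈ Finset.range q, W (P m) ≤ ∑ i ∈ Finset.range n, if p i then W i else 0 := by
  rw [← h.sum fun i => if p i then W i else 0]
  refine (Finset.sum_le_sum_of_subset_of_nonneg (Finset.range_subset_range.2 hq)
    (f := fun m => if p (P m) then W (P m) else 0) ?_).trans' ?_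
  · intro m hm _
    split_ifs
    exacts [hW _ (h.lt (Finset.mem_range.1 hm)), le_rfl]
  · exact Finset.sum_le_sum fun m hm => by rw [if_pos (hp m (Finset.mem_range.1 hm))]

/-- The weight sampled at `l` is a difference of two prefix sums in the sorted orders. -/
theorem sampleWeight_eq {cl : Bool} {L R W : ℕ → ℝ} {n : ℕ}
    (hLR : ∀ i, i < n → W i ≠ 0 → ∀ l, Gone cl (R i) l → L i ≤ l) (l : ℝ)
    [DecidablePred fun i => L i ≤ l] [DecidablePred fun i => Gone cl (R i) l] :
    sampleWeight cl L R W n l = (∑ i ∈ Finset.range n, if L i ≤ l then W i else 0) -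
      ∑ i ∈ Finset.range n, if Gone cl (R i) l then W i else 0 := by
  rw [sampleWeight, ← Finset.sum_sub_distrib]
  refine Finset.sum_congr rfl fun i hi => ?_
  by_cases hw : W i = 0
  · simp [hw]
  · have := hLR i (Finset.mem_range.1 hi) hw l
    by_cases h1 : L i ≤ l <;> by_cases h2 : Gone cl (R i) l <;> simp [h1, h2]
    exact absurd (this h2) h1

/-- The result of a sweep: the largest weight sampled at a left endpoint, and where it occurs. -/
structure IsSweepMax (cl : Bool) (L R W : ℕ → ℝ) (n : ℕ) (best arg : ℝ) : Prop where
  attained : best = 0 ∧ arg = 0 ∨ 0 < best ∧ best ≤ sampleWeight cl L R W n arg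
  le : ∀ i, i < n → sampleWeight cl L R W n (L i) ≤ best

/-- The state of the sweep: `k` left endpoints and `q` right endpoints have been processed. -/
structure SweepInv (cl : Bool) (L R W : ℕ → ℝ) (P P' : ℕ → ℕ) (n k q : ℕ) (acc best arg : ℝ) :
    Prop where
  k_le : k ≤ n
  q_le : q ≤ n
  acc_eq : acc = ∑ m ∈ Finset.range k, W (P m) - ∑ m ∈ Finset.range q, W (P' m)
  gone : ∀ k' m, k ≤ k' → k' < n → m < q → Gone cl (R (P' m)) (L (P k'))
  attained : best = 0 ∧ arg = 0 ∨ 0 < best ∧ best ≤ sampleWeight cl L R W n arg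
  le : ∀ m, m < k → (∀ m', m < m' → m' < n → L (P m) < L (P m')) →
    sampleWeight cl L R W n (L (P m)) ≤ best

section
variable {cl : Bool} {L R W : ℕ → ℝ} {P P' : ℕ → ℕ} {n k q : ℕ} {acc best arg : ℝ}

theorem SweepInv.remove (h : SweepInv cl L R W P P' n k q acc best arg)
    (hP : SortedIdx L P n) (hq : q < n) (hg : Gone cl (R (P' q)) (L (P k))) :
    SweepInv cl L R W P P' n k (q + 1) (acc - W (P' q)) best arg := by
  refine ⟨h.k_le, hq, ?_, ?_, h.attained, h.le⟩
  · rw [h.acc_eq, Finset.sum_range_succ _ q]; ring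
  · intro k' m hk hk' hm
    rcases Nat.lt_succ_iff_lt_or_eq.1 hm with hm | rfl
    · exact h.gone k' m hk hk' hm
    · exact hg.mono le_rfl (hP.mono _ _ hk hk')

/-- Adding a left endpoint gives at most the sampled weight, and exactly the sampled weight at the
last of several equal left endpoints. -/
theorem SweepInv.add_le (h : SweepInv cl L R W P P' n k q acc best arg)
    (hP : SortedIdx L P n) (hP' : SortedIdx R P' n) (hW : ∀ i, i < n → 0 ≤ W i)
    (hLR : ∀ i, i < n → W i ≠ 0 → ∀ l, Gone cl (R i) l → L i ≤ l) (hk : k < n)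
    (hg : q < n → ¬ Gone cl (R (P' q)) (L (P k))) :
    acc + W (P k) ≤ sampleWeight cl L R W n (L (P k)) ∧
      ((∀ m', k < m' → m' < n → L (P k) < L (P m')) →
        sampleWeight cl L R W n (L (P k)) ≤ acc + W (P k)) := by
  classical
  have hgone := hP'.sum_prefix W (fun i => Gone cl (R i) (L (P k))) h.q_le
    (fun m hm => h.gone k m le_rfl hk hm)
    (fun m hm hmn hg' => hg (by omega) (hg'.mono (hP'.mono _ _ hm hmn) le_rfl))
  have hle := hP.sum_prefix_le W (fun i => L i ≤ L (P k)) hW (q := k + 1) hk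
    (fun m hm => hP.mono _ _ (by omega) hk)
  have hacc : acc + W (P k) =
      ∑ m ∈ Finset.range (k + 1), W (P m) - ∑ m ∈ Finset.range q, W (P' m) := by
    rw [h.acc_eq, Finset.sum_range_succ _ k]; ring
  rw [sampleWeight_eq hLR, hacc, hgone]
  refine ⟨by linarith, fun hlast => ?_⟩
  have := hP.sum_prefix W (fun i => L i ≤ L (P k)) (q := k + 1) hk
    (fun m hm => hP.mono _ _ (by omega) hk)
    (fun m hm hmn => not_le.2 (hlast m hm hmn))
  linarith

theorem SweepInv.add (h : SweepInv cl L R W P P' n k q acc best arg) {best' arg' : ℝ}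
    (hP : SortedIdx L P n) (hP' : SortedIdx R P' n) (hW : ∀ i, i < n → 0 ≤ W i)
    (hLR : ∀ i, i < n → W i ≠ 0 → ∀ l, Gone cl (R i) l → L i ≤ l) (hk : k < n)
    (hg : q < n → ¬ Gone cl (R (P' q)) (L (P k)))
    (hb : best < acc + W (P k) ∧ best' = acc + W (P k) ∧ arg' = L (P k) ∨
      ¬ best < acc + W (P k) ∧ best' = best ∧ arg' = arg) :
    SweepInv cl L R W P P' n (k + 1) q (acc + W (P k)) best' arg' := by
  obtain ⟨h1, h2⟩ := h.add_le hP hP' hW hLR hk hg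
  refine ⟨hk, h.q_le, ?_, fun k' m hk hk' hm => h.gone k' m (by omega) hk' hm, ?_, ?_⟩
  · rw [h.acc_eq, Finset.sum_range_succ _ k]; ring
  · rcases hb with ⟨hb, rfl, rfl⟩ | ⟨hb, rfl, rfl⟩
    · refine Or.inr ⟨?_, h1⟩
      rcases h.attained with ⟨h0, -⟩ | ⟨h0, -⟩ <;> linarith
    · exact h.attained
  · intro m hm hlast
    rcases Nat.lt_succ_iff_lt_or_eq.1 hm with hm | rfl
    · have := h.le m hm hlast
      rcases hb with ⟨hb, rfl, rfl⟩ | ⟨hb, rfl, rfl⟩ <;> linarith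
    · have := h2 hlast
      rcases hb with ⟨hb, rfl, rfl⟩ | ⟨hb, rfl, rfl⟩ <;> linarith

/-- At the end every left endpoint equals the last of the left endpoints with the same value, for
which the sampled weight has been taken into account. -/
theorem SweepInv.finish (h : SweepInv cl L R W P P' n n q acc best arg)
    (hP : SortedIdx L P n) : IsSweepMax cl L R W n best arg := by
  classical
  refine ⟨h.attained, fun i hi => ?_⟩
  obtain ⟨x, hx, rfl⟩ := hP.cover i hi
  let F := (Finset.range n).filter fun m => L (P m) ≤ L (P x)
  have hxF : x ∈ F := by simp [F, hx]
  have hmF := F.max'_mem ⟨x, hxF⟩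
  set m := F.max' ⟨x, hxF⟩ with hm
  have hxm : x ≤ m := F.le_max' x hxF
  simp only [F, Finset.mem_filter, Finset.mem_range] at hmF
  have heq : L (P m) = L (P x) := le_antisymm hmF.2 (hP.mono _ _ hxm hmF.1)
  rw [← heq]
  refine h.le m hmF.1 fun m' hm' hm'n => ?_
  by_contra hle
  have hm'F : m' ∈ F := by
    simp only [F, Finset.mem_filter, Finset.mem_range]
    exact ⟨hm'n, by linarith⟩
  have := F.le_max' m' hm'F
  omega

end

/-- The test whether the next interval to end, the one with index `P' q`, has ended at the current
left endpoint. -/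
def goneTest (cl : Bool) : Test :=
  if cl = true then .rlt (.get 8 (.get 10 (nv 18))) (.get 7 (.get 12 (nv 14)))
  else .not (.rlt (.get 7 (.get 12 (nv 14))) (.get 8 (.get 10 (nv 18))))

theorem holds_goneTest (cl : Bool) (s : State) : (goneTest cl).Holds s ↔
    Gone cl (s.real 8 (s.nat 10 (s.nat 18 0))) (s.real 7 (s.nat 12 (s.nat 14 0))) := by
  cases cl <;> simp [goneTest, Gone]

/-- The sweep. The endpoints and weights are in the arrays `7`, `8`, `9` of reals, the indices
sorted by left and by right endpoints in the arrays `12` and `10`. The largest weight and its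
place are returned in the scalars `19` and `20`. -/
def sweepProg (cl : Bool) : Prog :=
  .seq (.nset 14 (.lit 0) (.lit 0))
  (.seq (.nset 18 (.lit 0) (.lit 0))
  (.seq (.rset 18 (.lit 0) (.lit 0))
  (.seq (.rset 19 (.lit 0) (.lit 0))
  (.seq (.rset 20 (.lit 0) (.lit 0))
  (.loop (.nlt (nv 14) (nv 0))
    (.ite (.and (.nlt (nv 18) (nv 0)) (goneTest cl))
      (.seq (.rset 18 (.lit 0) (.sub (rv 18) (.get 9 (.get 10 (nv 18)))))
        (.nset 18 (.lit 0) (.add (nv 18) (.lit 1))))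
      (.seq (.rset 18 (.lit 0) (.add (rv 18) (.get 9 (.get 12 (nv 14)))))
      (.seq (.ite (.rlt (rv 19) (rv 18))
          (.seq (.rset 19 (.lit 0) (rv 18)) (.rset 20 (.lit 0) (.get 7 (.get 12 (nv 14))))) .skip)
        (.nset 14 (.lit 0) (.add (nv 14) (.lit 1)))))))))))

theorem runs_sweepProg (cl : Bool) : ∃ c : ℕ, ∀ (n : ℕ) (s : State), 1 ≤ n → s.nat 0 0 = n →
    SortedIdx (s.real 7) (s.nat 12) n → SortedIdx (s.real 8) (s.nat 10) n →
    (∀ i, i < n → 0 ≤ s.real 9 i) →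
    (∀ i, i < n → s.real 9 i ≠ 0 → ∀ l, Gone cl (s.real 8 i) l → s.real 7 i ≤ l) →
    Runs (sweepProg cl) s (c * n) fun s' =>
      IsSweepMax cl (s.real 7) (s.real 8) (s.real 9) n (s'.real 19 0) (s'.real 20 0) := by
  obtain ⟨c₀, hc₀⟩ : ∃ c₀, c₀ = (goneTest cl).cost := ⟨_, rfl⟩
  refine ⟨2 * c₀ + 500, fun n s hn1 hn hP hP' hW hLR => ?_⟩
  refine ((Runs.of_wp (s := s) (p := .nset 14 (.lit 0) (.lit 0)) (Q := fun s' => s' = _) rfl).seq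
    fun s₁ _ h₁ => (Runs.of_wp (p := .nset 18 (.lit 0) (.lit 0)) (Q := fun s' => s' = _) rfl).seq
    fun s₂ _ h₂ => (Runs.of_wp (p := .rset 18 (.lit 0) (.lit 0)) (Q := fun s' => s' = _) rfl).seq
    fun s₃ _ h₃ => (Runs.of_wp (p := .rset 19 (.lit 0) (.lit 0)) (Q := fun s' => s' = _) rfl).seq
    fun s₄ _ h₄ => (Runs.of_wp (p := .rset 20 (.lit 0) (.lit 0)) (Q := fun s' => s' = _) rfl).seq
    fun s₅ _ h₅ => Runs.loop (T := c₀ + 100) (m := 2 * n)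
      (fun m s' => s'.nat 14 0 + s'.nat 18 0 + m = 2 * n ∧
        SweepInv cl (s.real 7) (s.real 8) (s.real 9) (s.nat 12) (s.nat 10) n (s'.nat 14 0)
          (s'.nat 18 0) (s'.real 18 0) (s'.real 19 0) (s'.real 20 0)) ?_ ?_).mono ?_ ?_
  · rintro m s' ha ⟨hm, hI⟩ hb
    have en : s'.nat 0 0 = n := by simp [ha.nat 0 rfl, h₅, h₄, h₃, h₂, h₁, hn]
    have e12 : s'.nat 12 = s.nat 12 := by simp [ha.nat 12 rfl, h₅, h₄, h₃, h₂, h₁]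
    have e10 : s'.nat 10 = s.nat 10 := by simp [ha.nat 10 rfl, h₅, h₄, h₃, h₂, h₁]
    have e7 : s'.real 7 = s.real 7 := by simp [ha.real 7 rfl, h₅, h₄, h₃, h₂, h₁]
    have e8 : s'.real 8 = s.real 8 := by simp [ha.real 8 rfl, h₅, h₄, h₃, h₂, h₁]
    have e9 : s'.real 9 = s.real 9 := by simp [ha.real 9 rfl, h₅, h₄, h₃, h₂, h₁]
    have hk : s'.nat 14 0 < n := by simpa [en] using hb
    have hq := hI.q_le
    refine ⟨m - 1, by omega, (Runs.of_wp ?_).mono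
      (show _ ≤ c₀ + 100 by simp [Prog.maxCost, Test.cost, NExpr.cost, RExpr.cost, ← hc₀]; omega)
      fun _ _ h => h⟩
    simp only [Prog.wp, Test.Holds, holds_goneTest, NExpr.eval, RExpr.eval, en, e7, e8, e9, e10,
      e12]
    refine ⟨fun hg => ⟨?_, ?_⟩, fun hg => ⟨fun hlt => ⟨?_, ?_⟩, fun hlt => ⟨?_, ?_⟩⟩⟩
    · simp; omega
    · simpa using hI.remove hP hg.1 hg.2
    · simp; omega
    · simp [e7, e12] at hlt ⊢
      exact hI.add hP hP' hW hLR hk (fun hq hg' => hg ⟨hq, hg'⟩) (Or.inl ⟨hlt, rfl, rfl⟩)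
    · simp; omega
    · simp only [State.setReal_real, State.setReal_nat, State.setNat_nat, State.setNat_real]
        at hlt ⊢
      simp at hlt ⊢
      exact hI.add hP hP' hW hLR hk (fun hq hg' => hg ⟨hq, hg'⟩)
        (Or.inr ⟨not_lt.2 hlt, rfl, rfl⟩)
  · refine ⟨by simp [h₅, h₄, h₃, h₂, h₁], ?_⟩
    constructor <;> simp [h₅, h₄, h₃, h₂, h₁]
  · simp only [Prog.maxCost, Test.cost, NExpr.cost, RExpr.cost]
    nlinarith
  · rintro s' ha ⟨hb, m, hm, hI⟩
    have en : s'.nat 0 0 = n := by rw [ha.nat 0 (by cases cl <;> rfl), hn]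
    have hk : ¬ s'.nat 14 0 < n := by simpa [en] using hb
    have hkn : s'.nat 14 0 = n := le_antisymm hI.k_le (not_lt.1 hk)
    rw [hkn] at hI
    exact hI.finish hP

/-! ### The directions in which a single customer is captured -/

/-- The quantity `E + √(E² - AC)`, from which both endpoints of `{τ | Aτ + C/τ < 2E}` are
computed. -/
noncomputable def pole (A C E : ℝ) : ℝ := E + Real.sqrt (E * E - A * C)

/-- The left endpoint of the interval `{τ > 0 | Aτ + C/τ < 2E}`, in the coordinate
`t = τ / (1 + τ)`, which maps `(0, ∞)` to `(0, 1)`. -/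
noncomputable def lft (A C E : ℝ) : ℝ := max C 0 / (pole A C E + max C 0)

/-- The right endpoint of the interval `{τ > 0 | Aτ + C/τ < 2E}`, in the coordinate
`t = τ / (1 + τ)`. If `max A 0` and `pole A C E` both vanish, then the division by zero correctly
gives the endpoint `1`. -/
noncomputable def rgt (A C E : ℝ) : ℝ := 1 - max A 0 / (pole A C E + max A 0)

/-- `{τ > 0 | Aτ + C/τ < 2E}` is nonempty; with `cl = true`, its analogues for all larger `E` are
nonempty. -/
def Valid (cl : Bool) (A C E : ℝ) : Prop :=
  A * C < 0 ∨ if cl = true then 0 ≤ E ∧ A * C ≤ E * E else 0 < E ∧ A * C < E * E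

section
variable {A C E E' τ t : ℝ} {cl : Bool}

theorem Valid.le_sq (h : Valid cl A C E) : A * C ≤ E * E := by
  rcases h with h | h
  · nlinarith [mul_self_nonneg E]
  · cases cl <;> norm_num at h <;> linarith

theorem Valid.lt_sq (h : Valid false A C E) : A * C < E * E := by
  rcases h with h | h
  · nlinarith [mul_self_nonneg E]
  · norm_num at h; linarith

theorem Valid.pole_pos (h : Valid false A C E) : 0 < pole A C E := by
  have hlt := h.lt_sq
  have hq : 0 < Real.sqrt (E * E - A * C) := Real.sqrt_pos.2 (by linarith)
  rw [pole]
  rcases h with h | h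
  · have : |E| < Real.sqrt (E * E - A * C) := Real.lt_sqrt_of_sq_lt (by rw [sq_abs]; nlinarith)
    linarith [neg_abs_le E]
  · norm_num at h; linarith

theorem Valid.pole_nonneg (h : Valid true A C E) : 0 ≤ pole A C E := by
  rcases h with h | h
  · exact (Valid.pole_pos (Or.inl h)).le
  · norm_num at h
    exact add_nonneg h.1 (Real.sqrt_nonneg _)

theorem Valid.closed (h : Valid cl A C E) : Valid true A C E := by
  rcases h with h | h
  · exact Or.inl h
  · refine Or.inr ?_
    cases cl <;> norm_num at h ⊢ <;> constructor <;> linarith [h.1, h.2]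

theorem pole_mul_sub (h : A * C ≤ E * E) : pole A C E * (2 * E - pole A C E) = A * C := by
  have : Real.sqrt (E * E - A * C) * Real.sqrt (E * E - A * C) = E * E - A * C :=
    Real.mul_self_sqrt (by linarith)
  rw [pole]; nlinarith

theorem lt_pole (h : Valid false A C E) : E < pole A C E := by
  have hq : 0 < Real.sqrt (E * E - A * C) := Real.sqrt_pos.2 (by linarith [h.lt_sq])
  rw [pole]; linarith

theorem mul_lt_pole_sq (h : Valid false A C E) : A * C < pole A C E * pole A C E := by
  have h1 := pole_mul_sub h.le_sq
  nlinarith [lt_pole h, h.pole_pos]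

theorem lft_nonneg (h : Valid cl A C E) : 0 ≤ lft A C E :=
  div_nonneg (le_max_right _ _) (add_nonneg h.closed.pole_nonneg (le_max_right _ _))

theorem rgt_le_one (h : Valid cl A C E) : rgt A C E ≤ 1 :=
  sub_le_self _ (div_nonneg (le_max_right _ _) (add_nonneg h.closed.pole_nonneg (le_max_right _ _)))

theorem lft_lt_iff (h : 0 < pole A C E) (hτ : 0 < τ) :
    lft A C E < τ / (1 + τ) ↔ C < τ * pole A C E := by
  have h0 : 0 ≤ max C 0 := le_max_right _ _
  rw [lft, div_lt_div_iff₀ (by linarith) (by linarith)]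
  constructor
  · intro hh
    linarith [le_max_left C 0]
  · intro hh
    have : max C 0 < τ * pole A C E := max_lt hh (mul_pos hτ h)
    linarith

theorem lt_rgt_iff (h : 0 < pole A C E) (hτ : 0 < τ) :
    τ / (1 + τ) < rgt A C E ↔ A * τ < pole A C E := by
  have h0 : 0 ≤ max A 0 := le_max_right _ _
  have e : τ / (1 + τ) = 1 - 1 / (1 + τ) := by field_simp; ring
  rw [rgt, e, sub_lt_sub_iff_left, div_lt_div_iff₀ (by linarith) (by linarith)]
  constructor
  · intro hh
    nlinarith [le_max_left A 0]
  · intro hh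
    rcases max_cases A 0 with ⟨h1, -⟩ | ⟨h1, -⟩ <;> rw [h1] <;> linarith

/-- The quadratic polynomial behind `Aτ + C/τ < 2E` factors over the pole. -/
theorem pole_factor (h : A * C ≤ E * E) :
    (τ * pole A C E - C) * (pole A C E - A * τ) =
      pole A C E * (2 * E * τ - A * τ * τ - C) := by
  linear_combination (-τ) * pole_mul_sub h

/-- A customer is captured in an open interval of directions, whose endpoints are computed with
one square root. -/
theorem sees_iff (hAC : 0 ≤ A + C) (hτ : 0 < τ) :
    A * τ + C / τ < 2 * E ↔
      Valid false A C E ∧ lft A C E < τ / (1 + τ) ∧ τ / (1 + τ) < rgt A C E := by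
  have key : A * τ + C / τ < 2 * E ↔ 0 < 2 * E * τ - A * τ * τ - C := by
    rw [← mul_lt_mul_iff_left₀ hτ]
    have : (A * τ + C / τ) * τ = A * τ * τ + C := by field_simp
    rw [this]
    constructor <;> intro <;> linarith
  rw [key]
  constructor
  · intro h
    have hv : Valid false A C E := by
      by_cases hneg : A * C < 0
      · exact Or.inl hneg
      · right
        norm_num
        have hA : 0 ≤ A := by nlinarith
        have hC : 0 ≤ C := by nlinarith
        have hE : 0 < E := by
          by_contra hE
          nlinarith [mul_nonneg (mul_nonneg hA hτ.le) hτ.le]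
        refine ⟨hE, ?_⟩
        rcases hA.eq_or_lt with rfl | hA
        · nlinarith
        · nlinarith [mul_self_nonneg (A * τ - E), mul_pos hA (sub_pos.2 h)]
    refine ⟨hv, ?_⟩
    rw [lft_lt_iff hv.pole_pos hτ, lt_rgt_iff hv.pole_pos hτ]
    have hprod : 0 < (τ * pole A C E - C) * (pole A C E - A * τ) := by
      rw [pole_factor hv.le_sq]; exact mul_pos hv.pole_pos h
    rcases mul_pos_iff.1 hprod with ⟨h1, h2⟩ | ⟨h1, h2⟩
    · constructor <;> linarith
    · exfalso
      have hC : 0 < C := by nlinarith [mul_pos hτ hv.pole_pos]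
      have hA : 0 < A := by
        by_contra hA
        nlinarith [hv.pole_pos]
      have h3 := mul_lt_pole_sq hv
      nlinarith [mul_pos hτ hv.pole_pos, hv.pole_pos]
  · rintro ⟨hv, h1, h2⟩
    rw [lft_lt_iff hv.pole_pos hτ] at h1
    rw [lt_rgt_iff hv.pole_pos hτ] at h2
    have hprod : 0 < (τ * pole A C E - C) * (pole A C E - A * τ) :=
      mul_pos (by linarith) (by linarith)
    rw [pole_factor hv.le_sq] at hprod
    exact pos_of_mul_pos_right hprod hv.pole_pos.le

theorem exists_param (h0 : 0 < t) (h1 : t < 1) : ∃ τ : ℝ, 0 < τ ∧ τ / (1 + τ) = t :=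
  ⟨t / (1 - t), div_pos h0 (by linarith), by
    have : 1 - t ≠ 0 := by linarith
    field_simp
    ring⟩

theorem param_pos (hτ : 0 < τ) : 0 < τ / (1 + τ) := by positivity

theorem param_lt_one (hτ : 0 < τ) : τ / (1 + τ) < 1 := by
  rw [div_lt_one (by linarith)]; linarith

theorem lft_lt_rgt (h : Valid false A C E) : lft A C E < rgt A C E := by
  have hz := h.pole_pos
  have h1 := mul_lt_pole_sq h
  have hA : 0 ≤ max A 0 := le_max_right _ _
  have hC : 0 ≤ max C 0 := le_max_right _ _
  have e : rgt A C E = pole A C E / (pole A C E + max A 0) := by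
    rw [rgt]; field_simp; ring
  rw [e, lft, div_lt_div_iff₀ (by linarith) (by linarith)]
  have : max C 0 * max A 0 < pole A C E * pole A C E := by
    rcases max_cases A 0 with ⟨h1, -⟩ | ⟨h1, -⟩ <;> rcases max_cases C 0 with ⟨h2, -⟩ | ⟨h2, -⟩ <;>
      rw [h1, h2] <;> nlinarith
  nlinarith

theorem Valid.mono (h : Valid true A C E) (hE : E < E') : Valid false A C E' := by
  rcases h with h | h
  · exact Or.inl h
  · norm_num at h
    refine Or.inr ?_
    norm_num
    constructor
    · linarith
    · nlinarith

theorem pole_lt_pole (h : Valid true A C E) (hE : E < E') : pole A C E < pole A C E' := by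
  rcases le_or_gt 0 E with h0 | h0
  · have : Real.sqrt (E * E - A * C) ≤ Real.sqrt (E' * E' - A * C) :=
      Real.sqrt_le_sqrt (by nlinarith)
    rw [pole, pole]; linarith
  · have hneg : A * C < 0 := by
      rcases h with h | h
      · exact h
      · norm_num at h; linarith
    have h1 := pole_mul_sub h.le_sq
    have h2 := pole_mul_sub (h.mono hE).le_sq
    have h3 : 0 < pole A C E := Valid.pole_pos (Or.inl hneg)
    have h4 := (h.mono hE).pole_pos
    by_contra hle
    push Not at hle
    nlinarith [mul_pos h3 h4, mul_nonneg h4.le (sub_nonneg.2 hle), mul_pos h4 (sub_pos.2 hE),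
      mul_nonneg (sub_nonneg.2 hle) (neg_nonneg.2 hneg.le)]

/-- Enlarging `E` strictly enlarges the interval, in the sense that every point of the closed
interval has a neighbourhood whose points in `(0, 1)` belong to the larger open interval. -/
theorem eventually_sees (hAC : 0 ≤ A + C) (h : Valid true A C E) (hE : E < E') {l : ℝ}
    (hl : lft A C E ≤ l) (hr : l ≤ rgt A C E) :
    ∀ᶠ t in nhds l, ∀ τ, 0 < τ → τ / (1 + τ) = t → A * τ + C / τ < 2 * E' := by
  have hz := h.pole_nonneg
  have hzz := pole_lt_pole h hE
  have e1 : ∀ᶠ t in nhds l, 0 < t → lft A C E' < t := by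
    rcases le_or_gt C 0 with hC | hC
    · refine Filter.Eventually.of_forall fun t ht => ?_
      rwa [lft, max_eq_right hC, zero_div]
    · refine (lt_mem_nhds (lt_of_lt_of_le ?_ hl)).mono fun t ht _ => ht
      rw [lft, lft, max_eq_left hC.le]
      exact div_lt_div_of_pos_left hC (by linarith) (by linarith)
  have e2 : ∀ᶠ t in nhds l, t < 1 → t < rgt A C E' := by
    rcases le_or_gt A 0 with hA | hA
    · refine Filter.Eventually.of_forall fun t ht => ?_
      rwa [rgt, max_eq_right hA, zero_div, sub_zero]
    · refine (gt_mem_nhds (lt_of_le_of_lt hr ?_)).mono fun t ht _ => ht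
      rw [rgt, rgt, max_eq_left hA.le, sub_lt_sub_iff_left]
      exact div_lt_div_of_pos_left hA (by linarith) (by linarith)
  filter_upwards [e1, e2] with t h1 h2 τ hτ hτt
  rw [sees_iff hAC hτ, hτt]
  exact ⟨h.mono hE, h1 (hτt ▸ param_pos hτ), h2 (hτt ▸ param_lt_one hτ)⟩

/-- The intervals for `cl = true` are the limits of those for `cl = false` as `E` decreases. -/
theorem valid_of_forall (h : ∀ E', E < E' → Valid false A C E') : Valid true A C E := by
  by_cases hneg : A * C < 0
  · exact Or.inl hneg
  · have h' : ∀ E', E < E' → 0 < E' ∧ A * C < E' * E' := fun E' hE => by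
      simpa [Valid, hneg] using h E' hE
    refine Or.inr ?_
    rw [if_pos rfl]
    refine ⟨le_of_forall_gt_imp_ge_of_dense fun E' hE => (h' E' hE).1.le, ?_⟩
    have hc : Filter.Tendsto (fun x : ℝ => x * x) (nhdsWithin E (Set.Ioi E)) (nhds (E * E)) :=
      ((continuous_id.mul continuous_id).tendsto E).mono_left nhdsWithin_le_nhds
    refine ge_of_tendsto hc ?_
    filter_upwards [self_mem_nhdsWithin] with x hx
    exact (h' x hx).2.le

/-- A set of directions that becomes nonempty exactly at `E` belongs to a customer at distance
`√(AC)` from the horizontal line considered. -/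
theorem eq_sqrt_of_not_valid (h : Valid true A C E) (h' : ¬ Valid false A C E) :
    E = Real.sqrt (A * C) := by
  have hneg : ¬ A * C < 0 := fun hneg => h' (Or.inl hneg)
  have h1 : 0 ≤ E ∧ A * C ≤ E * E := by simpa [Valid, hneg] using h
  have h2 : 0 < E → E * E ≤ A * C := by simpa [Valid, hneg] using h'
  rcases h1.1.eq_or_lt with rfl | hE
  · rw [show A * C = 0 by linarith, Real.sqrt_zero]
  · rw [le_antisymm h1.2 (h2 hE), Real.sqrt_mul_self hE.le]

theorem continuous_pole : Continuous fun E => pole A C E := by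
  unfold pole
  fun_prop

theorem tendsto_lft (h : Valid true A C E) :
    Filter.Tendsto (fun E => lft A C E) (nhdsWithin E (Set.Ioi E)) (nhds (lft A C E)) := by
  refine Filter.Tendsto.mono_left (ContinuousAt.tendsto ?_) nhdsWithin_le_nhds
  unfold lft
  rcases le_or_gt C 0 with hC | hC
  · simp only [max_eq_right hC, zero_div]; exact continuousAt_const
  · refine continuousAt_const.div (continuous_pole.continuousAt.add continuousAt_const) ?_
    have := h.pole_nonneg
    rw [max_eq_left hC.le]
    linarith

theorem tendsto_rgt (h : Valid true A C E) :
    Filter.Tendsto (fun E => rgt A C E) (nhdsWithin E (Set.Ioi E)) (nhds (rgt A C E)) := by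
  refine Filter.Tendsto.mono_left (ContinuousAt.tendsto ?_) nhdsWithin_le_nhds
  unfold rgt
  rcases le_or_gt A 0 with hA | hA
  · simp only [max_eq_right hA, zero_div]; exact continuousAt_const
  · refine continuousAt_const.sub
      (continuousAt_const.div (continuous_pole.continuousAt.add continuousAt_const) ?_)
    have := h.pole_nonneg
    rw [max_eq_left hA.le]
    linarith

theorem lft_le_rgt (h : Valid cl A C E) : lft A C E ≤ rgt A C E := by
  refine le_of_tendsto_of_tendsto (tendsto_lft h.closed) (tendsto_rgt h.closed) ?_
  filter_upwards [self_mem_nhdsWithin] with E' hE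
  exact (lft_lt_rgt (h.closed.mono hE)).le

/-- At an endpoint in `(0, 1)` of its interval of directions, a customer is on the tangent line. -/
theorem eq_of_endpoint (h : Valid false A C E) (hτ : 0 < τ)
    (ht : τ / (1 + τ) = lft A C E ∨ τ / (1 + τ) = rgt A C E) : A * τ + C / τ = 2 * E := by
  have hz := h.pole_pos
  have hprod : (τ * pole A C E - C) * (pole A C E - A * τ) = 0 := by
    rcases ht with ht | ht
    · have h1 : ¬ C < τ * pole A C E := by
        rw [← lft_lt_iff hz hτ, ht]; exact lt_irrefl _
      have h2 : ¬ τ * pole A C E < C := by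
        have hC : 0 < C := by nlinarith [mul_pos hτ hz]
        rw [lft, div_eq_div_iff (by linarith) (by rw [max_eq_left hC.le]; linarith),
          max_eq_left hC.le] at ht
        intro h2
        linarith
      rw [show τ * pole A C E - C = 0 by linarith, zero_mul]
    · have h1 : ¬ A * τ < pole A C E := by
        rw [← lt_rgt_iff hz hτ, ht]; exact lt_irrefl _
      have h2 : ¬ pole A C E < A * τ := by
        have hA : 0 < A := by
          by_contra hA
          nlinarith
        have e : rgt A C E = pole A C E / (pole A C E + A) := by
          rw [rgt, max_eq_left hA.le]; field_simp; ring
        rw [e, div_eq_div_iff (by linarith) (by linarith)] at ht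
        intro h2
        linarith
      rw [show pole A C E - A * τ = 0 by linarith, mul_zero]
  rw [pole_factor h.le_sq] at hprod
  have h3 := (mul_eq_zero.1 hprod).resolve_left hz.ne'
  field_simp
  linarith

end

/-! ### The largest capture over the directions of a half-circle -/

/-- The customers as seen from a vertical line: `d i` is the signed horizontal distance to the
line, `Y i` the height, `W i` the weight, and `g` half the minimal distance of the facilities.
Directions in the upper half-plane are `(-s, 1)` with `s = (τ - 1/τ) / 2`, `τ > 0`. -/
structure Conf where
  n : ℕ
  d : ℕ → ℝ
  Y : ℕ → ℝ
  W : ℕ → ℝ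
  g : ℝ

namespace Conf

/-- The leader at height `z` of the line loses the customer `i` to a follower in direction `τ`. -/
def Sees (c : Conf) (z τ : ℝ) (i : ℕ) : Prop :=
  (c.g + c.d i) * τ + (c.g - c.d i) / τ < 2 * (c.Y i - z)

open Classical in
/-- The weight lost to a follower in direction `τ`. -/
noncomputable def depth (c : Conf) (z τ : ℝ) : ℝ :=
  ∑ i ∈ Finset.range c.n, if c.Sees z τ i then c.W i else 0

/-- At height `z`, some follower in the half-circle of directions captures at least `v`. -/
def Reach (c : Conf) (z v : ℝ) : Prop := ∃ τ, 0 < τ ∧ v ≤ c.depth z τ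

/-- At all heights below `z`, some follower in the half-circle captures at least `v`. -/
def ReachBelow (c : Conf) (z v : ℝ) : Prop := ∀ z', z' < z → c.Reach z' v

/-- `v` is the largest capture at height `z`, attained just to the right of the direction with
coordinate `l = τ / (1 + τ)`. -/
structure IsTop (c : Conf) (z v l : ℝ) : Prop where
  le : ∀ u, c.Reach z u → u ≤ v
  nonneg : 0 ≤ l
  lt_one : l < 1
  near : ∀ᶠ t in nhdsWithin l (Set.Ioi l), ∀ τ, 0 < τ → τ / (1 + τ) = t → v ≤ c.depth z τ

/-- `v` is the limit of the largest captures at heights tending to `z` from below, and it is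
attained at these heights in all directions close to the one with coordinate `l`. -/
structure IsTopBelow (c : Conf) (z v l : ℝ) : Prop where
  le : ∀ u, c.ReachBelow z u → u ≤ v
  nonneg : 0 ≤ l
  le_one : l ≤ 1
  near : ∀ z', z' < z → ∀ᶠ t in nhds l, ∀ τ, 0 < τ → τ / (1 + τ) = t → v ≤ c.depth z' τ

/-- Minimal distance and weights are nonnegative. -/
structure Ok (c : Conf) : Prop where
  g_nonneg : 0 ≤ c.g
  W_nonneg : ∀ i, i < c.n → 0 ≤ c.W i

variable {c : Conf} {z z' τ u v l : ℝ} {i : ℕ}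

/-- The parameters `A`, `C`, `E` of the interval of directions of a customer, who is captured in
direction `τ` if `Aτ + C/τ < 2E`. -/
abbrev A (c : Conf) (i : ℕ) : ℝ := c.g + c.d i

abbrev C (c : Conf) (i : ℕ) : ℝ := c.g - c.d i

abbrev E (c : Conf) (z : ℝ) (i : ℕ) : ℝ := c.Y i - z

theorem Ok.AC_nonneg (h : c.Ok) (i : ℕ) : 0 ≤ c.A i + c.C i := by
  have := h.g_nonneg
  simp only [A, C]; linarith

theorem Ok.sees_iff (h : c.Ok) (hτ : 0 < τ) : c.Sees z τ i ↔
    Valid false (c.A i) (c.C i) (c.E z i) ∧ lft (c.A i) (c.C i) (c.E z i) < τ / (1 + τ) ∧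
      τ / (1 + τ) < rgt (c.A i) (c.C i) (c.E z i) :=
  _root_.sees_iff (h.AC_nonneg i) hτ

theorem Sees.anti (h : c.Sees z τ i) (hz : z' ≤ z) : c.Sees z' τ i := by
  unfold Sees at *; linarith

theorem Ok.depth_nonneg (h : c.Ok) : 0 ≤ c.depth z τ := by
  refine Finset.sum_nonneg fun i hi => ?_
  split_ifs
  exacts [h.W_nonneg i (Finset.mem_range.1 hi), le_rfl]

theorem Ok.depth_anti (h : c.Ok) (hz : z' ≤ z) : c.depth z τ ≤ c.depth z' τ := by
  refine Finset.sum_le_sum fun i hi => ?_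
  have hw := h.W_nonneg i (Finset.mem_range.1 hi)
  by_cases hs : c.Sees z τ i
  · rw [if_pos hs, if_pos (hs.anti hz)]
  · rw [if_neg hs]; split_ifs <;> linarith

theorem Ok.reach_anti (h : c.Ok) (hr : c.Reach z u) (hz : z' ≤ z) (hv : v ≤ u) : c.Reach z' v := by
  obtain ⟨τ, hτ, hu⟩ := hr
  exact ⟨τ, hτ, hv.trans (hu.trans (h.depth_anti hz))⟩

theorem Ok.reachBelow (h : c.Ok) (hr : c.Reach z u) : c.ReachBelow z u :=
  fun _ hz' => h.reach_anti hr hz'.le le_rfl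

/-- Captures persist slightly above the height considered. -/
theorem Ok.reach_above (h : c.Ok) (hr : c.Reach z u) : ∀ᶠ z' in nhds z, c.Reach z' u := by
  classical
  obtain ⟨τ, hτ, hu⟩ := hr
  have : ∀ᶠ z' in nhds z, ∀ i ∈ Finset.range c.n, c.Sees z τ i → c.Sees z' τ i := by
    rw [Filter.eventually_all_finset]
    intro i _
    by_cases hs : c.Sees z τ i
    · have hc : Continuous fun z' : ℝ => 2 * (c.Y i - z') := by fun_prop
      exact (hc.tendsto z |>.eventually (lt_mem_nhds hs)).mono fun _ h _ => h
    · exact Filter.Eventually.of_forall fun _ h => absurd h hs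
  refine this.mono fun z' hz' => ⟨τ, hτ, hu.trans (Finset.sum_le_sum fun i hi => ?_)⟩
  have hw := h.W_nonneg i (Finset.mem_range.1 hi)
  by_cases hs : c.Sees z τ i
  · rw [if_pos hs, if_pos (hz' i hi hs)]
  · rw [if_neg hs]; split_ifs <;> linarith

/-- Endpoints and weights of the intervals of directions, as computed by the machine. -/
structure Endpoints (c : Conf) (cl : Bool) (z : ℝ) (L R W : ℕ → ℝ) : Prop where
  L_eq : ∀ i, i < c.n → L i = lft (c.A i) (c.C i) (c.E z i)
  R_eq : ∀ i, i < c.n → R i = rgt (c.A i) (c.C i) (c.E z i)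
  W_valid : ∀ i, i < c.n → Valid cl (c.A i) (c.C i) (c.E z i) → W i = c.W i
  W_invalid : ∀ i, i < c.n → ¬ Valid cl (c.A i) (c.C i) (c.E z i) → W i = 0

/-- The customers captured in a direction are also captured just to the right of the largest of
their left endpoints, so it suffices to sample at left endpoints. -/
theorem Endpoints.isTop {L R W : ℕ → ℝ} (hc : c.Ok) (he : c.Endpoints false z L R W)
    (h : IsSweepMax false L R W c.n v l) : c.IsTop z v l := by
  classical
  have hWn : ∀ i, i < c.n → 0 ≤ W i := fun i hi => by
    by_cases hv : Valid false (c.A i) (c.C i) (c.E z i)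
    · rw [he.W_valid i hi hv]; exact hc.W_nonneg i hi
    · rw [he.W_invalid i hi hv]
  have hv0 : 0 ≤ v := by rcases h.attained with ⟨h, -⟩ | ⟨h, -⟩ <;> linarith
  have hle : ∀ u, c.Reach z u → u ≤ v := by
    rintro u ⟨τ, hτ, hu⟩
    refine hu.trans ?_
    let F := (Finset.range c.n).filter fun i => c.Sees z τ i
    rcases F.eq_empty_or_nonempty with hF | hF
    · refine hv0.trans' (Finset.sum_nonpos fun i hi => ?_)
      rw [if_neg fun hs => ?_]
      have : i ∈ F := Finset.mem_filter.2 ⟨hi, hs⟩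
      simp [hF] at this
    · obtain ⟨k, hk, hmax⟩ := F.exists_max_image L hF
      simp only [F, Finset.mem_filter, Finset.mem_range] at hk hmax
      refine (h.le k hk.1).trans' (Finset.sum_le_sum fun i hi => ?_)
      rw [Finset.mem_range] at hi
      by_cases hs : c.Sees z τ i
      · obtain ⟨h1, h2, h3⟩ := (hc.sees_iff hτ).1 hs
        obtain ⟨h4, h5, h6⟩ := (hc.sees_iff hτ).1 hk.2
        have hg : ¬ Gone false (R i) (L k) := by
          simp only [Gone, Bool.false_eq_true, if_false, not_le]
          rw [he.L_eq k hk.1, he.R_eq i hi]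
          linarith
        rw [if_pos hs, if_pos ⟨hmax i ⟨hi, hs⟩, hg⟩, he.W_valid i hi h1]
      · rw [if_neg hs]
        split_ifs
        exacts [hWn i hi, le_rfl]
  rcases h.attained with ⟨rfl, rfl⟩ | ⟨hpos, hatt⟩
  · exact ⟨hle, le_rfl, one_pos, Filter.Eventually.of_forall fun t τ _ _ => hc.depth_nonneg⟩
  · have hex : ∃ i, i < c.n ∧ Valid false (c.A i) (c.C i) (c.E z i) ∧ L i ≤ l ∧ l < R i := by
      obtain ⟨i, hi, hne⟩ := Finset.exists_ne_zero_of_sum_ne_zero (hpos.trans_le hatt).ne'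
      rw [Finset.mem_range] at hi
      have hc1 : L i ≤ l ∧ ¬ Gone false (R i) l := by
        by_contra hcon; exact hne (if_neg hcon)
      rw [if_pos hc1] at hne
      refine ⟨i, hi, ?_, hc1.1, ?_⟩
      · by_contra hv; exact hne (he.W_invalid i hi hv)
      · simpa [Gone] using hc1.2
    obtain ⟨k, hk, hkv, hkL, hkR⟩ := hex
    rw [he.L_eq k hk] at hkL
    rw [he.R_eq k hk] at hkR
    refine ⟨hle, (lft_nonneg hkv).trans hkL, hkR.trans_le (rgt_le_one hkv), ?_⟩
    have : ∀ᶠ t in nhdsWithin l (Set.Ioi l), ∀ i ∈ Finset.range c.n,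
        l < R i → t < R i := by
      rw [Filter.eventually_all_finset]
      intro i _
      by_cases hl : l < R i
      · exact ((gt_mem_nhds hl).filter_mono nhdsWithin_le_nhds).mono fun _ h _ => h
      · exact Filter.Eventually.of_forall fun _ h => absurd h hl
    filter_upwards [this, self_mem_nhdsWithin] with t ht hlt τ hτ hτt
    refine hatt.trans (Finset.sum_le_sum fun i hi => ?_)
    have hi' := Finset.mem_range.1 hi
    by_cases hs : L i ≤ l ∧ ¬ Gone false (R i) l
    · rw [if_pos hs]
      by_cases hval : Valid false (c.A i) (c.C i) (c.E z i)
      · rw [if_pos, he.W_valid i hi' hval]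
        rw [hc.sees_iff hτ, hτt, ← he.L_eq i hi', ← he.R_eq i hi']
        exact ⟨hval, lt_of_le_of_lt hs.1 hlt, ht i hi (by simpa [Gone] using hs.2)⟩
      · rw [he.W_invalid i hi' hval]
        split_ifs
        exacts [hc.W_nonneg i hi', le_rfl]
    · rw [if_neg hs]
      split_ifs
      exacts [hc.W_nonneg i hi', le_rfl]

/-- If a capture of `u` is possible at all heights below `z`, then a fixed set of customers can be
captured at all these heights. -/
theorem ReachBelow.exists_set (h : c.ReachBelow z u) :
    ∃ F ⊆ Finset.range c.n, u ≤ ∑ i ∈ F, c.W i ∧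
      ∀ z', z' < z → ∃ τ, 0 < τ ∧ ∀ i ∈ F, c.Sees z' τ i := by
  classical
  by_contra hcon
  push Not at hcon
  have : ∀ᶠ z' in nhdsWithin z (Set.Iio z), ∀ F ∈ (Finset.range c.n).powerset,
      u ≤ ∑ i ∈ F, c.W i → ¬ ∃ τ, 0 < τ ∧ ∀ i ∈ F, c.Sees z' τ i := by
    rw [Filter.eventually_all_finset]
    intro F hF
    by_cases hu : u ≤ ∑ i ∈ F, c.W i
    · obtain ⟨z₀, hz₀, hno⟩ := hcon F (Finset.mem_powerset.1 hF) hu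
      filter_upwards [Ioo_mem_nhdsLT hz₀] with z' hz' _
      rintro ⟨τ, hτ, hs⟩
      obtain ⟨i, hi, hns⟩ := hno τ hτ
      exact hns ((hs i hi).anti hz'.1.le)
    · exact Filter.Eventually.of_forall fun _ h => absurd h hu
  obtain ⟨z', hz', hlt⟩ := (this.and self_mem_nhdsWithin).exists
  obtain ⟨τ, hτ, hu⟩ := h z' hlt
  refine hz' ((Finset.range c.n).filter fun i => c.Sees z' τ i)
    (Finset.mem_powerset.2 (Finset.filter_subset _ _)) ?_ ⟨τ, hτ, fun i hi =>
      (Finset.mem_filter.1 hi).2⟩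
  rw [Finset.sum_filter]
  exact hu

theorem tendsto_E (c : Conf) (z : ℝ) (i : ℕ) : Filter.Tendsto (fun z' => c.E z' i)
    (nhdsWithin z (Set.Iio z)) (nhdsWithin (c.E z i) (Set.Ioi (c.E z i))) := by
  refine tendsto_nhdsWithin_iff.2 ⟨?_, ?_⟩
  · have : Continuous fun z' : ℝ => c.Y i - z' := by fun_prop
    exact (this.tendsto z).mono_left nhdsWithin_le_nhds
  · filter_upwards [self_mem_nhdsWithin] with z' hz'
    simp only [Set.mem_Iio, Set.mem_Ioi, E] at *
    linarith

theorem Ok.valid_of_sees (hc : c.Ok) (h : ∀ z', z' < z → ∃ τ, 0 < τ ∧ c.Sees z' τ i) :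
    Valid true (c.A i) (c.C i) (c.E z i) := by
  refine valid_of_forall fun E' hE => ?_
  obtain ⟨τ, hτ, hs⟩ := h (c.Y i - E') (by simp only [E] at hE; linarith)
  have := ((hc.sees_iff hτ).1 hs).1
  simpa [E] using this

theorem Ok.lft_le_rgt (hc : c.Ok) {j : ℕ}
    (h : ∀ z', z' < z → ∃ τ, 0 < τ ∧ c.Sees z' τ i ∧ c.Sees z' τ j) :
    lft (c.A i) (c.C i) (c.E z i) ≤ rgt (c.A j) (c.C j) (c.E z j) := by
  have hi := hc.valid_of_sees (i := i) fun z' hz' => (h z' hz').imp fun τ hτ => ⟨hτ.1, hτ.2.1⟩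
  have hj := hc.valid_of_sees (i := j) fun z' hz' => (h z' hz').imp fun τ hτ => ⟨hτ.1, hτ.2.2⟩
  refine le_of_tendsto_of_tendsto ((tendsto_lft hi).comp (c.tendsto_E z i))
    ((tendsto_rgt hj).comp (c.tendsto_E z j)) ?_
  filter_upwards [self_mem_nhdsWithin] with z' hz'
  obtain ⟨τ, hτ, hsi, hsj⟩ := h z' hz'
  exact ((hc.sees_iff hτ).1 hsi).2.1.le.trans ((hc.sees_iff hτ).1 hsj).2.2.le

/-- Customers that can be captured at all lower heights have closed intervals with a common point;
conversely, closed intervals through `l` grow to open neighbourhoods of `l` at lower heights. -/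
theorem Endpoints.isTopBelow {L R W : ℕ → ℝ} (hc : c.Ok) (he : c.Endpoints true z L R W)
    (h : IsSweepMax true L R W c.n v l) : c.IsTopBelow z v l := by
  classical
  have hWn : ∀ i, i < c.n → 0 ≤ W i := fun i hi => by
    by_cases hv : Valid true (c.A i) (c.C i) (c.E z i)
    · rw [he.W_valid i hi hv]; exact hc.W_nonneg i hi
    · rw [he.W_invalid i hi hv]
  have hv0 : 0 ≤ v := by rcases h.attained with ⟨h, -⟩ | ⟨h, -⟩ <;> linarith
  have hle : ∀ u, c.ReachBelow z u → u ≤ v := by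
    intro u hu
    obtain ⟨F, hF, huF, hs⟩ := hu.exists_set
    refine huF.trans ?_
    rcases F.eq_empty_or_nonempty with rfl | hne
    · simpa using hv0
    · obtain ⟨k, hk, hmax⟩ := F.exists_max_image L hne
      have hlt : ∀ i ∈ F, i < c.n := fun i hi => Finset.mem_range.1 (hF hi)
      refine (h.le k (hlt k hk)).trans' ?_
      rw [← Finset.inter_eq_right.2 hF, ← Finset.sum_ite_mem]
      refine Finset.sum_le_sum fun i hi => ?_
      have hi' := Finset.mem_range.1 hi
      by_cases hiF : i ∈ F
      · have hval := hc.valid_of_sees (z := z) (i := i) fun z' hz' =>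
          (hs z' hz').imp fun τ hτ => ⟨hτ.1, hτ.2 i hiF⟩
        have hg : ¬ Gone true (R i) (L k) := by
          simp only [Gone, if_true, not_lt]
          rw [he.L_eq k (hlt k hk), he.R_eq i hi']
          exact hc.lft_le_rgt fun z' hz' => (hs z' hz').imp fun τ hτ =>
            ⟨hτ.1, hτ.2 k hk, hτ.2 i hiF⟩
        rw [if_pos hiF, if_pos ⟨hmax i hiF, hg⟩, he.W_valid i hi' hval]
      · rw [if_neg hiF]
        split_ifs
        exacts [hWn i hi', le_rfl]
  rcases h.attained with ⟨rfl, rfl⟩ | ⟨hpos, hatt⟩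
  · exact ⟨hle, le_rfl, zero_le_one,
      fun z' _ => Filter.Eventually.of_forall fun t τ _ _ => hc.depth_nonneg⟩
  · have hex : ∃ i, i < c.n ∧ Valid true (c.A i) (c.C i) (c.E z i) ∧ L i ≤ l ∧ l ≤ R i := by
      obtain ⟨i, hi, hne⟩ := Finset.exists_ne_zero_of_sum_ne_zero (hpos.trans_le hatt).ne'
      rw [Finset.mem_range] at hi
      have hc1 : L i ≤ l ∧ ¬ Gone true (R i) l := by
        by_contra hcon; exact hne (if_neg hcon)
      rw [if_pos hc1] at hne
      refine ⟨i, hi, ?_, hc1.1, ?_⟩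
      · by_contra hv; exact hne (he.W_invalid i hi hv)
      · simpa [Gone] using hc1.2
    obtain ⟨k, hk, hkv, hkL, hkR⟩ := hex
    rw [he.L_eq k hk] at hkL
    rw [he.R_eq k hk] at hkR
    refine ⟨hle, (lft_nonneg hkv).trans hkL, hkR.trans (rgt_le_one hkv), fun z' hz' => ?_⟩
    have : ∀ᶠ t in nhds l, ∀ i ∈ Finset.range c.n, Valid true (c.A i) (c.C i) (c.E z i) →
        L i ≤ l ∧ ¬ Gone true (R i) l → ∀ τ, 0 < τ → τ / (1 + τ) = t → c.Sees z' τ i := by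
      rw [Filter.eventually_all_finset]
      intro i hi
      rw [Finset.mem_range] at hi
      by_cases hval : Valid true (c.A i) (c.C i) (c.E z i) ∧ L i ≤ l ∧ ¬ Gone true (R i) l
      · obtain ⟨hval, h1, h2⟩ := hval
        have h2 : l ≤ R i := by simpa [Gone] using h2
        rw [he.L_eq i hi] at h1
        rw [he.R_eq i hi] at h2
        refine (eventually_sees (hc.AC_nonneg i) hval (E' := c.E z' i) ?_ h1 h2).mono
          fun t ht _ _ => ht
        simp only [E]; linarith
      · exact Filter.Eventually.of_forall fun _ h1 h2 => absurd ⟨h1, h2⟩ hval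
    filter_upwards [this] with t ht τ hτ hτt
    refine hatt.trans (Finset.sum_le_sum fun i hi => ?_)
    have hi' := Finset.mem_range.1 hi
    by_cases hs : L i ≤ l ∧ ¬ Gone true (R i) l
    · rw [if_pos hs]
      by_cases hval : Valid true (c.A i) (c.C i) (c.E z i)
      · rw [if_pos (ht i hi hval hs τ hτ hτt), he.W_valid i hi' hval]
      · rw [he.W_invalid i hi' hval]
        split_ifs
        exacts [hc.W_nonneg i hi', le_rfl]
    · rw [if_neg hs]
      split_ifs
      exacts [hc.W_nonneg i hi', le_rfl]

theorem Endpoints.gone_imp {cl : Bool} {L R W : ℕ → ℝ} (he : c.Endpoints cl z L R W)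
    (hi : i < c.n) (hW : W i ≠ 0) (l : ℝ) (hg : Gone cl (R i) l) : L i ≤ l := by
  have hval : Valid cl (c.A i) (c.C i) (c.E z i) := by
    by_contra hv; exact hW (he.W_invalid i hi hv)
  rw [he.R_eq i hi] at hg
  rw [he.L_eq i hi]
  refine (_root_.lft_le_rgt hval).trans ?_
  cases cl <;> simp only [Gone] at hg <;> norm_num at hg <;> linarith

/-- A height is critical if it is the peak of the curve of a customer or a crossing of the curves of
two customers. -/
def Critical (c : Conf) (z : ℝ) : Prop :=
  (∃ i, i < c.n ∧ c.E z i = Real.sqrt (c.A i * c.C i)) ∨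
  ∃ i j τ, i < c.n ∧ j < c.n ∧ i ≠ j ∧ 0 < τ ∧
    c.A i * τ + c.C i / τ = 2 * c.E z i ∧ c.A j * τ + c.C j / τ = 2 * c.E z j

/-- The largest capture can only change at critical heights. In one dimension, intervals without a
common point contain two disjoint ones (Helly), so two customers are responsible for the change. -/
theorem Ok.reach_of_reachBelow (hc : c.Ok) (hcr : ¬ c.Critical z) (h : c.ReachBelow z u) :
    c.Reach z u := by
  classical
  obtain ⟨F, hF, huF, hs⟩ := h.exists_set
  have hlt : ∀ i ∈ F, i < c.n := fun i hi => Finset.mem_range.1 (hF hi)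
  have suff : (∃ τ, 0 < τ ∧ ∀ i ∈ F, c.Sees z τ i) → c.Reach z u := by
    rintro ⟨τ, hτ, hall⟩
    refine ⟨τ, hτ, huF.trans ?_⟩
    rw [depth, ← Finset.sum_filter]
    refine Finset.sum_le_sum_of_subset_of_nonneg
      (fun i hi => Finset.mem_filter.2 ⟨hF hi, hall i hi⟩) fun i hi _ =>
        hc.W_nonneg i (Finset.mem_range.1 (Finset.mem_filter.1 hi).1)
  rcases F.eq_empty_or_nonempty with rfl | hne
  · exact suff ⟨1, one_pos, by simp⟩
  have hval : ∀ i ∈ F, Valid false (c.A i) (c.C i) (c.E z i) := by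
    intro i hi
    by_contra hv
    refine hcr (Or.inl ⟨i, hlt i hi, eq_sqrt_of_not_valid (hc.valid_of_sees fun z' hz' => ?_) hv⟩)
    exact (hs z' hz').imp fun τ hτ => ⟨hτ.1, hτ.2 i hi⟩
  obtain ⟨i, hi, hmax⟩ := F.exists_max_image (fun i => lft (c.A i) (c.C i) (c.E z i)) hne
  obtain ⟨j, hj, hmin⟩ := F.exists_min_image (fun i => rgt (c.A i) (c.C i) (c.E z i)) hne
  have hij : lft (c.A i) (c.C i) (c.E z i) ≤ rgt (c.A j) (c.C j) (c.E z j) :=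
    hc.lft_le_rgt fun z' hz' => (hs z' hz').imp fun τ hτ => ⟨hτ.1, hτ.2 i hi, hτ.2 j hj⟩
  rcases hij.lt_or_eq with hij | hij
  · obtain ⟨t, ht1, ht2⟩ := exists_between hij
    obtain ⟨τ, hτ, hτt⟩ := exists_param ((lft_nonneg (hval i hi)).trans_lt ht1)
      (ht2.trans_le (rgt_le_one (hval j hj)))
    refine suff ⟨τ, hτ, fun k hk => ?_⟩
    rw [hc.sees_iff hτ, hτt]
    exact ⟨hval k hk, (hmax k hk).trans_lt ht1, ht2.trans_le (hmin k hk)⟩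
  · exfalso
    obtain ⟨τ, hτ, hτt⟩ := exists_param (t := lft (c.A i) (c.C i) (c.E z i))
      (by rw [hij]; exact (lft_nonneg (hval j hj)).trans_lt (lft_lt_rgt (hval j hj)))
      ((lft_lt_rgt (hval i hi)).trans_le (rgt_le_one (hval i hi)))
    refine hcr (Or.inr ⟨i, j, τ, hlt i hi, hlt j hj, ?_, hτ,
      eq_of_endpoint (hval i hi) hτ (Or.inl hτt), eq_of_endpoint (hval j hj) hτ (Or.inr ?_)⟩)
    · rintro rfl
      exact (lft_lt_rgt (hval i hi)).ne hij
    · rw [hτt, hij]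

end Conf

/-! ### Opposite half-circles: where the minimum on the line is attained -/

namespace Conf

variable {P N : Conf} {c : Conf} {y y' z z' u v l : ℝ}

theorem frequently_mem_Ioo (h0 : 0 ≤ l) (h1 : l ≤ 1) : ∃ᶠ t in nhds l, t ∈ Set.Ioo (0 : ℝ) 1 := by
  rw [← mem_closure_iff_frequently, closure_Ioo (by norm_num)]
  exact ⟨h0, h1⟩

theorem IsTop.reach (h : c.IsTop z v l) : c.Reach z v := by
  obtain ⟨t, ht, htl⟩ := (h.near.and (Ioo_mem_nhdsGT h.lt_one)).exists
  obtain ⟨τ, hτ, hτt⟩ := exists_param (h.nonneg.trans_lt htl.1) htl.2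
  exact ⟨τ, hτ, ht τ hτ hτt⟩

theorem IsTopBelow.reachBelow (h : c.IsTopBelow z v l) : c.ReachBelow z v := by
  intro z' hz'
  obtain ⟨t, htl, ht⟩ :=
    ((frequently_mem_Ioo h.nonneg h.le_one).and_eventually (h.near z' hz')).exists
  obtain ⟨τ, hτ, hτt⟩ := exists_param htl.1 htl.2
  exact ⟨τ, hτ, ht τ hτ hτt⟩

theorem ReachBelow.mono (h : c.ReachBelow z u) (hz : z' ≤ z) : c.ReachBelow z' u :=
  fun _ h' => h _ (h'.trans_le hz)

theorem Ok.reachBelow_anti (hc : c.Ok) (h : c.ReachBelow z u) (hv : v ≤ u) : c.ReachBelow z v :=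
  fun z' h' => hc.reach_anti (h z' h') le_rfl hv

/-- The largest captures upwards (`P`) and downwards (`N`) cross at the height `y`: neither exceeds
the limit of the other one from its side. Since `N` is rotated by a half-turn, its height is
`-y`. -/
def Done (P N : Conf) (y : ℝ) : Prop :=
  (∀ v, P.Reach y v → N.ReachBelow (-y) v) ∧ ∀ v, N.Reach (-y) v → P.ReachBelow y v

/-- The largest capture upwards exceeds the largest capture downwards, even slightly above `y`. -/
def Up (P N : Conf) (y : ℝ) : Prop := ∃ v, P.Reach y v ∧ ¬ N.ReachBelow (-y) v

theorem Up.anti (hP : P.Ok) (h : Up P N y) (hy : y' ≤ y) : Up P N y' := by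
  obtain ⟨v, h1, h2⟩ := h
  exact ⟨v, hP.reach_anti h1 hy le_rfl, fun h => h2 (h.mono (by linarith))⟩

theorem Up.exists_set (hN : N.Ok) (h : Up P N y) :
    ∃ F ∈ (Finset.range P.n).powerset,
      P.Reach y (∑ i ∈ F, P.W i) ∧ ¬ N.ReachBelow (-y) (∑ i ∈ F, P.W i) := by
  classical
  obtain ⟨v, ⟨τ, hτ, hv⟩, h2⟩ := h
  refine ⟨(Finset.range P.n).filter fun i => P.Sees y τ i,
    Finset.mem_powerset.2 (Finset.filter_subset _ _), ⟨τ, hτ, ?_⟩, fun h => h2 ?_⟩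
  · rw [Finset.sum_filter, depth]
  · refine hN.reachBelow_anti h ?_
    rw [Finset.sum_filter]
    exact hv

/-- Starting from a height `y₀` at which everything can be captured upwards, the captures cross at
`y₀` or at a critical height. -/
theorem exists_done (hP : P.Ok) (hN : N.Ok) {T y₀ y₁ : ℝ}
    (hTP : ∀ z v, P.Reach z v → v ≤ T) (hTN : ∀ z v, N.Reach z v → v ≤ T)
    (h₀ : P.ReachBelow y₀ T) (h₁ : N.ReachBelow (-y₁) T) :
    Done P N y₀ ∨ ∃ y, Done P N y ∧ (P.Critical y ∨ N.Critical (-y)) := by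
  by_cases hd : Done P N y₀
  · exact Or.inl hd
  right
  have hup : Up P N y₀ := by
    by_contra hup
    refine hd ⟨fun v hv => ?_, fun v hv => hP.reachBelow_anti h₀ (hTN _ _ hv)⟩
    by_contra hcon
    exact hup ⟨v, hv, hcon⟩
  have hbdd : BddAbove {y | Up P N y} := by
    refine ⟨y₁, fun y hy => ?_⟩
    by_contra hlt
    push Not at hlt
    obtain ⟨v, h1, h2⟩ := hy
    exact h2 (hN.reachBelow_anti (h₁.mono (by linarith)) (hTP _ _ h1))
  -- The captures cross at the supremum of the heights at which the upward captures prevail.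
  set m := sSup {y | Up P N y} with hm
  have hbelow : ∀ y, y < m → Up P N y := fun y hy => by
    obtain ⟨s, hs, hys⟩ := exists_lt_of_lt_csSup ⟨y₀, hup⟩ hy
    exact Up.anti hP hs hys.le
  have hneg : Filter.Tendsto (fun y : ℝ => -y) (nhds m) (nhds (-m)) := continuous_neg.tendsto m
  have hnup : ¬ Up P N m := by
    rintro ⟨v, h1, h2⟩
    have h2' : ∃ z, z < -m ∧ ¬ N.Reach z v := by
      by_contra hcon
      push Not at hcon
      exact h2 hcon
    obtain ⟨z, hz, hno⟩ := h2'
    have hev : ∀ᶠ y in nhdsWithin m (Set.Ioi m), Up P N y := by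
      filter_upwards [(hP.reach_above h1).filter_mono nhdsWithin_le_nhds,
        (hneg.eventually (lt_mem_nhds hz)).filter_mono nhdsWithin_le_nhds] with y hy hy'
      exact ⟨v, hy, fun h => hno (h z hy')⟩
    obtain ⟨y, hy, hlt⟩ := (hev.and self_mem_nhdsWithin).exists
    exact absurd (le_csSup hbdd hy) (not_le.2 hlt)
  have hdone : Done P N m := by
    refine ⟨fun v hv => by_contra fun hcon => hnup ⟨v, hv, hcon⟩, fun v hv z hz => ?_⟩
    by_contra hno
    have hev : ∀ᶠ y in nhdsWithin m (Set.Iio m), N.Reach (-y) v :=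
      (hneg.eventually (hN.reach_above hv)).filter_mono nhdsWithin_le_nhds
    obtain ⟨y, hy, hzy, hym⟩ := (hev.and (Ioo_mem_nhdsLT hz)).exists
    obtain ⟨v', h1, h2⟩ := hbelow y hym
    rcases le_or_gt v' v with hle | hlt
    · exact h2 (hN.reachBelow (hN.reach_anti hy le_rfl hle))
    · exact hno (hP.reach_anti h1 hzy.le hlt.le)
  refine ⟨m, hdone, ?_⟩
  by_contra hcr
  push Not at hcr
  -- Some weight is feasible upwards, but not downwards, at heights arbitrarily close below `m`.
  have hF : ∃ F ∈ (Finset.range P.n).powerset, ∃ᶠ y in nhdsWithin m (Set.Iio m),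
      P.Reach y (∑ i ∈ F, P.W i) ∧ ¬ N.ReachBelow (-y) (∑ i ∈ F, P.W i) := by
    by_contra hcon
    push Not at hcon
    have := (Filter.eventually_all_finset (Finset.range P.n).powerset).2 fun F hF =>
      hcon F hF
    obtain ⟨y, hy, hlt⟩ := (this.and self_mem_nhdsWithin).exists
    obtain ⟨F, hF, h⟩ := (hbelow y hlt).exists_set hN
    exact h.2 (hy F hF h.1)
  obtain ⟨F, -, hF⟩ := hF
  have h1 : P.ReachBelow m (∑ i ∈ F, P.W i) := fun z hz => by
    obtain ⟨y, hy, hlt⟩ := (hF.and_eventually (Ioo_mem_nhdsLT hz)).exists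
    exact hP.reach_anti hy.1 hlt.1.le le_rfl
  have h2 := hN.reach_of_reachBelow hcr.2 (hdone.1 _ (hP.reach_of_reachBelow hcr.1 h1))
  obtain ⟨y, hy, hy'⟩ := (hF.and_eventually
    ((hneg.eventually (hN.reach_above h2)).filter_mono nhdsWithin_le_nhds)).exists
  exact hy.2 (hN.reachBelow hy')

/-- If the captures upwards exceed those downwards, even slightly above `y`, then they cross only
above `y`. -/
theorem Done.gt_of_lt (hP : P.Ok) {l l' : ℝ} (h : P.IsTop y u l)
    (h' : N.IsTopBelow (-y) v l') (hlt : v < u) (hd : Done P N y') : y < y' := by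
  by_contra hle
  push Not at hle
  have h1 := (hd.1 u (hP.reach_anti h.reach hle le_rfl)).mono (z' := -y) (by linarith)
  linarith [h'.le u h1]

/-- If the captures downwards exceed those upwards, even slightly below `y`, then they cross only
below `y`. -/
theorem Done.lt_of_lt (hN : N.Ok) {l l' : ℝ} (h : N.IsTop (-y) u l)
    (h' : P.IsTopBelow y v l') (hlt : v < u) (hd : Done P N y') : y' < y := by
  by_contra hle
  push Not at hle
  have h1 := (hd.2 u (hN.reach_anti h.reach (by linarith) le_rfl)).mono (z' := y) hle
  linarith [h'.le u h1]

end Conf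

/-! ### Weight loss and directions -/

namespace Market

variable {n : ℕ} {M : Market n} {a σ : ℝ}

/-- The customers as seen from the vertical line with abscissa `a`, after a rotation by a half-turn
if `σ = -1`. -/
noncomputable def conf (M : Market n) (a σ : ℝ) : Conf where
  n := n
  d i := σ * (M.initial.real 0 i - a)
  Y i := σ * M.initial.real 1 i
  W i := M.initial.real 2 i
  g := M.R / 2

theorem initial_x (M : Market n) (i : Fin n) : M.initial.real 0 i = M.pos i 0 := by
  simp [initial]

theorem initial_y (M : Market n) (i : Fin n) : M.initial.real 1 i = M.pos i 1 := by
  simp [initial]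

theorem initial_w (M : Market n) (i : Fin n) : M.initial.real 2 i = M.weight i := by
  simp [initial]

theorem initial_R (M : Market n) : M.initial.real 3 0 = M.R := by
  simp [initial]

theorem Admissible.conf_ok (h : M.Admissible) (a σ : ℝ) : (M.conf a σ).Ok := by
  refine ⟨by have := h.R_nonneg; simp only [conf]; linarith, fun i hi => ?_⟩
  have := (h.weight_pos ⟨i, hi⟩).le
  rw [← M.initial_w] at this
  exact this

theorem dist_lt_dist_iff (v x y : Plane) : dist v y < dist v x ↔
    (v 0 - y 0) ^ 2 + (v 1 - y 1) ^ 2 < (v 0 - x 0) ^ 2 + (v 1 - x 1) ^ 2 := by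
  rw [EuclideanSpace.dist_eq, EuclideanSpace.dist_eq, Real.sqrt_lt_sqrt_iff (by positivity)]
  simp [Fin.sum_univ_two, Real.dist_eq, sq_abs]

/-- The customers beyond the tangent line of the circle of radius `R / 2` about `x` in the
direction `(p, q)` can be captured. -/
theorem Admissible.sum_le_weightLoss (h : M.Admissible) (x : Plane) {p q N : ℝ} (hN : 0 < N)
    (hpq : N * N = p * p + q * q) (F : Finset (Fin n))
    (hF : ∀ i ∈ F, M.R / 2 * N < (M.pos i 0 - x 0) * p + (M.pos i 1 - x 1) * q) :
    ∑ i ∈ F, M.weight i ≤ M.weightLoss x := by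
  classical
  have hev : ∀ᶠ ρ in nhdsWithin M.R (Set.Ioi M.R), ∀ i ∈ F,
      ρ / 2 * N < (M.pos i 0 - x 0) * p + (M.pos i 1 - x 1) * q := by
    rw [Filter.eventually_all_finset]
    intro i hi
    have hc : Continuous fun ρ : ℝ => ρ / 2 * N := by fun_prop
    exact (hc.tendsto M.R |>.eventually (gt_mem_nhds (hF i hi))).filter_mono nhdsWithin_le_nhds
  obtain ⟨ρ, hρ, hlt⟩ := (hev.and self_mem_nhdsWithin).exists
  have hρ0 : 0 < ρ := h.R_nonneg.trans_lt hlt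
  let y : Plane := !₂[x 0 + ρ / N * p, x 1 + ρ / N * q]
  have hy0 : y 0 = x 0 + ρ / N * p := rfl
  have hy1 : y 1 = x 1 + ρ / N * q := rfl
  have hk : ρ / N * (ρ / N) * (p * p + q * q) = ρ * ρ := by
    rw [← hpq]; field_simp
  have hd : M.R ≤ dist y x := by
    rw [EuclideanSpace.dist_eq]
    refine Real.le_sqrt_of_sq_le ?_
    rw [Fin.sum_univ_two, Real.dist_eq, Real.dist_eq, sq_abs, sq_abs, hy0, hy1]
    have : M.R ^ 2 ≤ ρ ^ 2 := pow_le_pow_left₀ h.R_nonneg (le_of_lt hlt) 2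
    nlinarith
  refine ((M.isGreatest_weightLoss x).2 ⟨y, hd, rfl⟩).trans' ?_
  refine Finset.sum_le_sum_of_subset_of_nonneg (fun i hi => ?_) fun i _ _ => (h.weight_pos i).le
  rw [Finset.mem_filter, dist_lt_dist_iff, hy0, hy1]
  refine ⟨Finset.mem_univ i, ?_⟩
  have h1 := mul_lt_mul_of_pos_left (hρ i hi) (div_pos hρ0 hN)
  have h2 : ρ / N * (ρ / 2 * N) = ρ * ρ / 2 := by field_simp
  rw [h2] at h1
  nlinarith

theorem sum_conf (M : Market n) (a σ z τ : ℝ)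
    [DecidablePred fun i : Fin n => (M.conf a σ).Sees z τ i] : (M.conf a σ).depth z τ =
      ∑ i ∈ Finset.univ.filter fun i : Fin n => (M.conf a σ).Sees z τ i, M.weight i := by
  rw [Conf.depth, Finset.sum_range, Finset.sum_filter]
  refine Finset.sum_congr rfl fun i _ => ?_
  by_cases hs : (M.conf a σ).Sees z τ i
  · rw [if_pos hs, if_pos hs]; exact M.initial_w i
  · rw [if_neg hs, if_neg hs]

/-- Points with a smaller weight loss lie on one side of the line of slope `(τ - 1/τ) / 2` through
the height `σ * z` of the vertical line. -/
theorem Admissible.lt_of_weightLoss_lt (h : M.Admissible) (hσ : σ * σ = 1) {z τ m : ℝ} (hτ : 0 < τ)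
    (x : Plane) (hm : m ≤ (M.conf a σ).depth z τ) (hx : M.weightLoss x < m) :
    z < σ * (x 1 - (τ - 1 / τ) / 2 * (x 0 - a)) := by
  classical
  by_contra hle
  push Not at hle
  refine absurd (hm.trans ?_) (not_le.2 hx)
  rw [sum_conf]
  set s := (τ - 1 / τ) / 2 with hs
  set N := (τ + 1 / τ) / 2 with hNdef
  have hN : 0 < N := by positivity
  have hNs : N * N = s * s + 1 := by
    rw [hs, hNdef]; field_simp; ring
  refine h.sum_le_weightLoss x (p := -(σ * s)) (q := σ) hN ?_ _ fun i hi => ?_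
  · linear_combination hNs - (s * s + 1) * hσ
  · have hsee := (Finset.mem_filter.1 hi).2
    simp only [Conf.Sees, conf, initial_x, initial_y] at hsee
    have e : (M.R / 2 + σ * (M.pos i 0 - a)) * τ + (M.R / 2 - σ * (M.pos i 0 - a)) / τ =
        2 * (M.R / 2 * N + σ * (M.pos i 0 - a) * s) := by
      rw [hs, hNdef]; field_simp; ring
    rw [e] at hsee
    nlinarith

/-- Every follower captures at most what can be captured in the two open half-circles of
directions; the horizontal directions are limits. -/
theorem Admissible.weightLoss_le (h : M.Admissible) (x : Plane) (hx : x 0 = a) {v : ℝ}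
    (h₁ : ∀ u, (M.conf a 1).Reach (x 1) u → u ≤ v)
    (h₂ : ∀ u, (M.conf a (-1)).Reach (-x 1) u → u ≤ v) : M.weightLoss x ≤ v := by
  classical
  have hboth : ∀ σ : ℝ, σ = 1 ∨ σ = -1 → ∀ u, (M.conf a σ).Reach (σ * x 1) u → u ≤ v := by
    rintro σ (rfl | rfl) u hu
    · exact h₁ u (by simpa using hu)
    · exact h₂ u (by simpa using hu)
  obtain ⟨⟨y, hy, hcap⟩, -⟩ := M.isGreatest_weightLoss x
  rw [← hcap]
  set ξ := y 0 - x 0 with hξ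
  set η := y 1 - x 1 with hη
  set N := dist y x with hN
  have hN0 : 0 ≤ N := dist_nonneg
  have hNN : N * N = ξ * ξ + η * η := by
    rw [hN, EuclideanSpace.dist_eq, Real.mul_self_sqrt (by positivity), Fin.sum_univ_two,
      Real.dist_eq, Real.dist_eq, sq_abs, sq_abs]
    ring
  have hR := h.R_nonneg
  have hcapt : ∀ i, dist (M.pos i) y < dist (M.pos i) x →
      M.R / 2 * N < (M.pos i 0 - a) * ξ + (M.pos i 1 - x 1) * η := by
    intro i hi
    rw [dist_lt_dist_iff, hx] at hi
    have e0 : y 0 = a + ξ := by rw [hξ, hx]; ring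
    have e1 : y 1 = x 1 + η := by rw [hη]; ring
    rw [e0, e1] at hi
    have : M.R * N ≤ N * N := mul_le_mul_of_nonneg_right hy hN0
    nlinarith
  have suff : ∀ σ : ℝ, σ = 1 ∨ σ = -1 → ∀ τ, 0 < τ →
      (∀ i : Fin n, dist (M.pos i) y < dist (M.pos i) x →
        (M.conf a σ).Sees (σ * x 1) τ i) → M.capture x y ≤ v := by
    intro σ hσ τ hτ hall
    refine hboth σ hσ _ ⟨τ, hτ, ?_⟩
    rw [sum_conf]
    refine Finset.sum_le_sum_of_subset_of_nonneg (fun i hi => ?_) fun i _ _ => (h.weight_pos i).le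
    rw [Finset.mem_filter] at hi ⊢
    exact ⟨hi.1, hall i hi.2⟩
  have hsign : ∀ r : ℝ, r ≠ 0 → ∃ σ : ℝ, (σ = 1 ∨ σ = -1) ∧ 0 < σ * r := fun r hr => by
    rcases lt_or_gt_of_ne hr with hr | hr
    · exact ⟨-1, Or.inr rfl, by linarith⟩
    · exact ⟨1, Or.inl rfl, by linarith⟩
  -- A horizontal direction is replaced by one that is slightly tilted.
  by_cases hη0 : η = 0
  · by_cases hξ0 : ξ = 0
    · refine suff 1 (Or.inl rfl) 1 one_pos fun i hi => ?_
      have := hcapt i hi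
      have hN' : N * N = 0 := by rw [hNN, hη0, hξ0]; ring
      have : N = 0 := by simpa using hN'
      have hh := hcapt i hi
      rw [hη0, hξ0, this] at hh
      simp at hh
    · obtain ⟨σ, hσ, hpos⟩ := hsign ξ hξ0
      have hσσ : σ * σ = 1 := by rcases hσ with rfl | rfl <;> norm_num
      have hNξ : N = σ * ξ := by
        have : (N - σ * ξ) * (N + σ * ξ) = 0 := by
          rw [hη0] at hNN
          linear_combination hNN - ξ * ξ * hσσ
        rcases mul_eq_zero.1 this with h | h <;> linarith
      have hev : ∀ᶠ τ in nhdsWithin (0 : ℝ) (Set.Ioi 0), ∀ i : Fin n,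
          dist (M.pos i) y < dist (M.pos i) x → (M.conf a σ).Sees (σ * x 1) τ i := by
        rw [Filter.eventually_all]
        intro i
        by_cases hi : dist (M.pos i) y < dist (M.pos i) x
        · have hc := hcapt i hi
          rw [hη0, hNξ] at hc
          have hd : M.R / 2 < σ * (M.pos i 0 - a) := by
            have h1 : M.R / 2 * (σ * ξ) < σ * (M.pos i 0 - a) * (σ * ξ) := by
              linear_combination hc - (M.pos i 0 - a) * ξ * hσσ
            exact lt_of_mul_lt_mul_right h1 hpos.le
          set A := M.R / 2 + σ * (M.pos i 0 - a) with hA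
          set C := M.R / 2 - σ * (M.pos i 0 - a) with hC
          set E := σ * M.pos i 1 - σ * x 1 with hE
          have hcont : Continuous fun τ : ℝ => A * τ * τ - 2 * E * τ := by fun_prop
          have : ∀ᶠ τ in nhds (0 : ℝ), A * τ * τ - 2 * E * τ < -C := by
            refine (hcont.tendsto 0).eventually (gt_mem_nhds ?_)
            rw [hC]; norm_num; linarith
          filter_upwards [this.filter_mono nhdsWithin_le_nhds, self_mem_nhdsWithin] with τ h1 hτ _
          have hτ : 0 < τ := hτ
          simp only [Conf.Sees, conf, initial_x, initial_y]
          rw [← hA, ← hC, ← hE, ← mul_lt_mul_iff_left₀ hτ]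
          have : (A * τ + C / τ) * τ = A * τ * τ + C := by field_simp
          rw [this]
          linarith
        · exact Filter.Eventually.of_forall fun _ h => absurd h hi
      obtain ⟨τ, hall, hτ⟩ := (hev.and self_mem_nhdsWithin).exists
      exact suff σ hσ τ hτ hall
  · obtain ⟨σ, hσ, hpos⟩ := hsign η hη0
    have hσσ : σ * σ = 1 := by rcases hσ with rfl | rfl <;> norm_num
    have hNlt : σ * ξ < N := by
      refine lt_of_pow_lt_pow_left₀ 2 hN0 ?_
      have : 0 < η * η := mul_self_pos.2 hη0
      have h2 : (σ * ξ) ^ 2 = ξ * ξ := by linear_combination ξ * ξ * hσσ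
      rw [h2, pow_two, hNN]; linarith
    have hNlt' : 0 < N + σ * ξ := by
      have : -(σ * ξ) < N := by
        refine lt_of_pow_lt_pow_left₀ 2 hN0 ?_
        have : 0 < η * η := mul_self_pos.2 hη0
        have h2 : (-(σ * ξ)) ^ 2 = ξ * ξ := by linear_combination ξ * ξ * hσσ
        rw [h2, pow_two, hNN]; linarith
      linarith
    have hprod : (N - σ * ξ) * (N + σ * ξ) = (σ * η) * (σ * η) := by
      linear_combination hNN + (-(ξ * ξ) - η * η) * hσσ
    refine suff σ hσ ((N - σ * ξ) / (σ * η)) (div_pos (by linarith) hpos) fun i hi => ?_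
    have hc := hcapt i hi
    have hinv : ∀ C : ℝ, C / ((N - σ * ξ) / (σ * η)) = C * ((N + σ * ξ) / (σ * η)) := fun C => by
      have h1 : N - σ * ξ ≠ 0 := by linarith
      rw [div_eq_iff (by positivity), mul_assoc, div_mul_div_comm, mul_comm (N + σ * ξ), hprod,
        div_self (by positivity), mul_one]
    simp only [Conf.Sees, conf, initial_x, initial_y]
    rw [hinv, ← mul_lt_mul_iff_left₀ hpos]
    have e : ((M.R / 2 + σ * (M.pos i 0 - a)) * ((N - σ * ξ) / (σ * η)) +
        (M.R / 2 - σ * (M.pos i 0 - a)) * ((N + σ * ξ) / (σ * η))) * (σ * η) =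
        2 * (M.R / 2 * N - σ * (M.pos i 0 - a) * (σ * ξ)) := by
      generalize σ * η = D at hpos
      field_simp; ring
    rw [e]
    linear_combination 2 * hc - (2 * (M.pos i 0 - a) * ξ + 2 * (M.pos i 1 - x 1) * η) * hσσ

theorem slope_lt {τ τ' : ℝ} (h : 0 < τ) (h' : 0 < τ') (hlt : τ / (1 + τ) < τ' / (1 + τ')) :
    (τ - 1 / τ) / 2 < (τ' - 1 / τ') / 2 := by
  rw [div_lt_div_iff₀ (by linarith) (by linarith)] at hlt
  have h1 : τ < τ' := by linarith
  have h2 : 1 / τ' < 1 / τ := one_div_lt_one_div_of_lt h h1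
  linarith

/-- The pruning criterion. At a height where the captures cross, the points with smaller weight
loss lie in the wedge between the two lines perpendicular to an optimal direction of each
half-circle, and comparing the slopes of these lines tells on which side the wedge lies. -/
theorem Admissible.prune (h : M.Admissible) (hσ : σ * σ = 1) {y m m' l l' : ℝ}
    (h₁ : (M.conf a σ).IsTop (σ * y) m l) (h₂ : (M.conf a (-σ)).IsTopBelow (-(σ * y)) m' l')
    (hm : m ≤ m') (x : Plane)
    (hx : l < l' ∧ σ * (x 0 - a) < 0 ∨ l' ≤ l ∧ 0 < σ * (x 0 - a)) : m ≤ M.weightLoss x := by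
  by_contra hlt
  push Not at hlt
  -- A direction strictly between `l` and the directions near `l'` separates the two slopes.
  have key : ∀ τ τ₁, 0 < τ → 0 < τ₁ → m ≤ (M.conf a σ).depth (σ * y) τ →
      0 < σ * (x 0 - a) * ((τ - 1 / τ) / 2 - (τ₁ - 1 / τ₁) / 2) →
      (∀ᶠ t in nhds l', ∀ τ₂, 0 < τ₂ → τ₂ / (1 + τ₂) = t → σ * (x 0 - a) * ((τ₂ - 1 / τ₂) / 2) ≤
        σ * (x 0 - a) * ((τ₁ - 1 / τ₁) / 2)) → False := by
    intro τ τ₁ hτ hτ₁ hdep he hev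
    set e := σ * (x 0 - a) * ((τ - 1 / τ) / 2 - (τ₁ - 1 / τ₁) / 2) with hedef
    obtain ⟨t, ht, h3, h4⟩ := ((Conf.frequently_mem_Ioo h₂.nonneg h₂.le_one).and_eventually
      (hev.and (h₂.near (-(σ * y) - e / 2) (by linarith)))).exists
    obtain ⟨τ₂, hτ₂, hτ₂t⟩ := exists_param ht.1 ht.2
    have h5 := h3 τ₂ hτ₂ hτ₂t
    have h6 := h.lt_of_weightLoss_lt (a := a) hσ hτ x hdep hlt
    have h7 := h.lt_of_weightLoss_lt (a := a) (σ := -σ) (by linarith) hτ₂ x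
      (hm.trans (h4 τ₂ hτ₂ hτ₂t)) hlt
    nlinarith
  rcases hx with ⟨hl, hx⟩ | ⟨hl, hx⟩
  · obtain ⟨t, ht, htl⟩ := (h₁.near.and (Ioo_mem_nhdsGT hl)).exists
    obtain ⟨τ, hτ, hτt⟩ := exists_param (h₁.nonneg.trans_lt htl.1) (htl.2.trans_le h₂.le_one)
    obtain ⟨t₁, h3, h4⟩ := exists_between htl.2
    obtain ⟨τ₁, hτ₁, hτ₁t⟩ := exists_param ((h₁.nonneg.trans_lt htl.1).trans h3)
      (h4.trans_le h₂.le_one)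
    have hs := slope_lt hτ hτ₁ (by rw [hτt, hτ₁t]; exact h3)
    refine key τ τ₁ hτ hτ₁ (ht τ hτ hτt) (mul_pos_of_neg_of_neg hx (by linarith)) ?_
    filter_upwards [lt_mem_nhds h4] with t₂ ht₂ τ₂ hτ₂ hτ₂t
    have := slope_lt hτ₁ hτ₂ (by rw [hτ₁t, hτ₂t]; exact ht₂)
    exact mul_le_mul_of_nonpos_left this.le hx.le
  · obtain ⟨t, ht, htl⟩ := (h₁.near.and (Ioo_mem_nhdsGT h₁.lt_one)).exists
    obtain ⟨τ, hτ, hτt⟩ := exists_param (h₁.nonneg.trans_lt htl.1) htl.2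
    obtain ⟨t₁, h3, h4⟩ := exists_between htl.1
    obtain ⟨τ₁, hτ₁, hτ₁t⟩ := exists_param (h₁.nonneg.trans_lt h3) (h4.trans htl.2)
    have hs := slope_lt hτ₁ hτ (by rw [hτt, hτ₁t]; exact h4)
    refine key τ τ₁ hτ hτ₁ (ht τ hτ hτt) (mul_pos hx (by linarith)) ?_
    filter_upwards [gt_mem_nhds (hl.trans_lt h3)] with t₂ ht₂ τ₂ hτ₂ hτ₂t
    have := slope_lt hτ₂ hτ₁ (by rw [hτ₁t, hτ₂t]; exact ht₂)
    exact mul_le_mul_of_nonneg_left this.le hx.le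

end Market

/-! ### Evaluating a height of the line -/

/-- The memory contains the data of the market. -/
structure Loaded {n : ℕ} (M : Market n) (s : State) : Prop where
  n_eq : s.nat 0 0 = n
  x_eq : s.real 0 = M.initial.real 0
  y_eq : s.real 1 = M.initial.real 1
  w_eq : s.real 2 = M.initial.real 2
  R_eq : s.real 3 0 = M.R

theorem Loaded.of_agree {n : ℕ} {M : Market n} {s s' : State} {p : Prog} (h : Loaded M s)
    (ha : Agree p s s') (h0 : p.keepsNat 0 = true) (h0' : p.keepsReal 0 = true)
    (h1 : p.keepsReal 1 = true) (h2 : p.keepsReal 2 = true) (h3 : p.keepsReal 3 = true) :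
    Loaded M s' :=
  ⟨by rw [ha.nat 0 h0, h.n_eq], by rw [ha.real 0 h0', h.x_eq], by rw [ha.real 1 h1, h.y_eq],
    by rw [ha.real 2 h2, h.w_eq], by rw [ha.real 3 h3, h.R_eq]⟩

/-- The positive part of a real number. -/
def RExpr.pos (e : RExpr) : RExpr := .div (.add e (.sqrt (.mul e e))) (.lit 2)

@[simp] theorem RExpr.eval_pos (s : State) (e : RExpr) : e.pos.eval s = max (e.eval s) 0 := by
  simp only [RExpr.pos, RExpr.eval, Real.sqrt_mul_self_eq_abs]
  rcases le_total 0 (e.eval s) with h | h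
  · rw [abs_of_nonneg h, max_eq_left h]; push_cast; ring
  · rw [abs_of_nonpos h, max_eq_right h]; push_cast; ring

/-- The test `Valid cl A C E` on the scalars `23`, `24`, `25`. -/
def validTest (cl : Bool) : Test :=
  .not (.and (.not (.rlt (.mul (rv 23) (rv 24)) (.lit 0)))
    (.not (if cl = true then .and (.not (.rlt (rv 25) (.lit 0)))
        (.not (.rlt (.mul (rv 25) (rv 25)) (.mul (rv 23) (rv 24))))
      else .and (.rlt (.lit 0) (rv 25)) (.rlt (.mul (rv 23) (rv 24)) (.mul (rv 25) (rv 25))))))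

theorem holds_validTest (cl : Bool) (s : State) : (validTest cl).Holds s ↔
    Valid cl (s.real 23 0) (s.real 24 0) (s.real 25 0) := by
  cases cl <;> simp [validTest, Valid, ← not_lt] <;> tauto

/-- Computes the endpoints and the weight of the interval of directions of one customer. -/
def fillStep (σ : ℤ) (cl : Bool) : Prog :=
  .seq (.rset 23 (.lit 0) (.add (.div (rv 3) (.lit 2))
    (.mul (.lit σ) (.sub (.get 0 (nv 13)) (rv 4)))))
  (.seq (.rset 24 (.lit 0) (.sub (.div (rv 3) (.lit 2))
    (.mul (.lit σ) (.sub (.get 0 (nv 13)) (rv 4)))))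
  (.seq (.rset 25 (.lit 0) (.sub (.mul (.lit σ) (.get 1 (nv 13))) (.mul (.lit σ) (rv 22))))
  (.seq (.rset 26 (.lit 0) (.add (rv 25)
    (.sqrt (.sub (.mul (rv 25) (rv 25)) (.mul (rv 23) (rv 24))))))
  (.seq (.rset 7 (nv 13) (.div (.pos (rv 24)) (.add (rv 26) (.pos (rv 24)))))
  (.seq (.rset 8 (nv 13) (.sub (.lit 1) (.div (.pos (rv 23)) (.add (rv 26) (.pos (rv 23))))))
  (.ite (validTest cl) (.rset 9 (nv 13) (.get 2 (nv 13))) (.rset 9 (nv 13) (.lit 0))))))))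

/-- The customers below `k` have been dealt with by `fillStep`. -/
def FillInv (c : Conf) (cl : Bool) (z : ℝ) (k : ℕ) (s : State) : Prop :=
  ∀ i, i < k → s.real 7 i = lft (c.A i) (c.C i) (c.E z i) ∧
    s.real 8 i = rgt (c.A i) (c.C i) (c.E z i) ∧
    (Valid cl (c.A i) (c.C i) (c.E z i) → s.real 9 i = c.W i) ∧
    (¬ Valid cl (c.A i) (c.C i) (c.E z i) → s.real 9 i = 0)

theorem FillInv.succ {c : Conf} {cl : Bool} {z : ℝ} {k : ℕ} {s s' : State}
    (h : FillInv c cl z k s) {w : ℝ}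
    (h7 : s'.real 7 = Function.update (s.real 7) k (lft (c.A k) (c.C k) (c.E z k)))
    (h8 : s'.real 8 = Function.update (s.real 8) k (rgt (c.A k) (c.C k) (c.E z k)))
    (h9 : s'.real 9 = Function.update (s.real 9) k w)
    (hw : Valid cl (c.A k) (c.C k) (c.E z k) ∧ w = c.W k ∨
      ¬ Valid cl (c.A k) (c.C k) (c.E z k) ∧ w = 0) : FillInv c cl z (k + 1) s' := by
  intro i hi
  rw [h7, h8, h9]
  by_cases hik : i = k
  · subst hik
    simp only [Function.update_self]
    tauto
  · simp only [Function.update_of_ne hik]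
    exact h i (by omega)

theorem runs_fillStep {n : ℕ} {M : Market n} {s : State} {σ : ℤ} {cl : Bool} {k : ℕ}
    (hM : Loaded M s) (hk : s.nat 13 0 = k)
    (h : FillInv (M.conf (s.real 4 0) σ) cl (σ * s.real 22 0) k s) :
    Runs (fillStep σ cl) s (fillStep σ cl).maxCost
      (FillInv (M.conf (s.real 4 0) σ) cl (σ * s.real 22 0) (k + 1)) := by
  refine Runs.of_wp ?_
  simp only [fillStep, Prog.wp, holds_validTest, NExpr.eval, RExpr.eval, RExpr.eval_pos]
  refine ⟨fun hv => h.succ (w := s.real 2 k) ?_ ?_ ?_ (Or.inl ?_),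
    fun hv => h.succ (w := 0) ?_ ?_ ?_ (Or.inr ?_)⟩ <;>
  simp [hk, lft, rgt, pole, Market.conf, hM.x_eq, hM.y_eq, hM.R_eq, hM.w_eq] at hv ⊢ <;>
  exact hv

theorem runs_fill {n : ℕ} {M : Market n} {s : State} {σ : ℤ} {cl : Bool} (hM : Loaded M s) :
    Runs (forLoop 13 (nv 0) (fillStep σ cl)) s ((n + 1) * ((fillStep σ cl).maxCost + 17)) fun s' =>
      (M.conf (s.real 4 0) σ).Endpoints cl (σ * s.real 22 0) (s'.real 7) (s'.real 8)
        (s'.real 9) := by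
  refine (Runs.forLoop (B := n) (T := (fillStep σ cl).maxCost)
    (FillInv (M.conf (s.real 4 0) σ) cl (σ * s.real 22 0)) (fun s' ha => ?_) ?_
    (fun k s₁ hk h13 ha hI => ?_)).mono (le_of_eq ?_) ?_
  · simp [ha.nat 0 rfl, hM.n_eq]
  · intro i hi; omega
  · have e4 : s₁.real 4 = s.real 4 := ha.real 4 rfl
    have e22 : s₁.real 22 = s.real 22 := ha.real 22 rfl
    rw [← e4, ← e22] at hI ⊢
    refine (runs_fillStep (hM.of_agree ha rfl rfl rfl rfl rfl) h13 hI).mono le_rfl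
      fun s₂ ha₂ h => ⟨by rw [ha₂.nat 13 rfl, h13], h⟩
  · simp [NExpr.cost]
  · exact fun s' ha h => ⟨fun i hi => (h i hi).1, fun i hi => (h i hi).2.1,
      fun i hi => (h i hi).2.2.1, fun i hi => (h i hi).2.2.2⟩

/-- Copies the sorted indices from the array `10` to the array `12`. -/
def copyIdx : Prog := forLoop 13 (nv 0) (.nset 12 (nv 13) (.get 10 (nv 13)))

theorem runs_copyIdx {n : ℕ} {s : State} (hn : s.nat 0 0 = n) :
    Runs copyIdx s ((n + 1) * 23) fun s' => ∀ x, x < n → s'.nat 12 x = s.nat 10 x := by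
  refine (Runs.forLoop (B := n) (T := Prog.maxCost _) (fun k s' => ∀ x, x < k →
    s'.nat 12 x = s.nat 10 x) (fun s' ha => ?_) ?_ (fun k s₁ hk h13 ha hI => Runs.of_wp ?_)).mono
    (le_of_eq (by simp [NExpr.cost, Prog.maxCost])) fun _ _ h => h
  · simp [ha.nat 0 rfl, hn]
  · simp
  · simp [h13, Function.update_apply]
    intro x hx
    split_ifs with hxk
    · rw [ha.nat 10 rfl, hxk]
    · exact hI x (by omega)

theorem SortedIdx.congr {key key' : ℕ → ℝ} {P P' : ℕ → ℕ} {n : ℕ} (h : SortedIdx key P n)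
    (hP : ∀ x, x < n → P' x = P x) (hkey : ∀ x, x < n → key' x = key x) : SortedIdx key' P' n := by
  refine ⟨fun v hv => ?_, fun x y hxy hy => ?_⟩
  · obtain ⟨x, hx, hxv⟩ := h.cover v hv
    exact ⟨x, hx, by rw [hP x hx, hxv]⟩
  · rw [hP x (by omega), hP y hy, hkey _ (h.lt (by omega)), hkey _ (h.lt hy)]
    exact h.mono x y hxy hy

/-- Computes the largest capture at the height in the scalar `22` over the half-circle of
directions `σ`, or its limit if `cl = true`, with a direction attaining it. The results are stored
in the scalars `v` and `l`. -/
def depthProg (σ : ℤ) (cl : Bool) (v l : ℕ) : Prog :=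
  .seq (.nset 2 (.lit 0) (nv 0))
  (.seq (forLoop 13 (nv 0) (fillStep σ cl))
  (.seq (sortProg 7)
  (.seq copyIdx
  (.seq (sortProg 8)
  (.seq (sweepProg cl)
  (.seq (.rset v (.lit 0) (rv 19)) (.rset l (.lit 0) (rv 20))))))))

theorem runs_depthProg (σ : ℤ) (cl : Bool) {v l : ℕ} (hvl : v ≠ l) (hv : v ≠ 20) :
    ∃ c : ℕ, ∀ (n : ℕ) (M : Market n) (s : State), 1 ≤ n → M.Admissible → Loaded M s →
    Runs (depthProg σ cl v l) s (c * (n * (Nat.log 2 n + 1))) fun s' =>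
      (cl = false → (M.conf (s.real 4 0) σ).IsTop (σ * s.real 22 0) (s'.real v 0) (s'.real l 0)) ∧
      (cl = true →
        (M.conf (s.real 4 0) σ).IsTopBelow (σ * s.real 22 0) (s'.real v 0) (s'.real l 0)) := by
  obtain ⟨c₁, h₁⟩ := runs_sortProg 7
  obtain ⟨c₂, h₂⟩ := runs_sortProg 8
  obtain ⟨c₃, h₃⟩ := runs_sweepProg cl
  obtain ⟨c₄, hc₄⟩ : ∃ c, c = (fillStep σ cl).maxCost := ⟨_, rfl⟩
  refine ⟨c₁ + c₂ + c₃ + 2 * c₄ + 200, fun n M s hn hadm hM => ?_⟩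
  refine ((Runs.of_wp (s := s) (p := .nset 2 (.lit 0) (nv 0)) (Q := fun s' => s' = _) rfl).seq
    fun s₁ ha₁ e₁ => (runs_fill (M := M) (σ := σ) (cl := cl) ?_).seq
    fun s₂ ha₂ e₂ => (h₁ n s₂ hn ?_).seq
    fun s₃ ha₃ e₃ => (runs_copyIdx (n := n) ?_).seq
    fun s₄ ha₄ e₄ => (h₂ n s₄ hn ?_).seq
    fun s₅ ha₅ e₅ => (h₃ n s₅ hn ?_ ?_ ?_ ?_ ?_).seq
    fun s₆ ha₆ e₆ => (Runs.of_wp (p := .rset v (.lit 0) (rv 19)) (Q := fun s' => s' = _) rfl).seq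
    fun s₇ ha₇ e₇ => Runs.of_wp (p := .rset l (.lit 0) (rv 20)) (Q := fun s' =>
      (cl = false → (M.conf (s.real 4 0) σ).IsTop (σ * s.real 22 0) (s'.real v 0) (s'.real l 0)) ∧
      (cl = true →
        (M.conf (s.real 4 0) σ).IsTopBelow (σ * s.real 22 0) (s'.real v 0) (s'.real l 0)))
      ?_).mono ?_ fun _ _ h => h
  · exact hM.of_agree ha₁ rfl rfl rfl rfl rfl
  · rw [ha₂.nat 2 rfl, e₁]; simp [hM.n_eq]
  · rw [ha₃.nat 0 rfl, ha₂.nat 0 rfl, ha₁.nat 0 rfl, hM.n_eq]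
  · rw [ha₄.nat 2 rfl, ha₃.nat 2 rfl, ha₂.nat 2 rfl, e₁]; simp [hM.n_eq]
  · rw [ha₅.nat 0 rfl, ha₄.nat 0 rfl, ha₃.nat 0 rfl, ha₂.nat 0 rfl, ha₁.nat 0 rfl, hM.n_eq]
  · rw [ha₅.nat 12 rfl, ha₅.real 7 rfl, ha₄.real 7 rfl, ha₃.real 7 rfl]
    exact e₃.congr e₄ fun _ _ => rfl
  · rw [ha₅.real 8 rfl]; exact e₅
  pick_goal 4
  · rw [← hc₄]
    simp only [Prog.maxCost, NExpr.cost, RExpr.cost]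
    generalize Nat.log 2 n = q
    have : n ≤ n * (q + 1) := Nat.le_mul_of_pos_right _ (by omega)
    nlinarith [Nat.mul_le_mul_left c₃ this, Nat.mul_le_mul_left c₄ this,
      Nat.mul_le_mul_left c₄ hn]
  all_goals
    have he : (M.conf (s.real 4 0) σ).Endpoints cl (σ * s.real 22 0) (s₅.real 7) (s₅.real 8)
        (s₅.real 9) := by
      rw [ha₅.real 7 rfl, ha₄.real 7 rfl, ha₃.real 7 rfl, ha₅.real 8 rfl, ha₄.real 8 rfl,
        ha₃.real 8 rfl, ha₅.real 9 rfl, ha₄.real 9 rfl, ha₃.real 9 rfl]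
      rw [ha₁.real 4 rfl, ha₁.real 22 rfl] at e₂
      exact e₂
    have hok := hadm.conf_ok (s.real 4 0) (σ : ℝ)
  · intro i hi
    by_cases hval : Valid cl ((M.conf (s.real 4 0) σ).A i) ((M.conf (s.real 4 0) σ).C i)
      ((M.conf (s.real 4 0) σ).E (σ * s.real 22 0) i)
    · rw [he.W_valid i hi hval]; exact hok.W_nonneg i hi
    · rw [he.W_invalid i hi hval]
  · exact fun i hi hw lv hg => he.gone_imp hi hw lv hg
  · have ev : (s₇.setReal l 0 (s₇.real 20 0)).real v 0 = s₆.real 19 0 := by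
      simp [hvl, e₇]
    have el : (s₇.setReal l 0 (s₇.real 20 0)).real l 0 = s₆.real 20 0 := by
      simp [e₇, hv.symm]
    simp only [Prog.wp, NExpr.eval, RExpr.eval, ev, el]
    constructor
    · rintro rfl; exact he.isTop hok e₆
    · rintro rfl; exact he.isTopBelow hok e₆

/-- Evaluates the height in the scalar `22`. -/
def evalProg : Prog :=
  .seq (depthProg 1 false 30 40)
  (.seq (depthProg 1 true 31 41)
  (.seq (depthProg (-1) false 32 42) (depthProg (-1) true 33 43)))

/-- The results of evaluating the height in the scalar `22`. -/
structure Evaluated {n : ℕ} (M : Market n) (s : State) : Prop where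
  up : (M.conf (s.real 4 0) 1).IsTop (s.real 22 0) (s.real 30 0) (s.real 40 0)
  upBelow : (M.conf (s.real 4 0) 1).IsTopBelow (s.real 22 0) (s.real 31 0) (s.real 41 0)
  down : (M.conf (s.real 4 0) (-1)).IsTop (-s.real 22 0) (s.real 32 0) (s.real 42 0)
  downBelow : (M.conf (s.real 4 0) (-1)).IsTopBelow (-s.real 22 0) (s.real 33 0) (s.real 43 0)

theorem runs_evalProg : ∃ c : ℕ, ∀ (n : ℕ) (M : Market n) (s : State), 1 ≤ n → M.Admissible →
    Loaded M s → Runs evalProg s (c * (n * (Nat.log 2 n + 1))) (Evaluated M) := by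
  obtain ⟨c₁, h₁⟩ := runs_depthProg 1 false (v := 30) (l := 40) (by norm_num) (by norm_num)
  obtain ⟨c₂, h₂⟩ := runs_depthProg 1 true (v := 31) (l := 41) (by norm_num) (by norm_num)
  obtain ⟨c₃, h₃⟩ := runs_depthProg (-1) false (v := 32) (l := 42) (by norm_num) (by norm_num)
  obtain ⟨c₄, h₄⟩ := runs_depthProg (-1) true (v := 33) (l := 43) (by norm_num) (by norm_num)
  refine ⟨c₁ + (c₂ + (c₃ + c₄)), fun n M s hn hadm hM => ?_⟩
  refine ((h₁ n M s hn hadm hM).seq fun s₁ ha₁ e₁ => (h₂ n M s₁ hn hadm ?_).seq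
    fun s₂ ha₂ e₂ => (h₃ n M s₂ hn hadm ?_).seq
    fun s₃ ha₃ e₃ => (h₄ n M s₃ hn hadm ?_).mono le_rfl
    fun s₄ ha₄ e₄ => show Evaluated M s₄ from ?_).mono (le_of_eq (by ring)) fun _ _ h => h
  · exact hM.of_agree ha₁ rfl rfl rfl rfl rfl
  · exact (hM.of_agree ha₁ rfl rfl rfl rfl rfl).of_agree ha₂ rfl rfl rfl rfl rfl
  · exact ((hM.of_agree ha₁ rfl rfl rfl rfl rfl).of_agree ha₂ rfl rfl rfl rfl rfl).of_agree ha₃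
      rfl rfl rfl rfl rfl
  · have e1 := e₁.1 rfl
    have e2 := e₂.2 rfl
    have e3 := e₃.1 rfl
    have e4 := e₄.2 rfl
    rw [ha₃.real 4 rfl, ha₃.real 22 rfl, ha₂.real 4 rfl, ha₂.real 22 rfl] at e4
    rw [ha₂.real 4 rfl, ha₂.real 22 rfl] at e3
    rw [ha₁.real 4 rfl, ha₁.real 22 rfl] at e2 e3 e4
    norm_num at e1 e2 e3 e4
    constructor
    all_goals
      rw [ha₄.real 4 rfl, ha₄.real 22 rfl, ha₃.real 4 rfl, ha₃.real 22 rfl, ha₂.real 4 rfl,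
        ha₂.real 22 rfl, ha₁.real 4 rfl, ha₁.real 22 rfl]
    · rwa [ha₄.real 30 rfl, ha₃.real 30 rfl, ha₂.real 30 rfl, ha₄.real 40 rfl, ha₃.real 40 rfl,
        ha₂.real 40 rfl]
    · rwa [ha₄.real 31 rfl, ha₃.real 31 rfl, ha₄.real 41 rfl, ha₃.real 41 rfl]
    · rwa [ha₄.real 32 rfl, ha₄.real 42 rfl]
    · exact e4

/-! ### The matrix of critical heights -/

/-- The height at which the curve of a customer is tangent to the direction `T`, replaced by the
peak of the curve beyond the peak. This makes it a nondecreasing function of `T > 0`. -/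
noncomputable def peakFn (A C Y T : ℝ) : ℝ :=
  open Classical in if A * T * T < C then Y - (A * T + C / T) / 2 else Y - Real.sqrt (A * C)

theorem peakFn_mono {A C Y T T' : ℝ} (hAC : 0 ≤ A + C) (hT : 0 < T) (h : T ≤ T') :
    peakFn A C Y T ≤ peakFn A C Y T' := by
  have hT' : 0 < T' := hT.trans_le h
  unfold peakFn
  by_cases h1 : A * T * T < C
  · rw [if_pos h1]
    by_cases h2 : A * T' * T' < C
    · rw [if_pos h2]
      have h3 : A * T' + C / T' ≤ A * T + C / T := by
        have h4 : A * (T * T') ≤ C := by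
          rcases le_or_gt 0 A with hA | hA
          · have : A * (T * T') ≤ A * (T' * T') :=
              mul_le_mul_of_nonneg_left (mul_le_mul_of_nonneg_right h hT'.le) hA
            linarith
          · have : A * (T * T') < 0 := mul_neg_of_neg_of_pos hA (mul_pos hT hT')
            linarith
        have h5 : A * T + C / T - (A * T' + C / T') =
            (C - A * (T * T')) * (T' - T) / (T * T') := by
          field_simp; ring
        have h6 : 0 ≤ (C - A * (T * T')) * (T' - T) / (T * T') :=
          div_nonneg (mul_nonneg (by linarith) (by linarith)) (mul_pos hT hT').le
        linarith
      linarith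
    · rw [if_neg h2]
      have hA : 0 < A := by
        by_contra hA
        push Not at h2 hA
        have : A * (T' * T') ≤ A * (T * T) :=
          mul_le_mul_of_nonpos_left (mul_le_mul h h hT.le hT'.le) hA
        linarith
      have h3 : 0 < C := lt_of_le_of_lt (by positivity) h1
      have h4 : Real.sqrt (A * C) ≤ (A * T + C / T) / 2 := by
        rw [Real.sqrt_le_left (by positivity)]
        have : ((A * T + C / T) / 2) ^ 2 - A * C = ((A * T - C / T) / 2) ^ 2 := by
          field_simp; ring
        nlinarith [sq_nonneg ((A * T - C / T) / 2)]
      linarith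
  · have h2 : ¬ A * T' * T' < C := by
      intro h2
      apply h1
      rcases le_or_gt 0 A with hA | hA
      · have : A * (T * T) ≤ A * (T' * T') :=
          mul_le_mul_of_nonneg_left (mul_le_mul h h hT.le hT'.le) hA
        linarith
      · have : A * T * T < 0 := by
          rw [mul_assoc]; exact mul_neg_of_neg_of_pos hA (mul_pos hT hT)
        linarith
    rw [if_neg h1, if_neg h2]

/-- Both the peak of a curve and its heights on either side of the peak occur among the values of
`peakFn`. -/
theorem peakFn_peak {A C Y T : ℝ} (hT : 0 < T) :
    peakFn A C Y T = Y - Real.sqrt (A * C) ∨ peakFn C A Y (1 / T) = Y - Real.sqrt (A * C) := by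
  by_cases h1 : A * T * T < C
  · right
    rw [peakFn, if_neg, mul_comm C A]
    have : C * (1 / T) * (1 / T) = C / (T * T) := by field_simp
    rw [this, not_lt, le_div_iff₀ (by positivity)]
    linarith
  · left
    rw [peakFn, if_neg h1]

theorem peakFn_curve {A C Y T : ℝ} (hAC : 0 ≤ A + C) (hT : 0 < T) :
    peakFn A C Y T = Y - (A * T + C / T) / 2 ∨
      peakFn C A Y (1 / T) = Y - (A * T + C / T) / 2 := by
  by_cases h1 : A * T * T < C
  · left
    rw [peakFn, if_pos h1]
  · by_cases h2 : C < A * T * T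
    · right
      rw [peakFn, if_pos]
      · rw [div_div_eq_mul_div, div_one]; ring
      · have : C * (1 / T) * (1 / T) = C / (T * T) := by field_simp
        rw [this, div_lt_iff₀ (by positivity)]
        linarith
    · left
      have hC : C = A * T * T := le_antisymm (not_lt.1 h1) (not_lt.1 h2)
      have hA : 0 ≤ A := by
        by_contra hA
        have : A * (T * T) < 0 := mul_neg_of_neg_of_pos (not_le.1 hA) (mul_pos hT hT)
        linarith
      rw [peakFn, if_neg h1, hC]
      have e1 : A * (A * T * T) = (A * T) * (A * T) := by ring
      rw [e1, Real.sqrt_mul_self (mul_nonneg hA hT.le)]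
      field_simp
      ring

namespace Market

variable {n : ℕ} {M : Market n} {a σ : ℝ}

/-- The parameter `τ` of the direction perpendicular to the line through two customers. For `i = j`
the division by zero makes it the harmless value `1`. -/
noncomputable def slopeParam (M : Market n) (i j : ℕ) : ℝ :=
  let s := (M.initial.real 1 j - M.initial.real 1 i) / (M.initial.real 0 j - M.initial.real 0 i)
  s + Real.sqrt (1 + s * s)

theorem slopeParam_pos (M : Market n) (i j : ℕ) : 0 < M.slopeParam i j := by
  rw [slopeParam]
  generalize (M.initial.real 1 j - M.initial.real 1 i) /
    (M.initial.real 0 j - M.initial.real 0 i) = s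
  have : |s| < Real.sqrt (1 + s * s) := by
    rw [← Real.sqrt_mul_self_eq_abs]
    exact Real.sqrt_lt_sqrt (mul_self_nonneg s) (by linarith)
  linarith [neg_abs_le s]

/-- `ρ` lists the directions perpendicular to the lines through the customer `i`, in increasing
order. -/
structure IsRow (M : Market n) (i : ℕ) (ρ : ℕ → ℝ) : Prop where
  pos : ∀ k, k < n → 0 < ρ k
  mono : ∀ k k', k ≤ k' → k' < n → ρ k ≤ ρ k'
  cover : ∀ j, j < n → ∃ k, k < n ∧ ρ k = M.slopeParam i j

/-- The four rows of the customer `i` in the table of directions. -/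
def RowStored (M : Market n) (TT : ℕ → ℝ) (i : ℕ) : Prop :=
  ∃ ρ, M.IsRow i ρ ∧ ∀ j, j < n → TT (i * n + j) = ρ j ∧
    TT ((i + n) * n + (n - 1 - j)) = 1 / ρ j ∧ TT ((i + n + n) * n + (n - 1 - j)) = ρ j ∧
    TT ((i + n + n + n) * n + j) = 1 / ρ j

/-- The parameters of the four rows of each customer: the rising and the falling branch of its
curve, for upward directions and (after a half-turn) for downward directions. -/
def Branches (M : Market n) (a : ℝ) (cA cC cY cS : ℕ → ℝ) : Prop :=
  ∀ i, i < n →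
    (cA i = M.R / 2 + (M.initial.real 0 i - a) ∧ cC i = M.R / 2 - (M.initial.real 0 i - a) ∧
      cY i = M.initial.real 1 i ∧ cS i = 1) ∧
    (cA (i + n) = M.R / 2 - (M.initial.real 0 i - a) ∧
      cC (i + n) = M.R / 2 + (M.initial.real 0 i - a) ∧
      cY (i + n) = M.initial.real 1 i ∧ cS (i + n) = 1) ∧
    (cA (i + n + n) = M.R / 2 - (M.initial.real 0 i - a) ∧
      cC (i + n + n) = M.R / 2 + (M.initial.real 0 i - a) ∧
      cY (i + n + n) = -M.initial.real 1 i ∧ cS (i + n + n) = -1) ∧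
    (cA (i + n + n + n) = M.R / 2 + (M.initial.real 0 i - a) ∧
      cC (i + n + n + n) = M.R / 2 - (M.initial.real 0 i - a) ∧
      cY (i + n + n + n) = -M.initial.real 1 i ∧ cS (i + n + n + n) = -1)

/-- The critical height in row `q` and column `k`. -/
noncomputable def critHeight (n : ℕ) (TT cA cC cY cS : ℕ → ℝ) (q k : ℕ) : ℝ :=
  cS q * peakFn (cA q) (cC q) (cY q) (TT (q * n + k))

theorem exists_row {n q : ℕ} (hq : q < n + n + n + n) :
    ∃ i, i < n ∧ (q = i ∨ q = i + n ∨ q = i + n + n ∨ q = i + n + n + n) := by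
  by_cases h1 : q < n
  · exact ⟨q, h1, Or.inl rfl⟩
  by_cases h2 : q < n + n
  · exact ⟨q - n, by omega, by omega⟩
  by_cases h3 : q < n + n + n
  · exact ⟨q - n - n, by omega, by omega⟩
  · exact ⟨q - n - n - n, by omega, by omega⟩

/-- Every row is sorted: the falling branches are listed by the decreasing parameter `1 / τ`, and a
half-turn reverses the order of the columns. -/
theorem critHeight_mono (hR : 0 ≤ M.R) {TT cA cC cY cS : ℕ → ℝ}
    (hTT : ∀ i, i < n → M.RowStored TT i) (hB : M.Branches a cA cC cY cS) {q k k' : ℕ}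
    (hq : q < n + n + n + n) (hk : k ≤ k') (hk' : k' < n) :
    critHeight n TT cA cC cY cS q k ≤ critHeight n TT cA cC cY cS q k' := by
  obtain ⟨i, hi, hqi⟩ := exists_row hq
  obtain ⟨ρ, hρ, hst⟩ := hTT i hi
  obtain ⟨⟨a1, a2, a3, a4⟩, ⟨b1, b2, b3, b4⟩, ⟨c1, c2, c3, c4⟩, ⟨d1, d2, d3, d4⟩⟩ := hB i hi
  have hrev : ∀ k, k < n → n - 1 - (n - 1 - k) = k := fun k hk => by omega
  unfold critHeight
  rcases hqi with rfl | rfl | rfl | rfl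
  · rw [(hst k (by omega)).1, (hst k' hk').1, a1, a2, a3, a4]
    have := peakFn_mono (A := M.R / 2 + (M.initial.real 0 q - a))
      (C := M.R / 2 - (M.initial.real 0 q - a)) (Y := M.initial.real 1 q) (by linarith)
      (hρ.pos k (by omega)) (hρ.mono k k' hk hk')
    linarith
  · have e1 := (hst (n - 1 - k) (by omega)).2.1
    have e2 := (hst (n - 1 - k') (by omega)).2.1
    rw [hrev k (by omega)] at e1
    rw [hrev k' hk'] at e2
    rw [e1, e2, b1, b2, b3, b4]
    have hp := hρ.pos (n - 1 - k') (by omega)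
    have hm := hρ.mono (n - 1 - k') (n - 1 - k) (by omega) (by omega)
    have := peakFn_mono (A := M.R / 2 - (M.initial.real 0 i - a))
      (C := M.R / 2 + (M.initial.real 0 i - a)) (Y := M.initial.real 1 i) (by linarith)
      (one_div_pos.2 (hp.trans_le hm)) (one_div_le_one_div_of_le hp hm)
    linarith
  · have e1 := (hst (n - 1 - k) (by omega)).2.2.1
    have e2 := (hst (n - 1 - k') (by omega)).2.2.1
    rw [hrev k (by omega)] at e1
    rw [hrev k' hk'] at e2
    rw [e1, e2, c1, c2, c3, c4]
    have hp := hρ.pos (n - 1 - k') (by omega)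
    have hm := hρ.mono (n - 1 - k') (n - 1 - k) (by omega) (by omega)
    have := peakFn_mono (A := M.R / 2 - (M.initial.real 0 i - a))
      (C := M.R / 2 + (M.initial.real 0 i - a)) (Y := -M.initial.real 1 i) (by linarith) hp hm
    linarith
  · rw [(hst k (by omega)).2.2.2, (hst k' hk').2.2.2, d1, d2, d3, d4]
    have hp := hρ.pos k (by omega)
    have hm := hρ.mono k k' hk hk'
    have := peakFn_mono (A := M.R / 2 + (M.initial.real 0 i - a))
      (C := M.R / 2 - (M.initial.real 0 i - a)) (Y := -M.initial.real 1 i) (by linarith)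
      (one_div_pos.2 (hp.trans_le hm)) (one_div_le_one_div_of_le hp hm)
    linarith

/-- Two customers `i` and `j` on a common tangent line have a direction perpendicular to the line
through `i` and `j`, which does not depend on the vertical line. -/
theorem critical_covered (h : M.Admissible) (hσ : σ * σ = 1) {z : ℝ}
    (hz : (M.conf a σ).Critical z) : ∃ i, i < n ∧ ∀ ρ, M.IsRow i ρ → ∃ k, k < n ∧
      (peakFn ((M.conf a σ).A i) ((M.conf a σ).C i) (σ * M.initial.real 1 i) (ρ k) = z ∨
        peakFn ((M.conf a σ).C i) ((M.conf a σ).A i) (σ * M.initial.real 1 i) (1 / ρ k) = z) := by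
  have hAC := (h.conf_ok a σ).AC_nonneg
  rcases hz with ⟨i, hi, hE⟩ | ⟨i, j, τ, hi, hj, hij, hτ, h1, h2⟩
  · refine ⟨i, hi, fun ρ hρ => ⟨0, (Nat.zero_le i).trans_lt hi, ?_⟩⟩
    have hz : z = σ * M.initial.real 1 i - Real.sqrt ((M.conf a σ).A i * (M.conf a σ).C i) := by
      rw [← hE]; simp only [Conf.E, conf]; ring
    rw [hz]
    exact peakFn_peak (hρ.pos 0 ((Nat.zero_le i).trans_lt hi))
  · refine ⟨i, hi, fun ρ hρ => ?_⟩
    obtain ⟨k, hk, hkτ⟩ := hρ.cover j hj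
    have hτs : M.slopeParam i j = τ := by
      have hx : M.initial.real 0 j - M.initial.real 0 i ≠ 0 := by
        have hi' : i < n := hi
        have hj' : j < n := hj
        have e1 := M.initial_x ⟨i, hi'⟩
        have e2 := M.initial_x ⟨j, hj'⟩
        dsimp only at e1 e2
        rw [e1, e2]
        refine sub_ne_zero.2 fun he => hij ?_
        have := h.x_injective he
        simpa using this.symm
      have hs : (M.initial.real 1 j - M.initial.real 1 i) /
          (M.initial.real 0 j - M.initial.real 0 i) = (τ - 1 / τ) / 2 := by
        rw [div_eq_iff hx]
        simp only [Conf.A, Conf.C, Conf.E, conf] at h1 h2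
        field_simp at h1 h2 ⊢
        have : σ * (σ * (2 * τ * (M.initial.real 1 j - M.initial.real 1 i) -
            (τ ^ 2 - 1) * (M.initial.real 0 j - M.initial.real 0 i))) = 0 := by
          linear_combination σ / 2 * 2 * (h1 - h2) / 2
        rw [← mul_assoc, hσ, one_mul] at this
        linarith
      rw [slopeParam]
      rw [hs, show 1 + (τ - 1 / τ) / 2 * ((τ - 1 / τ) / 2) =
        ((τ + 1 / τ) / 2) * ((τ + 1 / τ) / 2) by field_simp; ring,
        Real.sqrt_mul_self (by positivity)]
      ring
    have hz : z = σ * M.initial.real 1 i -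
        ((M.conf a σ).A i * τ + (M.conf a σ).C i / τ) / 2 := by
      rw [h1]; simp only [Conf.E, conf]; ring
    refine ⟨k, hk, ?_⟩
    rw [hkτ, hτs, hz]
    exact peakFn_curve (hAC i) hτ

/-- All critical heights occur in the matrix. -/
theorem critHeight_cover (h : M.Admissible) {TT cA cC cY cS : ℕ → ℝ}
    (hTT : ∀ i, i < n → M.RowStored TT i) (hB : M.Branches a cA cC cY cS) {y : ℝ}
    (hy : (M.conf a 1).Critical y ∨ (M.conf a (-1)).Critical (-y)) :
    ∃ q k, q < n + n + n + n ∧ k < n ∧ critHeight n TT cA cC cY cS q k = y := by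
  unfold critHeight
  rcases hy with hy | hy
  · obtain ⟨i, hi, hcov⟩ := critical_covered h (by norm_num) hy
    obtain ⟨ρ, hρ, hst⟩ := hTT i hi
    obtain ⟨⟨a1, a2, a3, a4⟩, ⟨b1, b2, b3, b4⟩, -⟩ := hB i hi
    obtain ⟨k, hk, hval⟩ := hcov ρ hρ
    simp only [Conf.A, Conf.C, conf, one_mul] at hval
    rcases hval with hval | hval
    · exact ⟨i, k, by omega, hk, by rw [(hst k hk).1, a1, a2, a3, a4, hval, one_mul]⟩
    · exact ⟨i + n, n - 1 - k, by omega, by omega, by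
        rw [(hst k hk).2.1, b1, b2, b3, b4, hval, one_mul]⟩
  · obtain ⟨i, hi, hcov⟩ := critical_covered h (by norm_num) hy
    obtain ⟨ρ, hρ, hst⟩ := hTT i hi
    obtain ⟨-, -, ⟨c1, c2, c3, c4⟩, ⟨d1, d2, d3, d4⟩⟩ := hB i hi
    obtain ⟨k, hk, hval⟩ := hcov ρ hρ
    simp only [Conf.A, Conf.C, conf, neg_mul, one_mul, sub_neg_eq_add, ← sub_eq_add_neg] at hval
    rcases hval with hval | hval
    · exact ⟨i + n + n, n - 1 - k, by omega, by omega, by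
        rw [(hst k hk).2.2.1, c1, c2, c3, c4, hval]; ring⟩
    · exact ⟨i + n + n + n, k, by omega, hk, by
        rw [(hst k hk).2.2.2, d1, d2, d3, d4, hval]; ring⟩

end Market

/-! ### Preprocessing -/

/-- The lowest customer, lowered by half the minimal distance, into the scalar `11`. -/
def lowestProg : Prog :=
  .seq (.rset 11 (.lit 0) (.sub (.get 1 (.lit 0)) (.div (rv 3) (.lit 2))))
  (forLoop 13 (nv 0)
    (.ite (.rlt (.sub (.get 1 (nv 13)) (.div (rv 3) (.lit 2))) (rv 11))
      (.rset 11 (.lit 0) (.sub (.get 1 (nv 13)) (.div (rv 3) (.lit 2)))) .skip))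

theorem runs_lowestProg {n : ℕ} {s : State} (hn : s.nat 0 0 = n) :
    Runs lowestProg s ((n + 1) * 100) fun s' =>
      ∀ i, i < n → s'.real 11 0 ≤ s.real 1 i - s.real 3 0 / 2 := by
  refine ((Runs.of_wp (s := s) (p := .rset 11 (.lit 0) (.sub (.get 1 (.lit 0))
    (.div (rv 3) (.lit 2)))) (Q := fun s' => s' = _) rfl).seq fun s₁ ha₁ e₁ =>
    Runs.forLoop (B := n) (T := Prog.maxCost _) (fun k s' =>
      ∀ i, i < k → s'.real 11 0 ≤ s.real 1 i - s.real 3 0 / 2) (fun s' ha => ?_) ?_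
      (fun k s₂ hk h13 ha hI => Runs.of_wp ?_)).mono ?_ fun _ _ h => h
  · simp [ha.nat 0 rfl, ha₁.nat 0 rfl, hn]
  · simp
  · have e1 : s₂.real 1 = s.real 1 := by rw [ha.real 1 rfl, ha₁.real 1 rfl]
    have e3 : s₂.real 3 = s.real 3 := by rw [ha.real 3 rfl, ha₁.real 3 rfl]
    simp [h13, e1, e3]
    refine ⟨fun hlt i hi => ?_, fun hlt i hi => ?_⟩
    · rcases Nat.lt_or_eq_of_le hi with hi | rfl
      · linarith [hI i hi]
      · exact le_rfl
    · rcases Nat.lt_or_eq_of_le hi with hi | rfl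
      · exact hI i hi
      · linarith
  · simp [Prog.maxCost, NExpr.cost, RExpr.cost, Test.cost]; nlinarith

/-- The scalar `21` becomes the number of rows, and the array `15` the table of their offsets. -/
def offsetProg : Prog :=
  .seq (.nset 21 (.lit 0) (.add (.add (.add (nv 0) (nv 0)) (nv 0)) (nv 0)))
  (.seq (.nset 24 (.lit 0) (.lit 0))
  (forLoop 13 (nv 21)
    (.seq (.nset 15 (nv 13) (nv 24)) (.nset 24 (.lit 0) (.add (nv 24) (nv 0))))))

theorem runs_offsetProg {n : ℕ} {s : State} (hn : s.nat 0 0 = n) :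
    Runs offsetProg s ((n + 1) * 300) fun s' => s'.nat 21 0 = n + n + n + n ∧
      ∀ q, q < n + n + n + n → s'.nat 15 q = q * n := by
  refine ((Runs.of_wp (s := s) (p := .nset 21 (.lit 0)
    (.add (.add (.add (nv 0) (nv 0)) (nv 0)) (nv 0))) (Q := fun s' => s' = _) rfl).seq
    fun s₁ ha₁ e₁ => (Runs.of_wp (p := .nset 24 (.lit 0) (.lit 0)) (Q := fun s' => s' = _) rfl).seq
    fun s₂ ha₂ e₂ => Runs.forLoop (B := n + n + n + n) (T := Prog.maxCost _) (fun k s' =>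
      s'.nat 21 0 = n + n + n + n ∧ s'.nat 24 0 = k * n ∧ ∀ q, q < k → s'.nat 15 q = q * n)
      (fun s' ha => ?_) ?_ (fun k s₃ hk h13 ha hI => Runs.of_wp ?_)).mono ?_
      fun _ _ h => ⟨h.1, h.2.2⟩
  · simp [ha.nat 21 rfl, e₂, e₁, hn]
  · simp [e₂, e₁, hn]
  · have e0 : s₃.nat 0 0 = n := by simp [ha.nat 0 rfl, e₂, e₁, hn]
    obtain ⟨h1, h2, h3⟩ := hI
    simp [h13, e0, h1, h2]
    refine ⟨by ring, fun q hq => ?_⟩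
    rcases Nat.lt_or_eq_of_le hq with hq | rfl
    · rw [Function.update_of_ne (by omega)]; exact h3 q hq
    · simp
  · simp [Prog.maxCost, NExpr.cost]; nlinarith

/-- Cells in different places of an array of rows of length `n` have different addresses. -/
theorem addr_inj {n q q' j j' : ℕ} (hj : j < n) (hj' : j' < n) :
    q * n + j = q' * n + j' ↔ q = q' ∧ j = j' := by
  refine ⟨fun h => ?_, fun h => by rw [h.1, h.2]⟩
  have hq : q = q' := by
    have h1 : q * n < (q' + 1) * n := by linarith
    have h2 : q' * n < (q + 1) * n := by linarith
    have := Nat.lt_of_mul_lt_mul_right h1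
    have := Nat.lt_of_mul_lt_mul_right h2
    omega
  subst hq
  exact ⟨rfl, by omega⟩

theorem update_addr {n q q' j j' : ℕ} (f : ℕ → ℝ) (v : ℝ) (hj : j < n) (hj' : j' < n) :
    Function.update f (q * n + j) v (q' * n + j') =
      if q' = q ∧ j' = j then v else f (q' * n + j') := by
  rw [Function.update_apply]
  simp only [addr_inj hj' hj]

/-- The directions perpendicular to the lines through the customer in the scalar `22`. -/
def slopeLoop : Prog :=
  forLoop 13 (nv 0)
    (.seq (.rset 27 (.lit 0) (.div (.sub (.get 1 (nv 13)) (.get 1 (nv 22)))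
      (.sub (.get 0 (nv 13)) (.get 0 (nv 22)))))
    (.rset 6 (nv 13) (.add (rv 27) (.sqrt (.add (.lit 1) (.mul (rv 27) (rv 27)))))))

theorem runs_slopeLoop {n : ℕ} {M : Market n} {s : State} {i : ℕ} (hM : Loaded M s)
    (hi : s.nat 22 0 = i) : Runs slopeLoop s ((n + 1) * 100) fun s' =>
      ∀ j, j < n → s'.real 6 j = M.slopeParam i j := by
  refine (Runs.forLoop (B := n) (T := Prog.maxCost _) (fun k s' =>
    ∀ j, j < k → s'.real 6 j = M.slopeParam i j) (fun s' ha => ?_) ?_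
    (fun k s₁ hk h13 ha hI => Runs.of_wp ?_)).mono ?_ fun _ _ h => h
  · simp [ha.nat 0 rfl, hM.n_eq]
  · simp
  · have e0 : s₁.real 0 = M.initial.real 0 := by rw [ha.real 0 rfl, hM.x_eq]
    have e1 : s₁.real 1 = M.initial.real 1 := by rw [ha.real 1 rfl, hM.y_eq]
    have e22 : s₁.nat 22 0 = i := by rw [ha.nat 22 rfl, hi]
    simp [h13, e0, e1, e22]
    intro j hj
    rcases Nat.lt_or_eq_of_le hj with hj | rfl
    · rw [Function.update_of_ne (by omega)]; exact hI j hj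
    · simp [Market.slopeParam]
  · simp [Prog.maxCost, NExpr.cost, RExpr.cost]

/-- The address of column `k` in the row `q`. -/
def cellAddr (q k : NExpr) : NExpr := .add (.get 15 q) k

/-- Stores the sorted directions of the customer in the scalar `22` in its four rows. -/
def storeStep : Prog :=
  .seq (.rset 27 (.lit 0) (.get 6 (.get 10 (nv 13))))
  (.seq (.rset 10 (cellAddr (nv 22) (nv 13)) (rv 27))
  (.seq (.rset 10 (cellAddr (.add (nv 22) (nv 0)) (.sub (.sub (nv 0) (.lit 1)) (nv 13)))
    (.div (.lit 1) (rv 27)))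
  (.seq (.rset 10 (cellAddr (.add (.add (nv 22) (nv 0)) (nv 0))
    (.sub (.sub (nv 0) (.lit 1)) (nv 13))) (rv 27))
  (.rset 10 (cellAddr (.add (.add (.add (nv 22) (nv 0)) (nv 0)) (nv 0)) (nv 13))
    (.div (.lit 1) (rv 27))))))

theorem runs_storeLoop {n : ℕ} {s : State} {i : ℕ} (hn : s.nat 0 0 = n)
    (hi : s.nat 22 0 = i) (hin : i < n)
    (hoff : ∀ q, q < n + n + n + n → s.nat 15 q = q * n) :
    Runs (forLoop 13 (nv 0) storeStep) s ((n + 1) * 200) fun s' =>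
      (∀ j, j < n → s'.real 10 (i * n + j) = s.real 6 (s.nat 10 j) ∧
        s'.real 10 ((i + n) * n + (n - 1 - j)) = 1 / s.real 6 (s.nat 10 j) ∧
        s'.real 10 ((i + n + n) * n + (n - 1 - j)) = s.real 6 (s.nat 10 j) ∧
        s'.real 10 ((i + n + n + n) * n + j) = 1 / s.real 6 (s.nat 10 j)) ∧
      ∀ q j, j < n → q ≠ i → q ≠ i + n → q ≠ i + n + n → q ≠ i + n + n + n →
        s'.real 10 (q * n + j) = s.real 10 (q * n + j) := by
  refine (Runs.forLoop (B := n) (T := Prog.maxCost _) (fun k s' =>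
      (∀ j, j < k → s'.real 10 (i * n + j) = s.real 6 (s.nat 10 j) ∧
        s'.real 10 ((i + n) * n + (n - 1 - j)) = 1 / s.real 6 (s.nat 10 j) ∧
        s'.real 10 ((i + n + n) * n + (n - 1 - j)) = s.real 6 (s.nat 10 j) ∧
        s'.real 10 ((i + n + n + n) * n + j) = 1 / s.real 6 (s.nat 10 j)) ∧
      ∀ q j, j < n → q ≠ i → q ≠ i + n → q ≠ i + n + n → q ≠ i + n + n + n →
        s'.real 10 (q * n + j) = s.real 10 (q * n + j))
    (fun s' ha => ?_) ?_ (fun k s₁ hk h13 ha hI => Runs.of_wp ?_)).mono ?_ fun _ _ h => h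
  · simp [ha.nat 0 rfl, hn]
  · simp
  · have e0 : s₁.nat 0 0 = n := by rw [ha.nat 0 rfl, hn]
    have e22 : s₁.nat 22 0 = i := by rw [ha.nat 22 rfl, hi]
    have e15 : ∀ q, q < n + n + n + n → s₁.nat 15 q = q * n := by
      rw [ha.nat 15 rfl]; exact hoff
    have e6 : s₁.real 6 (s₁.nat 10 k) = s.real 6 (s.nat 10 k) := by
      rw [ha.nat 10 rfl, ha.real 6 rfl]
    have o1 := e15 i (by omega)
    have o2 := e15 (i + n) (by omega)
    have o3 := e15 (i + n + n) (by omega)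
    have o4 := e15 (i + n + n + n) (by omega)
    simp only [storeStep, cellAddr, Prog.wp, NExpr.eval, RExpr.eval, State.setReal_nat,
      State.setReal_real, State.setNat_real, h13, e0, e22, o1, o2, o3, o4, e6]
    simp only [if_true, if_false, Function.update_self, Nat.reduceEqDiff, Int.cast_one]
    refine ⟨trivial, fun j hj => ?_, fun q j hj h1 h2 h3 h4 => ?_⟩
    · have hk' : n - 1 - k < n := by omega
      have hjn : j < n := by omega
      have hj' : n - 1 - j < n := by omega
      simp only [update_addr _ _ hk hjn, update_addr _ _ hk hj', update_addr _ _ hk' hjn,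
        update_addr _ _ hk' hj']
      rcases Nat.lt_succ_iff_lt_or_eq.1 hj with hj | rfl
      · obtain ⟨i1, i2, i3, i4⟩ := hI.1 j hj
        refine ⟨?_, ?_, ?_, ?_⟩
        · rw [if_neg (by omega), if_neg (by omega), if_neg (by omega), if_neg (by omega), i1]
        · rw [if_neg (by omega), if_neg (by omega), if_neg (by omega), if_neg (by omega), i2]
        · rw [if_neg (by omega), if_neg (by omega), if_neg (by omega), if_neg (by omega), i3]
        · rw [if_neg (by omega), if_neg (by omega), if_neg (by omega), if_neg (by omega), i4]
      · refine ⟨?_, ?_, ?_, ?_⟩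
        · rw [if_neg (by omega), if_neg (by omega), if_neg (by omega), if_pos (by simp)]
        · rw [if_neg (by omega), if_neg (by omega), if_pos (by simp)]
        · rw [if_neg (by omega), if_pos (by simp)]
        · rw [if_pos (by simp)]
    · have hk' : n - 1 - k < n := by omega
      simp only [update_addr _ _ hk hj, update_addr _ _ hk' hj]
      rw [if_neg (by omega), if_neg (by omega), if_neg (by omega), if_neg (by omega)]
      exact hI.2 q j hj h1 h2 h3 h4
  · simp [storeStep, cellAddr, Prog.maxCost, NExpr.cost, RExpr.cost]

theorem Market.RowStored.congr {n : ℕ} {M : Market n} {TT TT' : ℕ → ℝ} {i : ℕ}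
    (h : M.RowStored TT i) (hTT : ∀ q j, j < n →
      q = i ∨ q = i + n ∨ q = i + n + n ∨ q = i + n + n + n → TT' (q * n + j) = TT (q * n + j)) :
    M.RowStored TT' i := by
  obtain ⟨ρ, hρ, hst⟩ := h
  refine ⟨ρ, hρ, fun j hj => ?_⟩
  obtain ⟨h1, h2, h3, h4⟩ := hst j hj
  rw [hTT i j hj (by omega), hTT (i + n) (n - 1 - j) (by omega) (by omega),
    hTT (i + n + n) (n - 1 - j) (by omega) (by omega), hTT (i + n + n + n) j hj (by omega)]
  exact ⟨h1, h2, h3, h4⟩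

/-- Computes, sorts and stores the directions of the customer in the scalar `22`. -/
def rowProg : Prog := .seq slopeLoop (.seq (sortProg 6) (forLoop 13 (nv 0) storeStep))

/-- The first `k` customers have been preprocessed. -/
structure RowsState {n : ℕ} (M : Market n) (k : ℕ) (s : State) : Prop where
  len : s.nat 2 0 = n
  offset : ∀ q, q < n + n + n + n → s.nat 15 q = q * n
  rows : ∀ i, i < k → M.RowStored (s.real 10) i

theorem runs_rowProg : ∃ c : ℕ, ∀ (n : ℕ) (M : Market n) (k : ℕ) (s : State), 1 ≤ n →
    Loaded M s → s.nat 22 0 = k → k < n → RowsState M k s →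
    Runs rowProg s (c * (n * (Nat.log 2 n + 1))) (RowsState M (k + 1)) := by
  obtain ⟨c, hc⟩ := runs_sortProg 6
  refine ⟨c + 600, fun n M k s hn hM hk hkn hS => ?_⟩
  refine ((runs_slopeLoop hM hk).seq fun s₁ ha₁ e₁ => (hc n s₁ hn ?_).seq fun s₂ ha₂ e₂ =>
    (runs_storeLoop (n := n) (i := k) ?_ ?_ hkn ?_).mono le_rfl
    fun s₃ ha₃ e₃ => show RowsState M (k + 1) s₃ from ?_).mono ?_ fun _ _ h => h
  · rw [ha₁.nat 2 rfl, hS.len]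
  · rw [ha₂.nat 0 rfl, ha₁.nat 0 rfl, hM.n_eq]
  · rw [ha₂.nat 22 rfl, ha₁.nat 22 rfl, hk]
  · rw [ha₂.nat 15 rfl, ha₁.nat 15 rfl]; exact hS.offset
  · refine ⟨?_, ?_, fun i hi => ?_⟩
    · rw [ha₃.nat 2 rfl, ha₂.nat 2 rfl, ha₁.nat 2 rfl, hS.len]
    · rw [ha₃.nat 15 rfl, ha₂.nat 15 rfl, ha₁.nat 15 rfl]; exact hS.offset
    · rcases Nat.lt_succ_iff_lt_or_eq.1 hi with hi | rfl
      · refine (hS.rows i hi).congr fun q j hj hq => ?_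
        rw [e₃.2 q j hj (by omega) (by omega) (by omega) (by omega), ha₂.real 10 rfl,
          ha₁.real 10 rfl]
      · have hval : ∀ j, j < n → s₂.real 6 (s₂.nat 10 j) = M.slopeParam i (s₂.nat 10 j) :=
          fun j hj => by rw [ha₂.real 6 rfl, e₁ _ (e₂.lt hj)]
        refine ⟨fun j => s₂.real 6 (s₂.nat 10 j), ⟨fun j hj => ?_, fun j j' hj hj' => ?_,
          fun j hj => ?_⟩, e₃.1⟩
        · rw [hval j hj]; exact M.slopeParam_pos _ _
        · rw [ha₂.real 6 rfl]; exact e₂.mono j j' hj hj'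
        · obtain ⟨x, hx, hxj⟩ := e₂.cover j hj
          exact ⟨x, hx, by rw [hval x hx, hxj]⟩
  · generalize Nat.log 2 n = l
    have : n ≤ n * (l + 1) := Nat.le_mul_of_pos_right _ (by omega)
    nlinarith

/-- The preprocessing algorithm. -/
def preProg : Prog :=
  .seq (.nset 2 (.lit 0) (nv 0))
  (.seq lowestProg (.seq offsetProg (forLoop 22 (nv 0) rowProg)))

/-- What the preprocessing provides and the queries preserve. -/
structure Prepared {n : ℕ} (M : Market n) (s : State) : Prop where
  loaded : Loaded M s
  offset : ∀ q, q < n + n + n + n → s.nat 15 q = q * n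
  rowCount : s.nat 21 0 = n + n + n + n
  lowest : ∀ i, i < n → s.real 11 0 ≤ M.initial.real 1 i - M.R / 2
  rows : ∀ i, i < n → M.RowStored (s.real 10) i

theorem loaded_initial {n : ℕ} (M : Market n) : Loaded M M.initial :=
  ⟨by simp [Market.initial], rfl, rfl, rfl, M.initial_R⟩

theorem runs_preProg : ∃ c : ℕ, ∀ (n : ℕ) (M : Market n), 1 ≤ n →
    Runs preProg M.initial (c * (n * (n * (Nat.log 2 n + 1)))) (Prepared M) := by
  obtain ⟨c, hc⟩ := runs_rowProg
  refine ⟨2 * c + 1000, fun n M hn => ?_⟩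
  have hM := loaded_initial M
  refine ((Runs.of_wp (s := M.initial) (p := .nset 2 (.lit 0) (nv 0)) (Q := fun s' => s' = _)
    rfl).seq fun s₁ ha₁ e₁ => (runs_lowestProg (n := n) ?_).seq fun s₂ ha₂ e₂ =>
    (runs_offsetProg (n := n) ?_).seq fun s₃ ha₃ e₃ =>
    (Runs.forLoop (B := n) (T := c * (n * (Nat.log 2 n + 1))) (RowsState M) (fun s' ha => ?_) ?_
      (fun k s₄ hk h22 ha hI => ?_)).mono le_rfl
      fun s₄ ha₄ e₄ => show Prepared M s₄ from ?_).mono ?_ fun _ _ h => h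
  · rw [ha₁.nat 0 rfl, hM.n_eq]
  · rw [ha₂.nat 0 rfl, ha₁.nat 0 rfl, hM.n_eq]
  · simp [ha.nat 0 rfl, ha₃.nat 0 rfl, ha₂.nat 0 rfl, ha₁.nat 0 rfl, hM.n_eq]
  · refine ⟨?_, fun q hq => ?_, fun i hi => by omega⟩
    · simp [ha₃.nat 2 rfl, ha₂.nat 2 rfl, e₁, hM.n_eq]
    · simp [e₃.2 q hq]
  · have hM₄ : Loaded M s₄ := (((hM.of_agree ha₁ rfl rfl rfl rfl rfl).of_agree ha₂
      rfl rfl rfl rfl rfl).of_agree ha₃ rfl rfl rfl rfl rfl).of_agree ha rfl rfl rfl rfl rfl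
    refine (hc n M k s₄ hn hM₄ h22 hk hI).mono le_rfl fun s₅ ha₅ h =>
      ⟨by rw [ha₅.nat 22 rfl, h22], ⟨?_, ?_, ?_⟩⟩
    · simpa using h.len
    · simpa using h.offset
    · simpa using h.rows
  · refine ⟨(((hM.of_agree ha₁ rfl rfl rfl rfl rfl).of_agree ha₂ rfl rfl rfl rfl rfl).of_agree ha₃
      rfl rfl rfl rfl rfl).of_agree ha₄ rfl rfl rfl rfl rfl, e₄.offset, ?_, fun i hi => ?_, e₄.rows⟩
    · rw [ha₄.nat 21 rfl, e₃.1]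
    · have := e₂ i hi
      rw [ha₁.real 1 rfl, ha₁.real 3 rfl, M.initial_R] at this
      rw [ha₄.real 11 rfl, ha₃.real 11 rfl]
      exact this
  · simp only [Prog.maxCost, NExpr.cost]
    generalize Nat.log 2 n = l
    have h1 : n ≤ n * (l + 1) := Nat.le_mul_of_pos_right _ (by omega)
    have h2 : 1 ≤ n * (n * (l + 1)) := by nlinarith
    have h3 : n * (l + 1) ≤ n * (n * (l + 1)) := Nat.le_mul_of_pos_left _ hn
    nlinarith [Nat.mul_le_mul_left c h3]

/-! ### Searching the matrix of critical heights -/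

theorem Conf.reachBelow_sum {c : Conf} {z : ℝ} (h : ∀ i, i < c.n → z ≤ c.Y i - c.g) :
    c.ReachBelow z (∑ i ∈ Finset.range c.n, c.W i) := by
  intro z' hz'
  refine ⟨1, one_pos, Finset.sum_le_sum fun i hi => ?_⟩
  have := h i (Finset.mem_range.1 hi)
  rw [if_pos]
  simp only [Conf.Sees]
  linarith

theorem Conf.Ok.reach_le_sum {c : Conf} (hc : c.Ok) {z v : ℝ} (h : c.Reach z v) :
    v ≤ ∑ i ∈ Finset.range c.n, c.W i := by
  obtain ⟨τ, -, hv⟩ := h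
  refine hv.trans (Finset.sum_le_sum fun i hi => ?_)
  split_ifs
  exacts [le_rfl, hc.W_nonneg i (Finset.mem_range.1 hi)]

/-- The captures in the two half-circles cross at the height `y` of the line with abscissa `a`. -/
def Market.Crossing {n : ℕ} (M : Market n) (a y : ℝ) : Prop :=
  Conf.Done (M.conf a 1) (M.conf a (-1)) y

theorem Market.Admissible.exists_crossing {n : ℕ} {M : Market n} (h : M.Admissible) (a : ℝ)
    {y₀ : ℝ} (hy₀ : ∀ i, i < n → y₀ ≤ M.initial.real 1 i - M.R / 2) :
    M.Crossing a y₀ ∨ ∃ y, M.Crossing a y ∧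
      ((M.conf a 1).Critical y ∨ (M.conf a (-1)).Critical (-y)) := by
  obtain ⟨y₁, hy₁⟩ := ((Finset.range n).image fun i => M.initial.real 1 i + M.R / 2).exists_le
  refine Conf.exists_done (h.conf_ok a 1) (h.conf_ok a (-1)) (y₁ := y₁)
    (fun z v hv => (h.conf_ok a 1).reach_le_sum hv)
    (fun z v hv => (h.conf_ok a (-1)).reach_le_sum hv)
    (Conf.reachBelow_sum fun i hi => ?_) (Conf.reachBelow_sum (c := M.conf a (-1)) fun i hi => ?_)
  · simpa [Market.conf] using hy₀ i hi
  · have := hy₁ _ (Finset.mem_image_of_mem _ (Finset.mem_range.2 hi))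
    simp only [Market.conf]
    linarith

/-- `y` is a median of the keys with respect to the weights `w`. -/
structure IsMedian (Q : ℕ) (key : ℕ → ℝ) (w : ℕ → ℕ) (y : ℝ) : Prop where
  le : ∑ q ∈ Finset.range Q, w q ≤ 2 * ∑ q ∈ Finset.range Q with key q ≤ y, w q
  ge : ∑ q ∈ Finset.range Q, w q ≤ 2 * ∑ q ∈ Finset.range Q with y ≤ key q, w q

theorem SortedIdx.sum_nat {key : ℕ → ℝ} {P : ℕ → ℕ} {n : ℕ} (h : SortedIdx key P n) (f : ℕ → ℕ) :
    ∑ m ∈ Finset.range n, f (P m) = ∑ i ∈ Finset.range n, f i := by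
  conv_rhs => rw [← h.image, Finset.sum_image h.injOn]

/-- In a sorted sequence the element at which the partial sums of the weights reach half the total
is a median. -/
theorem SortedIdx.isMedian {key : ℕ → ℝ} {P : ℕ → ℕ} {Q r : ℕ} (h : SortedIdx key P Q)
    (w : ℕ → ℕ) (hr : r < Q)
    (h₁ : 2 * ∑ m ∈ Finset.range r, w (P m) < ∑ q ∈ Finset.range Q, w q)
    (h₂ : ∑ q ∈ Finset.range Q, w q ≤ 2 * ∑ m ∈ Finset.range (r + 1), w (P m)) :
    IsMedian Q key w (key (P r)) := by
  constructor
  · refine h₂.trans (Nat.mul_le_mul_left 2 ?_)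
    rw [Finset.sum_filter, ← h.sum_nat, ← Finset.sum_filter]
    refine Finset.sum_le_sum_of_subset fun m hm => ?_
    simp only [Finset.mem_range, Finset.mem_filter] at hm ⊢
    exact ⟨by omega, h.mono m r (by omega) hr⟩
  · have h3 : ∑ q ∈ Finset.range Q with ¬ key (P r) ≤ key q, w q ≤
        ∑ m ∈ Finset.range r, w (P m) := by
      rw [Finset.sum_filter, ← h.sum_nat, ← Finset.sum_filter]
      refine Finset.sum_le_sum_of_subset fun m hm => ?_
      simp only [Finset.mem_range, Finset.mem_filter] at hm ⊢
      by_contra hlt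
      exact hm.2 (h.mono r m (by omega) hm.1)
    have h4 := Finset.sum_filter_add_sum_filter_not (Finset.range Q) (fun q => key (P r) ≤ key q) w
    omega

open Classical in
/-- If the rows with keys on one side of a median lose half their cells, then at most three quarters
of all cells remain. -/
theorem sum_prune_le {Q : ℕ} {w w' : ℕ → ℕ} (p : ℕ → Prop)
    (hm : ∑ q ∈ Finset.range Q, w q ≤ 2 * ∑ q ∈ Finset.range Q with p q, w q)
    (h₁ : ∀ q, q < Q → p q → 2 * w' q ≤ w q) (h₂ : ∀ q, q < Q → w' q ≤ w q) :
    4 * ∑ q ∈ Finset.range Q, w' q ≤ 3 * ∑ q ∈ Finset.range Q, w q := by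
  have h3 := Finset.sum_filter_add_sum_filter_not (Finset.range Q) p w
  have h4 := Finset.sum_filter_add_sum_filter_not (Finset.range Q) p w'
  have h5 : 2 * ∑ q ∈ Finset.range Q with p q, w' q ≤ ∑ q ∈ Finset.range Q with p q, w q := by
    rw [Finset.mul_sum]
    refine Finset.sum_le_sum fun q hq => ?_
    rw [Finset.mem_filter, Finset.mem_range] at hq
    exact h₁ q hq.1 hq.2
  have h6 : ∑ q ∈ Finset.range Q with ¬ p q, w' q ≤ ∑ q ∈ Finset.range Q with ¬ p q, w q := by
    refine Finset.sum_le_sum fun q hq => ?_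
    rw [Finset.mem_filter, Finset.mem_range] at hq
    exact h₂ q hq.1
  omega

/-- The program leaves the results of the preprocessing alone. -/
def Prog.keepsPrepared (p : Prog) : Bool :=
  p.keepsNat 0 && (p.keepsNat 15 && (p.keepsNat 21 && (p.keepsReal 0 && (p.keepsReal 1 &&
    (p.keepsReal 2 && (p.keepsReal 3 && (p.keepsReal 10 && p.keepsReal 11)))))))

theorem Prepared.of_agree {n : ℕ} {M : Market n} {s s' : State} {p : Prog} (h : Prepared M s)
    (ha : Agree p s s') (hp : p.keepsPrepared = true) : Prepared M s' := by
  simp only [Prog.keepsPrepared, Bool.and_eq_true] at hp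
  obtain ⟨h0, h15, h21, r0, r1, r2, r3, r10, r11⟩ := hp
  refine ⟨h.loaded.of_agree ha h0 r0 r1 r2 r3, ?_, ?_, ?_, ?_⟩
  · rw [ha.nat 15 h15]; exact h.offset
  · rw [ha.nat 21 h21]; exact h.rowCount
  · rw [ha.real 11 r11]; exact h.lowest
  · rw [ha.real 10 r10]; exact h.rows

/-- The memory describes the matrix of critical heights of the line with abscissa `a`. -/
structure Tabled {n : ℕ} (M : Market n) (a : ℝ) (s : State) : Prop where
  prepared : Prepared M s
  line : s.real 4 0 = a
  branches : M.Branches a (s.real 14) (s.real 15) (s.real 16) (s.real 17)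

/-- The program leaves the description of the matrix of critical heights alone. -/
def Prog.keepsTabled (p : Prog) : Bool :=
  p.keepsPrepared && (p.keepsReal 4 && (p.keepsReal 14 && (p.keepsReal 15 &&
    (p.keepsReal 16 && p.keepsReal 17))))

theorem Tabled.of_agree {n : ℕ} {M : Market n} {a : ℝ} {s s' : State} {p : Prog}
    (h : Tabled M a s) (ha : Agree p s s') (hp : p.keepsTabled = true) : Tabled M a s' := by
  simp only [Prog.keepsTabled, Bool.and_eq_true] at hp
  obtain ⟨h0, r4, r14, r15, r16, r17⟩ := hp
  refine ⟨h.prepared.of_agree ha h0, ?_, ?_⟩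
  · rw [ha.real 4 r4]; exact h.line
  · rw [ha.real 14 r14, ha.real 15 r15, ha.real 16 r16, ha.real 17 r17]; exact h.branches

/-- The critical heights described by the memory. -/
noncomputable def State.crit (s : State) (n q k : ℕ) : ℝ :=
  Market.critHeight n (s.real 10) (s.real 14) (s.real 15) (s.real 16) (s.real 17) q k

theorem State.crit_of_agree {s s' : State} {p : Prog} (ha : Agree p s s')
    (h10 : p.keepsReal 10 = true) (hp : (p.keepsReal 14 && (p.keepsReal 15 &&
      (p.keepsReal 16 && p.keepsReal 17))) = true) : s'.crit = s.crit := by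
  simp only [Bool.and_eq_true] at hp
  obtain ⟨r14, r15, r16, r17⟩ := hp
  funext n q k
  rw [State.crit, State.crit, ha.real 10 h10, ha.real 14 r14, ha.real 15 r15, ha.real 16 r16,
    ha.real 17 r17]

theorem Tabled.crit_mono {n : ℕ} {M : Market n} {a : ℝ} {s : State} (h : Tabled M a s)
    (hM : M.Admissible) {q k k' : ℕ} (hq : q < n + n + n + n) (hk : k ≤ k') (hk' : k' < n) :
    s.crit n q k ≤ s.crit n q k' :=
  Market.critHeight_mono hM.R_nonneg h.prepared.rows h.branches hq hk hk'

theorem Tabled.exists_crossing {n : ℕ} {M : Market n} {a : ℝ} {s : State} (h : Tabled M a s)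
    (hM : M.Admissible) : M.Crossing a (s.real 11 0) ∨
      ∃ q k, q < n + n + n + n ∧ k < n ∧ M.Crossing a (s.crit n q k) := by
  refine (hM.exists_crossing a h.prepared.lowest).imp id ?_
  rintro ⟨y, hy, hcr⟩
  obtain ⟨q, k, hq, hk, rfl⟩ := Market.critHeight_cover hM h.prepared.rows h.branches hcr
  exact ⟨q, k, hq, hk, hy⟩

/-- The number of cells of the matrix in which the search continues: those in the columns between
the bounds in the arrays `16` and `17`. -/
def cells (n : ℕ) (s : State) : ℕ :=
  ∑ q ∈ Finset.range (n + n + n + n), (s.nat 17 q - s.nat 16 q)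

/-- The captures cross at the current height or in one of the remaining cells. -/
structure Searching {n : ℕ} (M : Market n) (a : ℝ) (s : State) : Prop where
  hi_le : ∀ q, q < n + n + n + n → s.nat 17 q ≤ n
  crossing : M.Crossing a (s.real 22 0) ∨ ∃ q k, q < n + n + n + n ∧ s.nat 16 q ≤ k ∧
    k < s.nat 17 q ∧ M.Crossing a (s.crit n q k)

/-! ### One round of the search -/

/-- The address of the middle of the remaining columns of the row in the scalar `13`. -/
def midExpr : NExpr := .half (.add (.get 16 (nv 13)) (.get 17 (nv 13)))

/-- Stores the critical height in the middle of a row, and counts the cells of the row. -/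
def keyStep : Prog :=
  .seq (.rset 27 (.lit 0) (.get 10 (cellAddr (nv 13) midExpr)))
  (.seq (.nset 19 (.lit 0) (.add (nv 19) (.sub (.get 17 (nv 13)) (.get 16 (nv 13)))))
  (.ite (.rlt (.mul (.mul (.get 14 (nv 13)) (rv 27)) (rv 27)) (.get 15 (nv 13)))
    (.rset 6 (nv 13) (.mul (.get 17 (nv 13)) (.sub (.get 16 (nv 13))
      (.div (.add (.mul (.get 14 (nv 13)) (rv 27)) (.div (.get 15 (nv 13)) (rv 27))) (.lit 2)))))
    (.rset 6 (nv 13) (.mul (.get 17 (nv 13)) (.sub (.get 16 (nv 13))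
      (.sqrt (.mul (.get 14 (nv 13)) (.get 15 (nv 13)))))))))

theorem runs_keyLoop {n : ℕ} {M : Market n} {a : ℝ} {s : State} (hs : Tabled M a s)
    (h19 : s.nat 19 0 = 0) : Runs (forLoop 13 (nv 21) keyStep) s ((n + n + n + n + 1) * 200)
      fun s' => s'.nat 19 0 = cells n s ∧ ∀ q, q < n + n + n + n →
        s'.real 6 q = s.crit n q ((s.nat 16 q + s.nat 17 q) / 2) := by
  refine (Runs.forLoop (B := n + n + n + n) (T := Prog.maxCost _) (fun k s' =>
    s'.nat 19 0 = ∑ q ∈ Finset.range k, (s.nat 17 q - s.nat 16 q) ∧ ∀ q, q < k →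
        s'.real 6 q = s.crit n q ((s.nat 16 q + s.nat 17 q) / 2)) (fun s' ha => ?_) ?_
    (fun k s₁ hk h13 ha hI => Runs.of_wp ?_)).mono ?_ fun _ _ h => h
  · simp [ha.nat 21 rfl, hs.prepared.rowCount]
  · simp [h19]
  · obtain ⟨hI1, hI2⟩ := hI
    have e15 : s₁.nat 15 k = k * n := by rw [ha.nat 15 rfl, hs.prepared.offset k hk]
    have e16 : s₁.nat 16 = s.nat 16 := ha.nat 16 rfl
    have e17 : s₁.nat 17 = s.nat 17 := ha.nat 17 rfl
    have f10 : s₁.real 10 = s.real 10 := ha.real 10 rfl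
    have f14 : s₁.real 14 = s.real 14 := ha.real 14 rfl
    have f15 : s₁.real 15 = s.real 15 := ha.real 15 rfl
    have f16 : s₁.real 16 = s.real 16 := ha.real 16 rfl
    have f17 : s₁.real 17 = s.real 17 := ha.real 17 rfl
    have hupd : ∀ v : ℝ, v = s.crit n k ((s.nat 16 k + s.nat 17 k) / 2) → ∀ q, q < k + 1 →
        Function.update (s₁.real 6) k v q = s.crit n q ((s.nat 16 q + s.nat 17 q) / 2) := by
      intro v hv q hq
      rcases Nat.lt_succ_iff_lt_or_eq.1 hq with hq | rfl
      · rw [Function.update_of_ne (by omega)]; exact hI2 q hq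
      · rw [Function.update_self, hv]
    simp only [keyStep, cellAddr, midExpr, Prog.wp, NExpr.eval, RExpr.eval, Test.Holds,
      State.setReal_nat, State.setReal_real, State.setNat_nat, State.setNat_real, h13, e15, e16,
      e17, f10, f14, f15, f16, f17, hI1, Finset.sum_range_succ]
    simp only [if_true, if_false, Function.update_self, Nat.reduceEqDiff, Int.cast_ofNat, h13]
    constructor
    · intro h
      exact ⟨trivial, trivial, hupd _ (by rw [State.crit, Market.critHeight, peakFn, if_pos h])⟩
    · intro h
      exact ⟨trivial, trivial, hupd _ (by rw [State.crit, Market.critHeight, peakFn, if_neg h])⟩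
  · simp [keyStep, cellAddr, midExpr, Prog.maxCost, NExpr.cost, RExpr.cost, Test.cost]

/-- A step of the scan of the sorted keys up to the weighted median. -/
def scanStep : Prog :=
  .ite (.nlt (.add (nv 20) (nv 20)) (nv 19))
    (.seq (.nset 20 (.lit 0) (.add (nv 20)
      (.sub (.get 17 (.get 10 (nv 13))) (.get 16 (.get 10 (nv 13))))))
    (.rset 22 (.lit 0) (.get 6 (.get 10 (nv 13))))) .skip

theorem runs_scanLoop {Q : ℕ} {s : State} (h21 : s.nat 21 0 = Q) (h20 : s.nat 20 0 = 0)
    (hsort : SortedIdx (s.real 6) (s.nat 10) Q)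
    (h19 : s.nat 19 0 = ∑ q ∈ Finset.range Q, (s.nat 17 q - s.nat 16 q)) (hpos : 0 < s.nat 19 0) :
    Runs (forLoop 13 (nv 21) scanStep) s ((Q + 1) * 100) fun s' =>
      IsMedian Q (s.real 6) (fun q => s.nat 17 q - s.nat 16 q) (s'.real 22 0) := by
  obtain ⟨w, hw⟩ : ∃ w : ℕ → ℕ, w = fun q => s.nat 17 q - s.nat 16 q := ⟨_, rfl⟩
  have hw' : ∀ q, s.nat 17 q - s.nat 16 q = w q := fun q => by rw [hw]
  simp only [hw'] at h19 ⊢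
  refine (Runs.forLoop (B := Q) (T := Prog.maxCost _) (fun k s' =>
    (2 * ∑ m ∈ Finset.range k, w (s.nat 10 m) < s.nat 19 0 ∧
      s'.nat 20 0 = ∑ m ∈ Finset.range k, w (s.nat 10 m)) ∨
    (s.nat 19 0 ≤ 2 * s'.nat 20 0 ∧ IsMedian Q (s.real 6) w (s'.real 22 0)))
    (fun s' ha => ?_) ?_ (fun k s₁ hk h13 ha hI => Runs.of_wp ?_)).mono ?_ fun s' ha h => ?_
  · simp [ha.nat 21 rfl, h21]
  · left; simpa [h20] using hpos
  · have e10 : s₁.nat 10 = s.nat 10 := ha.nat 10 rfl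
    have e16 : s₁.nat 16 = s.nat 16 := ha.nat 16 rfl
    have e17 : s₁.nat 17 = s.nat 17 := ha.nat 17 rfl
    have e19 : s₁.nat 19 = s.nat 19 := ha.nat 19 rfl
    have f6 : s₁.real 6 = s.real 6 := ha.real 6 rfl
    simp only [scanStep, Prog.wp, NExpr.eval, RExpr.eval, Test.Holds, State.setReal_nat,
      State.setReal_real, State.setNat_nat, State.setNat_real, e10, e16, e17, e19, f6, hw']
    simp only [if_true, if_false, Function.update_self, Nat.reduceEqDiff, h13]
    refine ⟨fun hlt => ⟨trivial, ?_⟩, fun hlt => ⟨trivial, Or.inr ?_⟩⟩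
    · rcases hI with ⟨h1, h2⟩ | ⟨h1, -⟩
      · rw [h2, ← Finset.sum_range_succ]
        by_cases h3 : 2 * ∑ m ∈ Finset.range (k + 1), w (s.nat 10 m) < s.nat 19 0
        · exact Or.inl ⟨h3, rfl⟩
        · refine Or.inr ⟨not_lt.1 h3, hsort.isMedian w hk ?_ ?_⟩
          · rwa [← h19]
          · rw [← h19]; exact not_lt.1 h3
      · omega
    · rcases hI with ⟨h1, h2⟩ | h
      · omega
      · exact h
  · simp [scanStep, Prog.maxCost, NExpr.cost, RExpr.cost, Test.cost]
  · rcases h with ⟨h, -⟩ | h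
    · rw [hsort.sum_nat, ← h19] at h
      omega
    · exact h.2

/-- Moves the current height to a weighted median of the middle cells of the rows. -/
def selectProg : Prog :=
  .seq (.nset 2 (.lit 0) (nv 21))
  (.seq (.nset 19 (.lit 0) (.lit 0))
  (.seq (forLoop 13 (nv 21) keyStep)
  (.seq (sortProg 6)
  (.seq (.nset 20 (.lit 0) (.lit 0)) (forLoop 13 (nv 21) scanStep)))))

/-- The keys of the rows are the heights in their middle cells, and the current height is a median
of these. -/
structure Selected (n : ℕ) (s : State) : Prop where
  key : ∀ q, q < n + n + n + n → s.real 6 q = s.crit n q ((s.nat 16 q + s.nat 17 q) / 2)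
  median : IsMedian (n + n + n + n) (s.real 6) (fun q => s.nat 17 q - s.nat 16 q) (s.real 22 0)

theorem Selected.of_agree {n : ℕ} {s s' : State} {p : Prog} (h : Selected n s) (ha : Agree p s s')
    (h16 : p.keepsNat 16 = true) (h17 : p.keepsNat 17 = true) (h6 : p.keepsReal 6 = true)
    (h22 : p.keepsReal 22 = true) (h10 : p.keepsReal 10 = true)
    (hp : (p.keepsReal 14 && (p.keepsReal 15 && (p.keepsReal 16 && p.keepsReal 17))) = true) :
    Selected n s' := by
  constructor
  · rw [State.crit_of_agree ha h10 hp, ha.nat 16 h16, ha.nat 17 h17, ha.real 6 h6]; exact h.key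
  · rw [ha.nat 16 h16, ha.nat 17 h17, ha.real 6 h6, ha.real 22 h22]; exact h.median

theorem log_four_mul_le (n : ℕ) (hn : 1 ≤ n) :
    Nat.log 2 (n + n + n + n) + 1 ≤ 3 * (Nat.log 2 n + 1) := by
  have : Nat.log 2 (n + n + n + n) < Nat.log 2 n + 3 := by
    refine Nat.log_lt_of_lt_pow (by omega) ?_
    have := Nat.lt_pow_succ_log_self (b := 2) (by norm_num) n
    have e : 2 ^ (Nat.log 2 n + 3) = 4 * 2 ^ (Nat.log 2 n + 1) := by ring
    rw [e]; omega
  omega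

theorem runs_selectProg : ∃ c : ℕ, ∀ (n : ℕ) (M : Market n) (a : ℝ) (s : State), 1 ≤ n →
    Tabled M a s → 0 < cells n s →
    Runs selectProg s (c * (n * (Nat.log 2 n + 1))) (Selected n) := by
  obtain ⟨c, hc⟩ := runs_sortProg 6
  refine ⟨12 * c + 2000, fun n M a s hn hs hpos => ?_⟩
  refine ((Runs.of_wp (s := s) (p := .nset 2 (.lit 0) (nv 21)) (Q := fun s' => s' = _) rfl).seq
    fun s₁ ha₁ e₁ => (Runs.of_wp (p := .nset 19 (.lit 0) (.lit 0)) (Q := fun s' => s' = _) rfl).seq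
    fun s₂ ha₂ e₂ => (runs_keyLoop (M := M) (a := a) ?_ ?_).seq
    fun s₃ ha₃ e₃ => (hc (n + n + n + n) s₃ (by omega) ?_).seq
    fun s₄ ha₄ e₄ => (Runs.of_wp (p := .nset 20 (.lit 0) (.lit 0)) (Q := fun s' => s' = _) rfl).seq
    fun s₅ ha₅ e₅ => (runs_scanLoop (Q := n + n + n + n) ?_ ?_ ?_ ?_ ?_).mono le_rfl
    fun s₆ ha₆ e₆ => show Selected n s₆ from ?_).mono ?_ fun _ _ h => h
  · exact (hs.of_agree ha₁ rfl).of_agree ha₂ rfl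
  · simp [e₂]
  · rw [ha₃.nat 2 rfl, ha₂.nat 2 rfl, e₁]
    simp [hs.prepared.rowCount]
  · rw [ha₅.nat 21 rfl, ha₄.nat 21 rfl, ha₃.nat 21 rfl, ha₂.nat 21 rfl, ha₁.nat 21 rfl,
      hs.prepared.rowCount]
  · simp [e₅]
  · rw [ha₅.nat 10 rfl, ha₅.real 6 rfl, ha₄.real 6 rfl]; exact e₄
  · rw [ha₅.nat 19 rfl, ha₄.nat 19 rfl, ha₅.nat 16 rfl, ha₅.nat 17 rfl, ha₄.nat 16 rfl,
      ha₄.nat 17 rfl, ha₃.nat 16 rfl, ha₃.nat 17 rfl]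
    exact e₃.1
  · rw [ha₅.nat 19 rfl, ha₄.nat 19 rfl, e₃.1, cells, ha₂.nat 16 rfl, ha₂.nat 17 rfl,
      ha₁.nat 16 rfl, ha₁.nat 17 rfl]
    exact hpos
  · have e6 : s₆.real 6 = s₃.real 6 := by rw [ha₆.real 6 rfl, ha₅.real 6 rfl, ha₄.real 6 rfl]
    have e16 : s₆.nat 16 = s₂.nat 16 := by
      rw [ha₆.nat 16 rfl, ha₅.nat 16 rfl, ha₄.nat 16 rfl, ha₃.nat 16 rfl]
    have e17 : s₆.nat 17 = s₂.nat 17 := by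
      rw [ha₆.nat 17 rfl, ha₅.nat 17 rfl, ha₄.nat 17 rfl, ha₃.nat 17 rfl]
    have ecr : s₆.crit = s₂.crit := by
      rw [State.crit_of_agree ha₆ rfl rfl, State.crit_of_agree ha₅ rfl rfl,
        State.crit_of_agree ha₄ rfl rfl, State.crit_of_agree ha₃ rfl rfl]
    constructor
    · rw [e6, e16, e17, ecr]; exact e₃.2
    · rw [ha₆.real 6 rfl, ha₆.nat 16 rfl, ha₆.nat 17 rfl]; exact e₆
  · have h1 : c * ((n + n + n + n) * (Nat.log 2 (n + n + n + n) + 1)) ≤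
        12 * c * (n * (Nat.log 2 n + 1)) := by
      have := Nat.mul_le_mul_left (c * (n + n + n + n)) (log_four_mul_le n hn)
      linarith
    have h2 : n ≤ n * (Nat.log 2 n + 1) := Nat.le_mul_of_pos_right _ (by omega)
    simp only [Prog.maxCost, NExpr.cost]
    linarith

/-- Discards the half of the row in the scalar `13` in which the captures do not cross, if the key
of the row is on the same side of the current height. -/
def pruneStep : Prog :=
  .ite (.nlt (.get 16 (nv 13)) (.get 17 (nv 13)))
    (.ite (.rlt (rv 33) (rv 30))
      (.ite (.rlt (rv 22) (.get 6 (nv 13))) .skip (.nset 16 (nv 13) (.add midExpr (.lit 1))))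
      (.ite (.rlt (.get 6 (nv 13)) (rv 22)) .skip (.nset 17 (nv 13) midExpr))) .skip

theorem runs_pruneUp {Q : ℕ} {s : State} (h21 : s.nat 21 0 = Q) (hup : s.real 33 0 < s.real 30 0) :
    Runs (forLoop 13 (nv 21) pruneStep) s ((Q + 1) * 100) fun s' => ∀ q, q < Q →
      s'.nat 17 q = s.nat 17 q ∧
      ((s.nat 16 q < s.nat 17 q ∧ s.real 6 q ≤ s.real 22 0 ∧
        s'.nat 16 q = (s.nat 16 q + s.nat 17 q) / 2 + 1) ∨
      (¬ (s.nat 16 q < s.nat 17 q ∧ s.real 6 q ≤ s.real 22 0) ∧ s'.nat 16 q = s.nat 16 q)) := by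
  refine (Runs.forLoop (B := Q) (T := Prog.maxCost _) (fun k s' => (∀ q, q < k →
      s'.nat 17 q = s.nat 17 q ∧
      ((s.nat 16 q < s.nat 17 q ∧ s.real 6 q ≤ s.real 22 0 ∧
        s'.nat 16 q = (s.nat 16 q + s.nat 17 q) / 2 + 1) ∨
      (¬ (s.nat 16 q < s.nat 17 q ∧ s.real 6 q ≤ s.real 22 0) ∧ s'.nat 16 q = s.nat 16 q))) ∧
      ∀ q, k ≤ q → s'.nat 16 q = s.nat 16 q ∧ s'.nat 17 q = s.nat 17 q)
    (fun s' ha => ?_) ?_ (fun k s₁ hk h13 ha hI => Runs.of_wp ?_)).mono ?_ fun s' ha h => h.1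
  · simp [ha.nat 21 rfl, h21]
  · simp
  · obtain ⟨hI1, hI2⟩ := hI
    have e33 : s₁.real 33 = s.real 33 := ha.real 33 rfl
    have e30 : s₁.real 30 = s.real 30 := ha.real 30 rfl
    have e22 : s₁.real 22 = s.real 22 := ha.real 22 rfl
    have e6 : s₁.real 6 = s.real 6 := ha.real 6 rfl
    obtain ⟨e16, e17⟩ := hI2 k le_rfl
    have stay : (¬ (s.nat 16 k < s.nat 17 k ∧ s.real 6 k ≤ s.real 22 0)) → (∀ q, q < k + 1 →
        s₁.nat 17 q = s.nat 17 q ∧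
        ((s.nat 16 q < s.nat 17 q ∧ s.real 6 q ≤ s.real 22 0 ∧
          s₁.nat 16 q = (s.nat 16 q + s.nat 17 q) / 2 + 1) ∨
        (¬ (s.nat 16 q < s.nat 17 q ∧ s.real 6 q ≤ s.real 22 0) ∧ s₁.nat 16 q = s.nat 16 q))) ∧
        ∀ q, k + 1 ≤ q → s₁.nat 16 q = s.nat 16 q ∧ s₁.nat 17 q = s.nat 17 q := by
      refine fun hno => ⟨fun q hq => ?_, fun q hq => hI2 q (by omega)⟩
      rcases Nat.lt_succ_iff_lt_or_eq.1 hq with hq | rfl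
      · exact hI1 q hq
      · exact ⟨e17, Or.inr ⟨hno, e16⟩⟩
    simp only [pruneStep, midExpr, Prog.wp, NExpr.eval, RExpr.eval, Test.Holds, State.setNat_nat,
      h13, e33, e30, e22, e6, e16, e17, hup, true_imp_iff, not_true,
      false_imp_iff, and_true, if_true, if_false, Nat.reduceEqDiff, true_and]
    refine ⟨fun hlt => ⟨fun h => stay fun hh => absurd hh.2 (not_le.2 h), fun h =>
      ⟨fun q hq => ?_, fun q hq => ?_⟩⟩, fun hlt => stay fun h => hlt h.1⟩
    · rcases Nat.lt_succ_iff_lt_or_eq.1 hq with hq | rfl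
      · rw [Function.update_of_ne (by omega)]; exact hI1 q hq
      · rw [Function.update_self]
        exact ⟨e17, Or.inl ⟨hlt, not_lt.1 h, rfl⟩⟩
    · rw [Function.update_of_ne (by omega)]; exact hI2 q (by omega)
  · simp [pruneStep, midExpr, Prog.maxCost, NExpr.cost, RExpr.cost, Test.cost]

theorem runs_pruneDown {Q : ℕ} {s : State} (h21 : s.nat 21 0 = Q)
    (hup : ¬ s.real 33 0 < s.real 30 0) :
    Runs (forLoop 13 (nv 21) pruneStep) s ((Q + 1) * 100) fun s' => ∀ q, q < Q →
      s'.nat 16 q = s.nat 16 q ∧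
      ((s.nat 16 q < s.nat 17 q ∧ s.real 22 0 ≤ s.real 6 q ∧
        s'.nat 17 q = (s.nat 16 q + s.nat 17 q) / 2) ∨
      (¬ (s.nat 16 q < s.nat 17 q ∧ s.real 22 0 ≤ s.real 6 q) ∧ s'.nat 17 q = s.nat 17 q)) := by
  refine (Runs.forLoop (B := Q) (T := Prog.maxCost _) (fun k s' => (∀ q, q < k →
      s'.nat 16 q = s.nat 16 q ∧
      ((s.nat 16 q < s.nat 17 q ∧ s.real 22 0 ≤ s.real 6 q ∧
        s'.nat 17 q = (s.nat 16 q + s.nat 17 q) / 2) ∨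
      (¬ (s.nat 16 q < s.nat 17 q ∧ s.real 22 0 ≤ s.real 6 q) ∧ s'.nat 17 q = s.nat 17 q))) ∧
      ∀ q, k ≤ q → s'.nat 16 q = s.nat 16 q ∧ s'.nat 17 q = s.nat 17 q)
    (fun s' ha => ?_) ?_ (fun k s₁ hk h13 ha hI => Runs.of_wp ?_)).mono ?_ fun s' ha h => h.1
  · simp [ha.nat 21 rfl, h21]
  · simp
  · obtain ⟨hI1, hI2⟩ := hI
    have e33 : s₁.real 33 = s.real 33 := ha.real 33 rfl
    have e30 : s₁.real 30 = s.real 30 := ha.real 30 rfl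
    have e22 : s₁.real 22 = s.real 22 := ha.real 22 rfl
    have e6 : s₁.real 6 = s.real 6 := ha.real 6 rfl
    obtain ⟨e16, e17⟩ := hI2 k le_rfl
    have stay : (¬ (s.nat 16 k < s.nat 17 k ∧ s.real 22 0 ≤ s.real 6 k)) → (∀ q, q < k + 1 →
        s₁.nat 16 q = s.nat 16 q ∧
        ((s.nat 16 q < s.nat 17 q ∧ s.real 22 0 ≤ s.real 6 q ∧
          s₁.nat 17 q = (s.nat 16 q + s.nat 17 q) / 2) ∨
        (¬ (s.nat 16 q < s.nat 17 q ∧ s.real 22 0 ≤ s.real 6 q) ∧ s₁.nat 17 q = s.nat 17 q))) ∧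
        ∀ q, k + 1 ≤ q → s₁.nat 16 q = s.nat 16 q ∧ s₁.nat 17 q = s.nat 17 q := by
      refine fun hno => ⟨fun q hq => ?_, fun q hq => hI2 q (by omega)⟩
      rcases Nat.lt_succ_iff_lt_or_eq.1 hq with hq | rfl
      · exact hI1 q hq
      · exact ⟨e16, Or.inr ⟨hno, e17⟩⟩
    simp only [pruneStep, midExpr, Prog.wp, NExpr.eval, RExpr.eval, Test.Holds, State.setNat_nat,
      h13, e33, e30, e22, e6, e16, e17, hup, true_imp_iff, not_false_iff,
      false_imp_iff, if_true, if_false, Nat.reduceEqDiff, true_and]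
    refine ⟨fun hlt => ⟨fun h => stay fun hh => absurd hh.2 (not_le.2 h), fun h =>
      ⟨fun q hq => ?_, fun q hq => ?_⟩⟩, fun hlt => stay fun h => hlt h.1⟩
    · rcases Nat.lt_succ_iff_lt_or_eq.1 hq with hq | rfl
      · rw [Function.update_of_ne (by omega)]; exact hI1 q hq
      · rw [Function.update_self]
        exact ⟨e16, Or.inl ⟨hlt, not_lt.1 h, rfl⟩⟩
    · rw [Function.update_of_ne (by omega)]; exact hI2 q (by omega)
  · simp [pruneStep, midExpr, Prog.maxCost, NExpr.cost, RExpr.cost, Test.cost]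

theorem Evaluated.not_crossing_up {n : ℕ} {M : Market n} {a y : ℝ} {s : State}
    (h : Evaluated M s) (hM : M.Admissible) (ha : s.real 4 0 = a)
    (hlt : s.real 33 0 < s.real 30 0) (hy : M.Crossing a y) : s.real 22 0 < y := by
  subst ha
  exact Conf.Done.gt_of_lt (hM.conf_ok _ _) h.up h.downBelow hlt hy

theorem Evaluated.not_crossing_down {n : ℕ} {M : Market n} {a y : ℝ} {s : State}
    (h : Evaluated M s) (hM : M.Admissible) (ha : s.real 4 0 = a)
    (hlt : s.real 31 0 < s.real 32 0) (hy : M.Crossing a y) : y < s.real 22 0 := by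
  subst ha
  exact Conf.Done.lt_of_lt (hM.conf_ok _ _) h.down h.upBelow hlt hy

theorem Evaluated.crossing {n : ℕ} {M : Market n} {a : ℝ} {s : State}
    (h : Evaluated M s) (hM : M.Admissible) (ha : s.real 4 0 = a)
    (h₁ : ¬ s.real 33 0 < s.real 30 0) (h₂ : ¬ s.real 31 0 < s.real 32 0) :
    M.Crossing a (s.real 22 0) := by
  subst ha
  constructor
  · intro v hv
    exact (hM.conf_ok _ _).reachBelow_anti h.downBelow.reachBelow
      ((h.up.le v hv).trans (not_lt.1 h₁))
  · intro v hv
    exact (hM.conf_ok _ _).reachBelow_anti h.upBelow.reachBelow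
      ((h.down.le v hv).trans (not_lt.1 h₂))

/-- Since the rows are sorted, the discarded cells are on the wrong side of the current height. -/
theorem runs_pruneProg {n : ℕ} {M : Market n} {a : ℝ} {s : State} (hM : M.Admissible)
    (hs : Tabled M a s) (hsel : Selected n s) (hev : Evaluated M s) (hS : Searching M a s) :
    Runs (forLoop 13 (nv 21) pruneStep) s ((n + n + n + n + 1) * 100) fun s' =>
      Searching M a s' ∧ 4 * cells n s' ≤ 3 * cells n s := by
  by_cases hup : s.real 33 0 < s.real 30 0
  · refine (runs_pruneUp hs.prepared.rowCount hup).mono le_rfl fun s' ha h => ⟨⟨?_, ?_⟩, ?_⟩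
    · intro q hq; rw [(h q hq).1]; exact hS.hi_le q hq
    · right
      rcases hS.crossing with hc | ⟨q, k, hq, hk, hk', hc⟩
      · exact absurd (hev.not_crossing_up hM hs.line hup hc) (lt_irrefl _)
      · have hlt := hev.not_crossing_up hM hs.line hup hc
        refine ⟨q, k, hq, ?_, by rwa [(h q hq).1], by rwa [State.crit_of_agree ha rfl rfl]⟩
        rcases (h q hq).2 with ⟨h1, h2, h3⟩ | ⟨-, h3⟩
        · rw [h3]
          by_contra hle
          have := hs.crit_mono hM hq (k := k) (k' := (s.nat 16 q + s.nat 17 q) / 2) (by omega)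
            (by have := hS.hi_le q hq; omega)
          rw [← hsel.key q hq] at this
          linarith
        · rwa [h3]
    · refine sum_prune_le (fun q => s.real 6 q ≤ s.real 22 0) hsel.median.le
        (fun q hq hle => ?_) fun q hq => ?_
      · obtain ⟨h1, ⟨h2, h3, h4⟩ | ⟨h2, h4⟩⟩ := h q hq
        · omega
        · have : ¬ s.nat 16 q < s.nat 17 q := fun hh => h2 ⟨hh, hle⟩
          omega
      · obtain ⟨h1, ⟨h2, h3, h4⟩ | ⟨h2, h4⟩⟩ := h q hq <;> omega
  · refine (runs_pruneDown hs.prepared.rowCount hup).mono le_rfl fun s' ha h => ⟨⟨?_, ?_⟩, ?_⟩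
    · intro q hq
      have := hS.hi_le q hq
      rcases (h q hq).2 with ⟨h1, h2, h3⟩ | ⟨-, h3⟩ <;> omega
    · rw [ha.real 22 rfl, State.crit_of_agree ha rfl rfl]
      by_cases hdn : s.real 31 0 < s.real 32 0
      · right
        rcases hS.crossing with hc | ⟨q, k, hq, hk, hk', hc⟩
        · exact absurd (hev.not_crossing_down hM hs.line hdn hc) (lt_irrefl _)
        · have hlt := hev.not_crossing_down hM hs.line hdn hc
          refine ⟨q, k, hq, by rwa [(h q hq).1], ?_, hc⟩
          rcases (h q hq).2 with ⟨h1, h2, h3⟩ | ⟨-, h3⟩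
          · rw [h3]
            by_contra hle
            have := hs.crit_mono hM hq (k := (s.nat 16 q + s.nat 17 q) / 2) (k' := k) (by omega)
              (by have := hS.hi_le q hq; omega)
            rw [← hsel.key q hq] at this
            linarith
          · rwa [h3]
      · exact Or.inl (hev.crossing hM hs.line hup hdn)
    · refine sum_prune_le (fun q => s.real 22 0 ≤ s.real 6 q) hsel.median.ge
        (fun q hq hle => ?_) fun q hq => ?_
      · obtain ⟨h1, ⟨h2, h3, h4⟩ | ⟨h2, h4⟩⟩ := h q hq
        · omega
        · have : ¬ s.nat 16 q < s.nat 17 q := fun hh => h2 ⟨hh, hle⟩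
          omega
      · obtain ⟨h1, ⟨h2, h3, h4⟩ | ⟨h2, h4⟩⟩ := h q hq <;> omega

/-! ### The search for the crossing -/

/-- The captures do not cross at the current height. -/
def openTest : Test :=
  .not (.and (.not (.rlt (rv 33) (rv 30))) (.not (.rlt (rv 31) (rv 32))))

/-- A round of the search. -/
def roundProg : Prog :=
  .seq selectProg (.seq evalProg (forLoop 13 (nv 21) pruneStep))

/-- As long as the captures do not cross at the current height, there are cells left. -/
theorem Searching.cells_pos {n : ℕ} {M : Market n} {a : ℝ} {s : State} (hM : M.Admissible)
    (hs : Tabled M a s) (hev : Evaluated M s) (hS : Searching M a s) (hb : openTest.Holds s) :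
    0 < cells n s ∧ ∃ q k, q < n + n + n + n ∧ s.nat 16 q ≤ k ∧
    k < s.nat 17 q ∧ M.Crossing a (s.crit n q k) := by
  rcases hS.crossing with hc | ⟨q, k, hq, hk, hk', hc⟩
  · exfalso
    refine hb ⟨fun h => ?_, fun h => ?_⟩
    · exact lt_irrefl _ (hev.not_crossing_up hM hs.line h hc)
    · exact lt_irrefl _ (hev.not_crossing_down hM hs.line h hc)
  · refine ⟨?_, q, k, hq, hk, hk', hc⟩
    refine Finset.sum_pos' (fun _ _ => Nat.zero_le _) ⟨q, Finset.mem_range.2 hq, ?_⟩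
    omega

theorem runs_roundProg : ∃ c : ℕ, ∀ (n : ℕ) (M : Market n) (a : ℝ) (s : State), 1 ≤ n →
    M.Admissible → Tabled M a s → Evaluated M s → Searching M a s → openTest.Holds s →
    Runs roundProg s (c * (n * (Nat.log 2 n + 1))) fun s' =>
      Evaluated M s' ∧ Searching M a s' ∧ 4 * cells n s' ≤ 3 * cells n s := by
  obtain ⟨c₁, h₁⟩ := runs_selectProg
  obtain ⟨c₂, h₂⟩ := runs_evalProg
  refine ⟨c₁ + c₂ + 500, fun n M a s hn hM hs hev hS hb => ?_⟩
  obtain ⟨hpos, q, k, hq, hk, hk', hc⟩ := hS.cells_pos hM hs hev hb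
  have key : Runs roundProg s (c₁ * (n * (Nat.log 2 n + 1)) +
      (c₂ * (n * (Nat.log 2 n + 1)) + (n + n + n + n + 1) * 100)) fun s' =>
      Evaluated M s' ∧ Searching M a s' ∧ 4 * cells n s' ≤ 3 * cells n s := by
    refine (h₁ n M a s hn hs hpos).seq fun s₁ ha₁ e₁ => ?_
    have hs₁ := hs.of_agree ha₁ rfl
    refine (h₂ n M s₁ hn hM hs₁.prepared.loaded).seq fun s₂ ha₂ e₂ => ?_
    have hs₂ := hs₁.of_agree ha₂ rfl
    refine (runs_pruneProg hM hs₂ (e₁.of_agree ha₂ rfl rfl rfl rfl rfl rfl) e₂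
      ⟨?_, Or.inr ⟨q, k, hq, ?_, ?_, ?_⟩⟩).mono le_rfl fun s₃ ha₃ e₃ => ⟨⟨?_, ?_, ?_, ?_⟩, e₃.1, ?_⟩
    · rw [ha₂.nat 17 rfl, ha₁.nat 17 rfl]; exact hS.hi_le
    · rwa [ha₂.nat 16 rfl, ha₁.nat 16 rfl]
    · rwa [ha₂.nat 17 rfl, ha₁.nat 17 rfl]
    · rwa [State.crit_of_agree ha₂ rfl rfl, State.crit_of_agree ha₁ rfl rfl]
    · rw [ha₃.real 4 rfl, ha₃.real 22 rfl, ha₃.real 30 rfl, ha₃.real 40 rfl]; exact e₂.up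
    · rw [ha₃.real 4 rfl, ha₃.real 22 rfl, ha₃.real 31 rfl, ha₃.real 41 rfl]; exact e₂.upBelow
    · rw [ha₃.real 4 rfl, ha₃.real 22 rfl, ha₃.real 32 rfl, ha₃.real 42 rfl]; exact e₂.down
    · rw [ha₃.real 4 rfl, ha₃.real 22 rfl, ha₃.real 33 rfl, ha₃.real 43 rfl]; exact e₂.downBelow
    · have := e₃.2
      rwa [cells, cells, ha₂.nat 16 rfl, ha₂.nat 17 rfl, ha₁.nat 16 rfl, ha₁.nat 17 rfl] at this
  refine key.mono ?_ fun _ _ h => h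
  have h2 : n ≤ n * (Nat.log 2 n + 1) := Nat.le_mul_of_pos_right _ (by omega)
  linarith

/-- Fills the parameters of the four rows of the customer in the scalar `13`. -/
def branchStep : Prog :=
  .seq (.rset 27 (.lit 0) (.add (.div (rv 3) (.lit 2)) (.sub (.get 0 (nv 13)) (rv 4))))
  (.seq (.rset 28 (.lit 0) (.sub (.div (rv 3) (.lit 2)) (.sub (.get 0 (nv 13)) (rv 4))))
  (.seq (.seq (.rset 14 (nv 13) (rv 27)) (.seq (.rset 14 (.add (nv 13) (nv 0)) (rv 28))
    (.seq (.rset 14 (.add (.add (nv 13) (nv 0)) (nv 0)) (rv 28))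
      (.rset 14 (.add (.add (.add (nv 13) (nv 0)) (nv 0)) (nv 0)) (rv 27)))))
  (.seq (.seq (.rset 15 (nv 13) (rv 28)) (.seq (.rset 15 (.add (nv 13) (nv 0)) (rv 27))
    (.seq (.rset 15 (.add (.add (nv 13) (nv 0)) (nv 0)) (rv 27))
      (.rset 15 (.add (.add (.add (nv 13) (nv 0)) (nv 0)) (nv 0)) (rv 28)))))
  (.seq (.seq (.rset 16 (nv 13) (.get 1 (nv 13)))
    (.seq (.rset 16 (.add (nv 13) (nv 0)) (.get 1 (nv 13)))
    (.seq (.rset 16 (.add (.add (nv 13) (nv 0)) (nv 0)) (.sub (.lit 0) (.get 1 (nv 13))))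
      (.rset 16 (.add (.add (.add (nv 13) (nv 0)) (nv 0)) (nv 0))
        (.sub (.lit 0) (.get 1 (nv 13)))))))
  (.seq (.rset 17 (nv 13) (.lit 1)) (.seq (.rset 17 (.add (nv 13) (nv 0)) (.lit 1))
    (.seq (.rset 17 (.add (.add (nv 13) (nv 0)) (nv 0)) (.lit (-1)))
      (.rset 17 (.add (.add (.add (nv 13) (nv 0)) (nv 0)) (nv 0)) (.lit (-1))))))))))

theorem update_four {n k j : ℕ} (f : ℕ → ℝ) (u v : ℝ) (w w' : ℝ) (hk : k < n) (hj : j < n) :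
    let g := Function.update (Function.update (Function.update (Function.update f k u) (k + n) v)
      (k + n + n) w) (k + n + n + n) w'
    g j = (if j = k then u else f j) ∧ g (j + n) = (if j = k then v else f (j + n)) ∧
    g (j + n + n) = (if j = k then w else f (j + n + n)) ∧
    g (j + n + n + n) = (if j = k then w' else f (j + n + n + n)) := by
  intro g
  simp only [g, Function.update_apply]
  by_cases h : j = k
  · subst h
    refine ⟨?_, ?_, ?_, ?_⟩ <;> repeat' split_ifs
    all_goals first | rfl | omega
  · refine ⟨?_, ?_, ?_, ?_⟩ <;> repeat' split_ifs
    all_goals first | rfl | omega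

theorem runs_branchLoop {n : ℕ} {M : Market n} {s : State} (hM : Loaded M s) :
    Runs (forLoop 13 (nv 0) branchStep) s ((n + 1) * 400) fun s' =>
      M.Branches (s.real 4 0) (s'.real 14) (s'.real 15) (s'.real 16) (s'.real 17) := by
  refine (Runs.forLoop (B := n) (T := Prog.maxCost _) (fun k s' => ∀ i, i < k →
    (s'.real 14 i = M.R / 2 + (M.initial.real 0 i - s.real 4 0) ∧
      s'.real 15 i = M.R / 2 - (M.initial.real 0 i - s.real 4 0) ∧
      s'.real 16 i = M.initial.real 1 i ∧ s'.real 17 i = 1) ∧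
    (s'.real 14 (i + n) = M.R / 2 - (M.initial.real 0 i - s.real 4 0) ∧
      s'.real 15 (i + n) = M.R / 2 + (M.initial.real 0 i - s.real 4 0) ∧
      s'.real 16 (i + n) = M.initial.real 1 i ∧ s'.real 17 (i + n) = 1) ∧
    (s'.real 14 (i + n + n) = M.R / 2 - (M.initial.real 0 i - s.real 4 0) ∧
      s'.real 15 (i + n + n) = M.R / 2 + (M.initial.real 0 i - s.real 4 0) ∧
      s'.real 16 (i + n + n) = -M.initial.real 1 i ∧ s'.real 17 (i + n + n) = -1) ∧
    (s'.real 14 (i + n + n + n) = M.R / 2 + (M.initial.real 0 i - s.real 4 0) ∧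
      s'.real 15 (i + n + n + n) = M.R / 2 - (M.initial.real 0 i - s.real 4 0) ∧
      s'.real 16 (i + n + n + n) = -M.initial.real 1 i ∧ s'.real 17 (i + n + n + n) = -1))
    (fun s' ha => ?_) ?_ (fun k s₁ hk h13 ha hI => Runs.of_wp ?_)).mono ?_ fun s' ha h => h
  · simp [ha.nat 0 rfl, hM.n_eq]
  · simp
  · have e0 : s₁.nat 0 0 = n := by rw [ha.nat 0 rfl, hM.n_eq]
    have f0 : s₁.real 0 = M.initial.real 0 := by rw [ha.real 0 rfl, hM.x_eq]
    have f1 : s₁.real 1 = M.initial.real 1 := by rw [ha.real 1 rfl, hM.y_eq]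
    have f3 : s₁.real 3 0 = M.R := by rw [ha.real 3 rfl, hM.R_eq]
    have f4 : s₁.real 4 = s.real 4 := ha.real 4 rfl
    simp only [branchStep, Prog.wp, NExpr.eval, RExpr.eval, State.setReal_nat, State.setReal_real,
      State.setNat_real, h13, e0, f0, f1, f3, f4]
    simp only [if_true, if_false, Function.update_self, Nat.reduceEqDiff, Int.cast_ofNat, f3]
    refine ⟨trivial, fun i hi => ?_⟩
    have hin : i < n := by omega
    obtain ⟨a1, a2, a3, a4⟩ := update_four (s₁.real 14)
      (M.R / 2 + (M.initial.real 0 k - s.real 4 0)) (M.R / 2 - (M.initial.real 0 k - s.real 4 0))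
      (M.R / 2 - (M.initial.real 0 k - s.real 4 0)) (M.R / 2 + (M.initial.real 0 k - s.real 4 0))
      hk hin
    obtain ⟨b1, b2, b3, b4⟩ := update_four (s₁.real 15)
      (M.R / 2 - (M.initial.real 0 k - s.real 4 0)) (M.R / 2 + (M.initial.real 0 k - s.real 4 0))
      (M.R / 2 + (M.initial.real 0 k - s.real 4 0)) (M.R / 2 - (M.initial.real 0 k - s.real 4 0))
      hk hin
    obtain ⟨c1, c2, c3, c4⟩ := update_four (s₁.real 16) (M.initial.real 1 k)
      (M.initial.real 1 k) (((0 : ℤ) : ℝ) - M.initial.real 1 k)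
      (((0 : ℤ) : ℝ) - M.initial.real 1 k) hk hin
    obtain ⟨d1, d2, d3, d4⟩ := update_four (s₁.real 17) ((1 : ℤ) : ℝ) ((1 : ℤ) : ℝ)
      ((-1 : ℤ) : ℝ) ((-1 : ℤ) : ℝ) hk hin
    rw [a1, a2, a3, a4, b1, b2, b3, b4, c1, c2, c3, c4, d1, d2, d3, d4]
    by_cases hik : i = k
    · subst hik
      simp
    · simp only [if_neg hik]
      exact hI i (by omega)
  · simp [branchStep, Prog.maxCost, NExpr.cost, RExpr.cost]

/-- At first all columns of all rows are searched. -/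
def rangeStep : Prog := .seq (.nset 16 (nv 13) (.lit 0)) (.nset 17 (nv 13) (nv 0))

theorem runs_rangeLoop {n Q : ℕ} {s : State} (hn : s.nat 0 0 = n) (hQ : s.nat 21 0 = Q) :
    Runs (forLoop 13 (nv 21) rangeStep) s ((Q + 1) * 100) fun s' => ∀ q, q < Q →
      s'.nat 16 q = 0 ∧ s'.nat 17 q = n := by
  refine (Runs.forLoop (B := Q) (T := Prog.maxCost _) (fun k s' => ∀ q, q < k →
      s'.nat 16 q = 0 ∧ s'.nat 17 q = n)
    (fun s' ha => ?_) ?_ (fun k s₁ hk h13 ha hI => Runs.of_wp ?_)).mono ?_ fun s' ha h => h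
  · simp [ha.nat 21 rfl, hQ]
  · simp
  · have e0 : s₁.nat 0 0 = n := by rw [ha.nat 0 rfl, hn]
    simp [rangeStep, h13, e0, Function.update_apply]
    intro q hq
    exact ⟨fun h => (hI q (by omega)).1, fun h => (hI q (by omega)).2⟩
  · simp [rangeStep, Prog.maxCost, NExpr.cost]

/-- Finds a height at which the captures cross. -/
def searchProg : Prog :=
  .seq (forLoop 13 (nv 0) branchStep)
  (.seq (forLoop 13 (nv 21) rangeStep)
  (.seq (.rset 22 (.lit 0) (rv 11))
  (.seq evalProg (.loop openTest roundProg))))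

/-- The number of rounds: `4n²` cells shrink by the factor `3 / 4` in each round, and
`(4 / 3) ^ 3 > 2`. -/
theorem four_mul_sq_lt (n : ℕ) :
    4 * (n * n) * 3 ^ (6 * (Nat.log 2 n + 1) + 6) < 4 ^ (6 * (Nat.log 2 n + 1) + 6) := by
  generalize hL : Nat.log 2 n + 1 = L
  have h1 : n < 2 ^ L := by rw [← hL]; exact Nat.lt_pow_succ_log_self (by norm_num) n
  have h2 : 4 * (n * n) < 2 ^ (2 * L + 2) := by
    have : n * n < 2 ^ L * 2 ^ L := Nat.mul_self_lt_mul_self h1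
    have e : 2 ^ (2 * L + 2) = 4 * (2 ^ L * 2 ^ L) := by ring
    omega
  calc 4 * (n * n) * 3 ^ (6 * L + 6) < 2 ^ (2 * L + 2) * 3 ^ (6 * L + 6) :=
        Nat.mul_lt_mul_of_pos_right h2 (by positivity)
    _ = (2 * 27) ^ (2 * L + 2) := by
        rw [show 6 * L + 6 = 3 * (2 * L + 2) by ring, pow_mul 3, mul_pow]; norm_num
    _ ≤ 64 ^ (2 * L + 2) := Nat.pow_le_pow_left (by norm_num) _
    _ = 4 ^ (6 * L + 6) := by
        rw [show 6 * L + 6 = 3 * (2 * L + 2) by ring, pow_mul 4]; norm_num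

theorem runs_searchProg : ∃ c : ℕ, ∀ (n : ℕ) (M : Market n) (a : ℝ) (s : State), 1 ≤ n →
    M.Admissible → Prepared M s → s.real 4 0 = a →
    Runs searchProg s (c * (n * (Nat.log 2 n + 1) * (Nat.log 2 n + 1))) fun s' =>
      Evaluated M s' ∧ ¬ openTest.Holds s' := by
  obtain ⟨c₁, h₁⟩ := runs_evalProg
  obtain ⟨c₂, h₂⟩ := runs_roundProg
  refine ⟨c₁ + 12 * c₂ + 3000, fun n M a s hn hM hP ha => ?_⟩
  have key : Runs searchProg s ((n + 1) * 400 + ((n + n + n + n + 1) * 100 +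
      (Prog.maxCost (.rset 22 (.lit 0) (rv 11)) + (c₁ * (n * (Nat.log 2 n + 1)) +
      ((6 * (Nat.log 2 n + 1) + 6) * (openTest.cost + c₂ * (n * (Nat.log 2 n + 1))) +
        openTest.cost))))) fun s' => Evaluated M s' ∧ ¬ openTest.Holds s' := by
    refine (runs_branchLoop hP.loaded).seq fun s₁ ha₁ e₁ =>
      (runs_rangeLoop (n := n) (Q := n + n + n + n) (by rw [ha₁.nat 0 rfl, hP.loaded.n_eq])
        (by rw [ha₁.nat 21 rfl, hP.rowCount])).seq fun s₂ ha₂ e₂ =>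
      (Runs.of_wp (p := .rset 22 (.lit 0) (rv 11)) (Q := fun s' => s' = _) rfl).seq
      fun s₃ ha₃ e₃ => ?_
    have hs₃ : Tabled M a s₃ := by
      refine ⟨((hP.of_agree ha₁ rfl).of_agree ha₂ rfl).of_agree ha₃ rfl, ?_, ?_⟩
      · rw [ha₃.real 4 rfl, ha₂.real 4 rfl, ha₁.real 4 rfl, ha]
      · rw [ha₃.real 14 rfl, ha₃.real 15 rfl, ha₃.real 16 rfl, ha₃.real 17 rfl, ha₂.real 14 rfl,
          ha₂.real 15 rfl, ha₂.real 16 rfl, ha₂.real 17 rfl, ← ha]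
        exact e₁
    refine (h₁ n M s₃ hn hM hs₃.prepared.loaded).seq fun s₄ ha₄ e₄ => ?_
    have hs₄ := hs₃.of_agree ha₄ rfl
    have h16 : s₄.nat 16 = s₂.nat 16 := by rw [ha₄.nat 16 rfl, ha₃.nat 16 rfl]
    have h17 : s₄.nat 17 = s₂.nat 17 := by rw [ha₄.nat 17 rfl, ha₃.nat 17 rfl]
    have h22 : s₄.real 22 0 = s₄.real 11 0 := by
      rw [ha₄.real 22 rfl, ha₄.real 11 rfl, ha₃.real 11 rfl, e₃]
      simp
    refine (Runs.loop (T := c₂ * (n * (Nat.log 2 n + 1))) (m := 6 * (Nat.log 2 n + 1) + 6)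
      (fun m s' => Evaluated M s' ∧ Searching M a s' ∧ cells n s' * 3 ^ m < 4 ^ m)
      (fun m s₅ ha₅ hI hb => ?_) ⟨e₄, ⟨?_, ?_⟩, ?_⟩).mono le_rfl
      fun s₅ _ h => ⟨h.2.choose_spec.1, h.1⟩
    · obtain ⟨hev, hS, hcells⟩ := hI
      have hs₅ := hs₄.of_agree ha₅ rfl
      have hpos := (hS.cells_pos hM hs₅ hev hb).1
      rcases m with _ | m
      · simp only [pow_zero] at hcells; omega
      · refine ⟨m, rfl, (h₂ n M a s₅ hn hM hs₅ hev hS hb).mono le_rfl fun s₆ _ h =>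
          ⟨h.1, h.2.1, ?_⟩⟩
        have := Nat.mul_le_mul_right (3 ^ m) h.2.2
        rw [pow_succ, pow_succ] at hcells
        linarith
    · intro q hq; rw [h17, (e₂ q hq).2]
    · refine (hs₄.exists_crossing hM).imp (fun h => h22 ▸ h) ?_
      rintro ⟨q, k, hq, hk, hc⟩
      exact ⟨q, k, hq, by rw [h16, (e₂ q hq).1]; exact Nat.zero_le _, by rwa [h17, (e₂ q hq).2], hc⟩
    · have hc : cells n s₄ = 4 * (n * n) := by
        rw [cells, Finset.sum_congr rfl (g := fun _ => n)]
        · simp; ring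
        · intro q hq
          rw [h16, h17, (e₂ q (Finset.mem_range.1 hq)).1, (e₂ q (Finset.mem_range.1 hq)).2]
          rfl
      rw [hc]
      exact four_mul_sq_lt n
  refine key.mono ?_ fun _ _ h => h
  simp only [Prog.maxCost, NExpr.cost, RExpr.cost, openTest, Test.cost]
  obtain ⟨L, hL⟩ : ∃ L, L = Nat.log 2 n + 1 := ⟨_, rfl⟩
  have hL1 : 1 ≤ L := by omega
  rw [← hL]
  have h1 : n * L ≤ n * L * L := Nat.le_mul_of_pos_right _ hL1
  have h2 : n ≤ n * L := Nat.le_mul_of_pos_right _ hL1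
  have h3 : L ≤ n * L := Nat.le_mul_of_pos_left _ hn
  have h4 := Nat.mul_le_mul_left c₁ h1
  have h5 := Nat.mul_le_mul_left c₂ h1
  nlinarith

/-! ### The query algorithm -/

/-- Outputs the height found and the side of the line to be discarded. -/
def outputProg : Prog :=
  .seq (.rset 5 (.lit 0) (rv 4))
  (.seq (.rset 5 (.lit 1) (rv 22))
  (.ite (.rlt (rv 30) (rv 32))
    (.ite (.rlt (rv 42) (rv 41)) (.nset 1 (.lit 0) (.lit 1)) (.nset 1 (.lit 0) (.lit 0)))
    (.ite (.rlt (rv 40) (rv 43)) (.nset 1 (.lit 0) (.lit 0)) (.nset 1 (.lit 0) (.lit 1)))))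

/-- The output is correct for the line with abscissa `a`. -/
def Answers {n : ℕ} (M : Market n) (a : ℝ) (s : State) : Prop :=
  s.foundPoint 0 = a ∧ ∀ x ∈ s.prunedSide.halfPlane a, M.weightLoss s.foundPoint ≤ M.weightLoss x

/-- If the captures do not prevail in either direction, then the point found loses the larger of the
two captures, and the pruning criterion applies to the half-circle where it is attained. -/
theorem Evaluated.answers {n : ℕ} {M : Market n} {s s' : State} (h : Evaluated M s)
    (hM : M.Admissible) (ho : ¬ openTest.Holds s) (h0 : s'.real 5 0 = s.real 4 0)
    (h1 : s'.real 5 1 = s.real 22 0)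
    (hside : s.real 32 0 ≤ s.real 30 0 ∧
        (s.real 40 0 < s.real 43 0 ∧ s'.nat 1 0 = 0 ∨
          s.real 43 0 ≤ s.real 40 0 ∧ s'.nat 1 0 ≠ 0) ∨
      s.real 30 0 ≤ s.real 32 0 ∧
        (s.real 42 0 < s.real 41 0 ∧ s'.nat 1 0 ≠ 0 ∨
          s.real 41 0 ≤ s.real 42 0 ∧ s'.nat 1 0 = 0)) : Answers M (s.real 4 0) s' := by
  have hx : s'.foundPoint 0 = s.real 4 0 := h0
  have hy : s'.foundPoint 1 = s.real 22 0 := h1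
  refine ⟨hx, fun x hxs => ?_⟩
  have ho' : s.real 30 0 ≤ s.real 33 0 ∧ s.real 32 0 ≤ s.real 31 0 := by
    simpa [openTest] using ho
  have hleft : s'.nat 1 0 = 0 → x 0 < s.real 4 0 := fun h => by
    rw [State.prunedSide, if_pos h] at hxs; exact hxs
  have hright : s'.nat 1 0 ≠ 0 → s.real 4 0 < x 0 := fun h => by
    rw [State.prunedSide, if_neg h] at hxs; exact hxs
  rcases hside with ⟨hle, hside⟩ | ⟨hle, hside⟩
  · refine (hM.weightLoss_le _ hx (v := s.real 30 0) (fun u hu => h.up.le u (by rwa [hy] at hu))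
      fun u hu => (h.down.le u (by rwa [hy] at hu)).trans hle).trans ?_
    refine hM.prune (a := s.real 4 0) (σ := 1) (y := s.real 22 0) (by norm_num)
      (by simpa using h.up) (by simpa using h.downBelow) ho'.1 x ?_
    rcases hside with ⟨h2, h3⟩ | ⟨h2, h3⟩
    · exact Or.inl ⟨h2, by linarith [hleft h3]⟩
    · exact Or.inr ⟨h2, by linarith [hright h3]⟩
  · refine (hM.weightLoss_le _ hx (v := s.real 32 0)
      (fun u hu => (h.up.le u (by rwa [hy] at hu)).trans hle)
      fun u hu => h.down.le u (by rwa [hy] at hu)).trans ?_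
    refine hM.prune (a := s.real 4 0) (σ := -1) (y := s.real 22 0) (by norm_num)
      (by simpa using h.down) (by simpa using h.upBelow) ho'.2 x ?_
    rcases hside with ⟨h2, h3⟩ | ⟨h2, h3⟩
    · exact Or.inl ⟨h2, by linarith [hright h3]⟩
    · exact Or.inr ⟨h2, by linarith [hleft h3]⟩

theorem runs_outputProg {n : ℕ} {M : Market n} {s : State} (h : Evaluated M s)
    (hM : M.Admissible) (ho : ¬ openTest.Holds s) :
    Runs outputProg s 100 (Answers M (s.real 4 0)) := by
  refine (Runs.of_wp ?_).mono (T := outputProg.maxCost)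
    (by simp [outputProg, Prog.maxCost, NExpr.cost, RExpr.cost, Test.cost]) fun _ _ h => h
  simp only [outputProg, Prog.wp, Test.Holds, RExpr.eval, NExpr.eval,
    State.setReal_real, Nat.reduceEqDiff, if_false]
  refine ⟨fun hlt => ⟨fun hl => ?_, fun hl => ?_⟩, fun hlt => ⟨fun hl => ?_, fun hl => ?_⟩⟩ <;>
    refine h.answers hM ho (by simp) (by simp) ?_
  · exact Or.inr ⟨hlt.le, Or.inl ⟨hl, by simp⟩⟩
  · exact Or.inr ⟨hlt.le, Or.inr ⟨not_lt.1 hl, by simp⟩⟩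
  · exact Or.inl ⟨not_lt.1 hlt, Or.inl ⟨hl, by simp⟩⟩
  · exact Or.inl ⟨not_lt.1 hlt, Or.inr ⟨not_lt.1 hl, by simp⟩⟩

/-- The query algorithm. -/
def queryProg : Prog := .seq searchProg outputProg

theorem runs_queryProg : ∃ c : ℕ, ∀ (n : ℕ) (M : Market n) (a : ℝ) (s : State), 1 ≤ n →
    M.Admissible → Prepared M s → s.real 4 0 = a →
    Runs queryProg s (c * (n * (Nat.log 2 n + 1) * (Nat.log 2 n + 1))) fun s' =>
      Prepared M s' ∧ Answers M a s' := by
  obtain ⟨c, hc⟩ := runs_searchProg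
  refine ⟨c + 100, fun n M a s hn hM hP ha => ?_⟩
  refine ((hc n M a s hn hM hP ha).seq fun s₁ ha₁ h =>
    (runs_outputProg h.1 hM h.2).mono le_rfl fun s' _ h' => show Answers M a s' from ?_).mono ?_
    fun s' ha' h => ⟨hP.of_agree ha' rfl, h⟩
  · rwa [ha₁.real 4 rfl, ha] at h'
  · have : 1 ≤ n * (Nat.log 2 n + 1) * (Nat.log 2 n + 1) :=
      Nat.mul_pos (Nat.mul_pos hn (by omega)) (by omega)
    linarith

theorem Prepared.query {n : ℕ} {M : Market n} {s : State} (h : Prepared M s) (a : ℝ) :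
    Prepared M (s.query a) := by
  refine h.of_agree (p := .rset 4 (.lit 0) (.lit 0)) ⟨fun _ _ => rfl, fun k hk => ?_⟩ rfl
  have : k ≠ 4 := by rintro rfl; simp [Prog.keepsReal] at hk
  simp [State.query, this]

/-- Both summands are at most `log (n + 1) / log 2`, and `2 / log 2 ≤ 3`. -/
theorem log_two_le {n : ℕ} (hn : 1 ≤ n) :
    ((Nat.log 2 n + 1 : ℕ) : ℝ) ≤ 3 * Real.log ((n : ℝ) + 1) := by
  have hn' : (1 : ℝ) ≤ n := by exact_mod_cast hn
  have h1 : (Nat.log 2 n : ℝ) * Real.log 2 ≤ Real.log ((n : ℝ) + 1) := by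
    rw [← Real.log_pow]
    refine Real.log_le_log (by positivity) ?_
    have : 2 ^ Nat.log 2 n ≤ n := Nat.pow_log_le_self 2 (by omega)
    have : ((2 : ℝ)) ^ Nat.log 2 n ≤ n := by exact_mod_cast this
    linarith
  have h2 : Real.log 2 ≤ Real.log ((n : ℝ) + 1) := Real.log_le_log (by norm_num) (by linarith)
  have h3 := Real.log_two_gt_d9
  have h4 : (0 : ℝ) ≤ Nat.log 2 n := Nat.cast_nonneg _
  push_cast
  nlinarith

theorem mainTheorem3 :
    ∃ (pre qry : Prog) (C : ℝ), 0 < C ∧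
      ∀ (n : ℕ) (M : Market n), 1 ≤ n → M.Admissible →
        (∃ (t : ℕ) (s : State), Exec pre M.initial t s ∧
          (t : ℝ) ≤ C * ((n : ℝ) ^ 2 * Real.log ((n : ℝ) + 1))) ∧
        ∀ s : State, Ready pre qry M s → ∀ a : ℝ,
          ∃ (t : ℕ) (s' : State), Exec qry (s.query a) t s' ∧
            (t : ℝ) ≤ C * ((n : ℝ) * Real.log ((n : ℝ) + 1) ^ 2) ∧
            s'.foundPoint 0 = a ∧
            ∀ x ∈ s'.prunedSide.halfPlane a,
              M.weightLoss s'.foundPoint ≤ M.weightLoss x := by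
  obtain ⟨c₁, h₁⟩ := runs_preProg
  obtain ⟨c₂, h₂⟩ := runs_queryProg
  refine ⟨preProg, queryProg, 3 * c₁ + 9 * c₂ + 1, by positivity, fun n M hn hM => ?_⟩
  have hlog := log_two_le hn
  have hlog0 : 0 ≤ Real.log ((n : ℝ) + 1) := Real.log_nonneg (by simp)
  have hquery : ∀ s, Prepared M s → ∀ a, Runs queryProg (s.query a) _ _ := fun s hs a =>
    h₂ n M a (s.query a) hn hM (hs.query a) (by simp [State.query])
  have hready : ∀ s, Ready preProg queryProg M s → Prepared M s := by
    intro s hs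
    induction hs with
    | start he =>
      obtain ⟨t', s', he', -, h⟩ := h₁ n M hn
      exact (he.deterministic he').2 ▸ h
    | next _ he ih =>
      obtain ⟨t', s', he', -, h⟩ := hquery _ ih _
      exact (he.deterministic he').2 ▸ h.1
  constructor
  · obtain ⟨t, s, he, ht, -⟩ := h₁ n M hn
    refine ⟨t, s, he, ?_⟩
    calc (t : ℝ) ≤ ((c₁ * (n * (n * (Nat.log 2 n + 1))) : ℕ) : ℝ) := by exact_mod_cast ht
      _ = c₁ * (n : ℝ) ^ 2 * ((Nat.log 2 n + 1 : ℕ) : ℝ) := by push_cast; ring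
      _ ≤ c₁ * (n : ℝ) ^ 2 * (3 * Real.log ((n : ℝ) + 1)) := by gcongr
      _ = 3 * c₁ * ((n : ℝ) ^ 2 * Real.log ((n : ℝ) + 1)) := by ring
      _ ≤ _ := by
        gcongr
        linarith [(Nat.cast_nonneg c₂ : (0 : ℝ) ≤ c₂)]
  · intro s hs a
    obtain ⟨t, s', he, ht, -, h⟩ := hquery s (hready s hs) a
    refine ⟨t, s', he, ?_, h⟩
    calc (t : ℝ) ≤ ((c₂ * (n * (Nat.log 2 n + 1) * (Nat.log 2 n + 1)) : ℕ) : ℝ) := by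
          exact_mod_cast ht
      _ = c₂ * n * ((Nat.log 2 n + 1 : ℕ) : ℝ) ^ 2 := by push_cast; ring
      _ ≤ c₂ * n * (3 * Real.log ((n : ℝ) + 1)) ^ 2 := by gcongr
      _ = 9 * c₂ * ((n : ℝ) * Real.log ((n : ℝ) + 1) ^ 2) := by ring
      _ ≤ _ := by
        gcongr
        linarith [(Nat.cast_nonneg c₁ : (0 : ℝ) ≤ c₁)]
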